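/- Let $\sigma>0$ and $\kappa>0$. There is a constant $C>0$, depending only on $\sigma$ and $\kappa$, such that the following holds. **Model.** Let $d\in\mathbb N$, $\mathcal X\subset\mathbb R^d$, and let $f$ be a centred Gaussian process on $\mathcal X$ with covariance function $k$ satisfying $\kappa\le k(x,x)\le 1$ for all $x\in\mathcal X$. In round $t=1,2,\dots$ a point $x_t\in\mathcal X$ is chosen as a measurable function of the previous observations $y_1,\dots,y_{t-1}$ (and of the previous queries) and possibly of extra randomness independent of $f$ and of the noise (e.g. for breaking ties), and $y_t=f(x_t)+\epsilon_t$ is observed, where $\epsilon_1,\epsilon_2,\dots$ are i.i.d. $N(0,\sigma^2)$ and independent of $f$. Let $$\mu_{t-1}(x)=\mathbf k_{t-1}(x)^\top(\mathbf K+\sigma^2 I)^{-1}\mathbf y_{t-1},\qquad \sigma_{t-1}^2(x)=k(x,x)-\mathbf k_{t-1}(x)^\top(\mathbf K+\sigma^2 I)^{-1}\mathbf k_{t-1}(x)$$ be the posterior mean and variance given the first $t-1$ observations, where $\mathbf k_{t-1}(x)=(k(x,x_i))_{i<t}$, $\mathbf K=(k(x_i,x_j))_{i,j<t}$ and $\mathbf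 y_{t-1}=(y_i)_{i<t}$. Let $$\gamma_T=\sup_{a_1,\dots,a_T\in\mathcal X} I\bigl((f(a_i)+\epsilon_i)_{i\le T};(f(a_i))_{i\le T}\bigr)$$ be the maximum information gain ($I$ is Shannon mutual information, repetitions among the $a_i$ are allowed), and let $R_T=\sum_{t=1}^T\bigl(\sup_{x\in\mathcal X}f(x)-f(x_t)\bigr)$ be the cumulative regret. **Domain and confidence parameter.** Let $\delta\in(0,1)$, and suppose that one of the following holds. (i) $\mathcal X$ is finite, and $\beta_t(\delta)=2\log\bigl(|\mathcal X|\,t^2\pi^2/(6\delta)\bigr)$. (ii) $\mathcal X$ is a compact convex subset of $[0,r]^d$ with $r>0$, the sample paths of $f$ are almost surely differentiable on $\mathcal X$, and there are $a\ge1$, $b>0$ such that $L_j=\sup_{x\in\mathcal X}|\partial f/\partial x_j|$ satisfies $\Pr(L_j>c)\le a\,e^{-(c/b)^2}$ for all $c>0$ and $j=1,\dots,d$; and $$\beta_t(\delta)=2\log\frac{\pi^2t^2}{3\delta}+2d\log\Bigl(\Bigl\lceil bdrt^2\sqrt{\log(4ad/\delta)}\Bigr\rceil+t\Bigr).$$ **Algorithm.**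 Let $\mathrm{EI}(m,s,b)=s\,\tau((m-b)/s)$ if $s>0$ and $\mathrm{EI}(m,0,b)=\max\{m-b,0\}$, where $\tau(c)=c\,\Phi(c)+\phi(c)$ and $\Phi,\phi$ are the standard Gaussian distribution function and density. Suppose that, almost surely, for every $t\ge1$, $$x_t\in\operatorname*{arg\,max}_{x\in\mathcal X}\ \mathrm{EI}\bigl(\mu_{t-1}(x),\ \beta_t(\delta)^{1/2}\sigma_{t-1}(x),\ \tilde\mu^{\max}_{t-1}\bigr),$$ where $\tilde\mu^{\max}_0=0$ and $\tilde\mu^{\max}_{t-1}=\max_{i<t}\mu_{t-1}(x_i)$ for $t\ge2$. **Conclusion.** With probability at least $1-\delta$, simultaneously for all $T\ge2$, $$R_T\le C\sqrt{\beta_T(\delta)\,\gamma_T\,T\log T}.$$ -/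

import Mathlib

open MeasureTheory ProbabilityTheory
open scoped NNReal ENNReal Matrix

namespace GPEI

noncomputable section

/-! ### Gaussian process posterior and expected improvement -/

/-- The regularized Gram matrix `K + σ² I` of the points `a 0, …, a (n - 1)`. -/
def regGram {S : Type*} (k : S → S → ℝ) (σ : ℝ≥0) {n : ℕ} (a : Fin n → S) :
    Matrix (Fin n) (Fin n) ℝ :=
  Matrix.of (fun i j => k (a i) (a j)) + ((σ : ℝ) ^ 2) • (1 : Matrix (Fin n) (Fin n) ℝ)

/-- Posterior mean at `s`, given the `n` noisy observations `y i` at the points `a i`. -/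
def postMean {S : Type*} (k : S → S → ℝ) (σ : ℝ≥0) {n : ℕ} (a : Fin n → S) (y : Fin n → ℝ)
    (s : S) : ℝ :=
  (fun i => k s (a i)) ⬝ᵥ ((regGram k σ a)⁻¹ *ᵥ y)

/-- Posterior variance at `s`, given `n` noisy observations at the points `a i`. -/
def postVar {S : Type*} (k : S → S → ℝ) (σ : ℝ≥0) {n : ℕ} (a : Fin n → S) (s : S) : ℝ :=
  k s s - (fun i => k s (a i)) ⬝ᵥ ((regGram k σ a)⁻¹ *ᵥ (fun i => k s (a i)))

/-- Posterior standard deviation. -/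
def postSd {S : Type*} (k : S → S → ℝ) (σ : ℝ≥0) {n : ℕ} (a : Fin n → S) (s : S) : ℝ :=
  Real.sqrt (postVar k σ a s)

/-- `τ(c) = c Φ(c) + φ(c)`, with `Φ`, `φ` the standard Gaussian distribution function and density. -/
def tau (c : ℝ) : ℝ :=
  c * cdf (gaussianReal 0 1) c + gaussianPDFReal 0 1 c

/-- Expected improvement `EI(m, s, b)` over the reference value `b`, for mean `m` and standard
deviation `s`. -/
def EI (m s b : ℝ) : ℝ :=
  if 0 < s then s * tau ((m - b) / s) else max (m - b) 0

/-- The reference value: the largest posterior mean among the `n` points evaluated so far,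
and `0` if there are none. -/
def refValue {S : Type*} (k : S → S → ℝ) (σ : ℝ≥0) {n : ℕ} (a : Fin n → S) (y : Fin n → ℝ) : ℝ :=
  if n = 0 then 0 else ⨆ i : Fin n, postMean k σ a y (a i)

/-! ### The Bayesian model -/

/-- `f` is a centred Gaussian process on `S` with covariance `k`; the noise variables `ε n` are
i.i.d. `N(0, σ²)` and independent of `f`; and `U`, the randomness available to the algorithm
(for instance for breaking ties), is independent of `(f, ε)`. -/
structure IsModel {S Ω 𝒰 : Type*} [MeasurableSpace Ω] [MeasurableSpace 𝒰] (P : Measure Ω)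
    (k : S → S → ℝ) (σ : ℝ≥0) (f : S → Ω → ℝ) (ε : ℕ → Ω → ℝ) (U : Ω → 𝒰) : Prop where
  measurable_f : ∀ s, Measurable (f s)
  gaussian_f : IsGaussianProcess f P
  mean_f : ∀ s, ∫ ω, f s ω ∂P = 0
  cov_f : ∀ s s', cov[f s, f s'; P] = k s s'
  measurable_noise : ∀ n, Measurable (ε n)
  law_noise : ∀ n, P.map (ε n) = gaussianReal 0 (σ ^ 2)
  indep_noise : iIndepFun ε P
  indep_f_noise : IndepFun (fun ω s => f s ω) (fun ω n => ε n ω) P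
  measurable_U : Measurable U
  indep_U : IndepFun U (fun ω => ((fun s => f s ω), (fun n => ε n ω))) P

/-- The observation at round `n` (rounds are numbered from `0`): `f` at the queried point
plus noise. -/
def obs {S Ω : Type*} (f : S → Ω → ℝ) (ε : ℕ → Ω → ℝ) (x : ℕ → Ω → S) (n : ℕ) (ω : Ω) : ℝ :=
  f (x n ω) ω + ε n ω

/-- Every query is a measurable function of the previous observations and of `U`. (The previous
queries are themselves such functions.) -/
def IsAdaptive {S Ω 𝒰 : Type*} [MeasurableSpace S] [MeasurableSpace 𝒰]
    (f : S → Ω → ℝ) (ε : ℕ → Ω → ℝ) (U : Ω → 𝒰) (x : ℕ → Ω → S) : Prop :=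
  ∃ π : (n : ℕ) → 𝒰 × (Fin n → ℝ) → S, (∀ n, Measurable (π n)) ∧
    ∀ n ω, x n ω = π n (U ω, fun i : Fin n => obs f ε x i ω)

/-- Almost surely, in every round the queried point maximizes over `S` the expected improvement
with posterior standard deviation rescaled by the square root of `β`. Round `n` is the `(n + 1)`-st
one, whence `β (n + 1)`, and `n` observations are available. -/
def IsScaledEI {S Ω : Type*} [MeasurableSpace Ω] (P : Measure Ω) (k : S → S → ℝ) (σ : ℝ≥0)
    (β : ℕ → ℝ) (f : S → Ω → ℝ) (ε : ℕ → Ω → ℝ) (x : ℕ → Ω → S) : Prop :=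
  ∀ᵐ ω ∂P, ∀ n : ℕ,
    let a : Fin n → S := fun i => x i ω
    let y : Fin n → ℝ := fun i => obs f ε x i ω
    let acq : S → ℝ := fun s =>
      EI (postMean k σ a y s) (Real.sqrt (β (n + 1)) * postSd k σ a s) (refValue k σ a y)
    ∀ s, acq s ≤ acq (x n ω)

/-- Cumulative regret of the first `T` rounds. -/
def regret {S Ω : Type*} (f : S → Ω → ℝ) (x : ℕ → Ω → S) (T : ℕ) (ω : Ω) : ℝ :=
  ∑ n ∈ Finset.range T, ((⨆ s, f s ω) - f (x n ω) ω)

/-! ### Maximum information gain -/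

/-- Shannon mutual information: the Kullback-Leibler divergence of the joint law from the
product of the marginal laws. -/
def mutualInfo {Ω A B : Type*} [MeasurableSpace Ω] [MeasurableSpace A] [MeasurableSpace B]
    (P : Measure Ω) (Y : Ω → A) (Z : Ω → B) : ℝ≥0∞ :=
  InformationTheory.klDiv (P.map (fun ω => (Y ω, Z ω))) ((P.map Y).prod (P.map Z))

/-- Maximum information gain: the supremum of `I(y_A ; f_A)` over all families
`A = (a 0, …, a (T - 1))` of points (repetitions allowed). -/
def maxInfoGain {S Ω : Type*} [MeasurableSpace Ω] (P : Measure Ω) (f : S → Ω → ℝ)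
    (ε : ℕ → Ω → ℝ) (T : ℕ) : ℝ≥0∞ :=
  ⨆ a : Fin T → S,
    mutualInfo P (fun ω (i : Fin T) => f (a i) ω + ε i ω) (fun ω (i : Fin T) => f (a i) ω)

/-! ### Continuous domains -/

/-- The domain `X` is a compact convex subset of `[0, r]^d`, the sample paths are almost surely
differentiable on `X`, and the suprema `L_j` over `X` of their partial derivatives satisfy
`P(L_j > c) ≤ a exp(-(c / b)²)` for `c > 0`. `D s ω` is the derivative of the path at `s`
(relative to `X`); it is unique if `X` has interior points. -/
def SmoothPaths {d : ℕ} {X : Set (Fin d → ℝ)} {Ω : Type*} [MeasurableSpace Ω] (P : Measure Ω)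
    (f : X → Ω → ℝ) (r a b : ℝ) : Prop :=
  0 < r ∧ 1 ≤ a ∧ 0 < b ∧
  IsCompact X ∧ Convex ℝ X ∧ X ⊆ Set.Icc 0 (fun _ => r) ∧
  ∃ D : X → Ω → (Fin d → ℝ) →L[ℝ] ℝ,
    (∀ᵐ ω ∂P, ∀ s : X,
      HasFDerivWithinAt (Function.extend Subtype.val (fun s' : X => f s' ω) 0) (D s ω) X s) ∧
    ∀ (j : Fin d) (c : ℝ), 0 < c →
      P {ω | ENNReal.ofReal c < ⨆ s : X, ‖D s ω (Pi.single j 1)‖ₑ} ≤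
        ENNReal.ofReal (a * Real.exp (-(c / b) ^ 2))

/-! ### Confidence parameters -/

/-- `β_t(δ)` for a finite domain with `N` points. -/
def betaFinite (N : ℕ) (δ : ℝ) (t : ℕ) : ℝ :=
  2 * Real.log (N * t ^ 2 * Real.pi ^ 2 / (6 * δ))

/-- `β_t(δ)` for a continuous domain. -/
def betaCont (d : ℕ) (r a b δ : ℝ) (t : ℕ) : ℝ :=
  2 * Real.log (Real.pi ^ 2 * t ^ 2 / (3 * δ)) +
    2 * d * Real.log ((⌈b * d * r * t ^ 2 * Real.sqrt (Real.log (4 * a * d / δ))⌉₊ : ℝ) + t)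

end

end GPEI

/-!
High-probability regret bound for Gaussian process optimization with expected improvement, where the
reference value is the best posterior mean at the evaluated points and the posterior standard
deviation is scaled by `√β`.

*Deterministic part.* Fix a path on which the posterior confidence bounds `|f s - μ s| ≤ √β σ s`
hold at all queries and at points that nearly maximize `f`. Expected improvement is comparable to
the upper confidence excess: it is at least `Φ(-1) (f s - b)` at every such point `s`
(`cdf_mul_sub_le_EI`), and at the query it is at most `(μ - b)⁺ + √β σ` (`EI_le`). Hence the
regret of a round is controlled by the improvement `(μ - b)⁺` of the mean at the query over the
reference value and by the width `√β σ`. The improvements telescope along the rounds. If instead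
`μ < b` at the query, comparison with an evaluated point that attains the reference value bounds
`(b - μ) / (√β σ)` by the square root of the logarithm of a ratio of posterior variances
(`sub_le_of_EI_le`), which is of order `log T` because a posterior variance after `n` observations
is at least of order `1 / n` (`le_postVar`); this produces the factor `√(log T)`. The outcome is
`ConfidentRun.sum_regret_le`. The sum of the posterior standard deviations at the queries is
bounded by Cauchy-Schwarz and the information gain, which is a sum of logarithms of posterior
variances (`IsModel.mutualInfo_eq`, by writing both the joint and the marginal densities of the
observations as products over successive observations).

*Probabilistic part.* The confidence bounds hold at a fixed point and for fixed queries since the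
residual `f s - μ s` is Gaussian and independent of the observations. To reach adaptive queries,
the density of the observations given the path and the extra randomness is written out
(`lintegral_eq_lintegral_likelihood`): it is the density for the fixed design that the strategy
would have chosen from these observations. The Gaussian tail bound for a fixed design, stated for
the posterior at every value of the observations and not only at almost every one
(`IsModel.lintegral_tail_le`), can then be integrated (`IsModel.measure_tail_le`). A union bound
over the points of a finite domain, or over the queries and the points of a grid that becomes finer
with the rounds, completes the proof; in the second case the paths are Lipschitz with high
probability.
-/

namespace GPEI

/-! ### Expected improvement and the Gaussian tail -/

lemma gaussianPDFReal_std (x : ℝ) :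
    gaussianPDFReal 0 1 x = gaussianPDFReal 0 1 0 * Real.exp (-x ^ 2 / 2) := by
  simp [gaussianPDFReal]

lemma gaussianPDFReal_std_zero_pos : 0 < gaussianPDFReal 0 1 0 :=
  gaussianPDFReal_pos _ _ _ one_ne_zero

lemma gaussianPDFReal_std_zero_le_one : gaussianPDFReal 0 1 0 ≤ 1 := by
  have h : 1 ≤ √(2 * Real.pi) := by
    rw [Real.one_le_sqrt]
    nlinarith [Real.pi_gt_three]
  simp only [gaussianPDFReal, NNReal.coe_one, mul_one, sub_zero, ne_eq, OfNat.ofNat_ne_zero,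
    not_false_eq_true, zero_pow, neg_zero, zero_div, Real.exp_zero]
  exact inv_le_one_of_one_le₀ h

lemma hasDerivAt_gaussianPDFReal_std (x : ℝ) :
    HasDerivAt (gaussianPDFReal 0 1) (gaussianPDFReal 0 1 x * (-x)) x := by
  have h : HasDerivAt (fun x : ℝ => gaussianPDFReal 0 1 0 * Real.exp (-x ^ 2 / 2))
      (gaussianPDFReal 0 1 0 * (Real.exp (-x ^ 2 / 2) * (-(2 * x) / 2))) x := by
    have := ((hasDerivAt_pow 2 x).fun_neg.div_const 2).exp.const_mul (gaussianPDFReal 0 1 0)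
    simpa using this
  convert! h using 1
  · funext y; exact gaussianPDFReal_std y
  · rw [gaussianPDFReal_std x]; ring

lemma integrable_id_gaussianReal_std : Integrable (fun x : ℝ => x) (gaussianReal 0 1) :=
  (memLp_id_gaussianReal (μ := 0) (v := 1) 1).integrable (by simp)

lemma setIntegral_neg_id_gaussianReal_std (c : ℝ) :
    ∫ x in Set.Iic c, -x ∂(gaussianReal 0 1) = gaussianPDFReal 0 1 c := by
  have hint : Integrable (fun x => gaussianPDFReal 0 1 x * (-x)) volume := by
    have h := integrable_id_gaussianReal_std.neg
    rw [gaussianReal_of_var_ne_zero _ one_ne_zero,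
      integrable_withDensity_iff_integrable_smul' (measurable_gaussianPDF _ _)
        (ae_of_all _ fun _ => gaussianPDF_lt_top)] at h
    simpa [toReal_gaussianPDF] using h
  have hlim : Filter.Tendsto (gaussianPDFReal 0 1) Filter.atBot (nhds 0) := by
    have h1 : Filter.Tendsto (fun x : ℝ => gaussianPDFReal 0 1 0 * Real.exp (-x ^ 2 / 2))
        Filter.atBot (nhds (gaussianPDFReal 0 1 0 * 0)) := by
      refine Filter.Tendsto.const_mul _ (Real.tendsto_exp_atBot.comp ?_)
      have h2 : Filter.Tendsto (fun x : ℝ => x ^ 2) Filter.atBot Filter.atTop := by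
        simpa [Function.comp_def] using
          (Filter.tendsto_pow_atTop (α := ℝ) two_ne_zero).comp Filter.tendsto_neg_atBot_atTop
      have := (h2.atTop_div_const (r := (2 : ℝ)) two_pos)
      simpa [neg_div, Function.comp_def] using Filter.tendsto_neg_atTop_atBot.comp this
    rw [mul_zero] at h1
    exact h1.congr fun x => (gaussianPDFReal_std x).symm
  have key := integral_Iic_of_hasDerivAt_of_tendsto' (a := c)
    (fun x _ => hasDerivAt_gaussianPDFReal_std x) hint.integrableOn hlim
  rw [sub_zero] at key
  rw [← key, ← integral_indicator measurableSet_Iic, ← integral_indicator measurableSet_Iic,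
    integral_gaussianReal_eq_integral_smul one_ne_zero]
  refine integral_congr_ae (ae_of_all _ fun x => ?_)
  by_cases hx : x ∈ Set.Iic c <;> simp [hx]

lemma integrable_max_sub (c : ℝ) : Integrable (fun x : ℝ => max (c - x) 0) (gaussianReal 0 1) :=
  ((integrable_const c).sub integrable_id_gaussianReal_std).pos_part

/-- The representation `τ(c) = E[(c - N)⁺]` with `N` standard Gaussian. -/
lemma tau_eq_integral (c : ℝ) : tau c = ∫ x, max (c - x) 0 ∂(gaussianReal 0 1) := by
  have h : ∀ x : ℝ, max (c - x) 0 = (Set.Iic c).indicator (fun x => c + -x) x := by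
    intro x
    by_cases hx : x ≤ c
    · simp [hx, sub_eq_add_neg]
    · simp [hx, (not_le.1 hx).le]
  simp_rw [h]
  have hi : Integrable (fun x : ℝ => -x) (gaussianReal 0 1) := integrable_id_gaussianReal_std.neg
  rw [integral_indicator measurableSet_Iic, integral_add (integrable_const c).integrableOn
    hi.integrableOn, setIntegral_neg_id_gaussianReal_std,
    setIntegral_const, tau, cdf_eq_real, smul_eq_mul, mul_comm]

lemma tau_nonneg (c : ℝ) : 0 ≤ tau c := by
  rw [tau_eq_integral]
  exact integral_nonneg fun x => le_max_right _ _

lemma cdf_neg_one_pos : 0 < cdf (gaussianReal 0 1) (-1) := by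
  rw [cdf_eq_real, measureReal_def, ENNReal.toReal_pos_iff]
  refine ⟨pos_iff_ne_zero.2 fun h => ?_, measure_lt_top _ _⟩
  have := gaussianReal_absolutelyContinuous' 0 (v := 1) one_ne_zero h
  simp at this

lemma cdf_mul_le_tau (z : ℝ) :
    cdf (gaussianReal 0 1) (-1) * (z + 1) ≤ tau z := by
  have h : ∫ x, (Set.Iic (-1 : ℝ)).indicator (fun _ => z + 1) x ∂(gaussianReal 0 1)
      = cdf (gaussianReal 0 1) (-1) * (z + 1) := by
    rw [integral_indicator measurableSet_Iic, setIntegral_const, cdf_eq_real, smul_eq_mul]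
  rw [tau_eq_integral, ← h]
  refine integral_mono ((integrable_const _).indicator measurableSet_Iic)
    (integrable_max_sub z) fun x => ?_
  by_cases hx : x ≤ -1
  · simp only [Set.mem_Iic, hx, Set.indicator_of_mem]
    exact le_max_of_le_left (by linarith)
  · simp [hx]

lemma tau_le_add_one {c : ℝ} (hc : 0 ≤ c) : tau c ≤ c + 1 := by
  have h1 : gaussianPDFReal 0 1 c ≤ 1 := by
    rw [gaussianPDFReal_std]
    refine mul_le_one₀ gaussianPDFReal_std_zero_le_one (Real.exp_pos _).le ?_
    rw [Real.exp_le_one_iff]; nlinarith [sq_nonneg c]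
  have h2 := mul_le_of_le_one_right hc (cdf_le_one (gaussianReal 0 1) c)
  unfold tau; linarith

lemma tau_zero : tau 0 = gaussianPDFReal 0 1 0 := by simp [tau]

lemma tau_neg_le {u : ℝ} (hu : 0 ≤ u) : tau (-u) ≤ tau 0 * Real.exp (-u ^ 2 / 2) := by
  have := mul_nonneg hu (cdf_nonneg (gaussianReal 0 1) (-u))
  rw [tau_zero, tau, gaussianPDFReal_std (-u), neg_sq]
  linarith

lemma tau_le_max_add_one (c : ℝ) : tau c ≤ max c 0 + 1 := by
  rcases le_total 0 c with hc | hc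
  · rw [max_eq_left hc]; exact tau_le_add_one hc
  · have h := tau_neg_le (u := -c) (by linarith)
    have h1 : Real.exp (-(-c) ^ 2 / 2) ≤ 1 := by
      rw [Real.exp_le_one_iff]; nlinarith [sq_nonneg c]
    have h0 : tau 0 ≤ 1 := by rw [tau_zero]; exact gaussianPDFReal_std_zero_le_one
    rw [neg_neg] at h
    rw [max_eq_right hc]
    nlinarith [tau_nonneg 0]

lemma EI_nonneg (m s b : ℝ) : 0 ≤ EI m s b := by
  unfold EI
  split_ifs with h
  · exact mul_nonneg h.le (tau_nonneg _)
  · exact le_max_right _ _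

/-- If the value `z` lies within the confidence width `s` of the mean `m`, then its improvement
over `b` is at most a constant times the expected improvement. -/
lemma cdf_mul_sub_le_EI {m s b z : ℝ} (hs : 0 ≤ s) (hz : |z - m| ≤ s) :
    cdf (gaussianReal 0 1) (-1) * (z - b) ≤ EI m s b := by
  have hc := cdf_neg_one_pos
  have hc1 := cdf_le_one (gaussianReal 0 1) (-1)
  rcases le_or_gt (z - b) 0 with h | h
  · exact (mul_nonpos_of_nonneg_of_nonpos hc.le h).trans (EI_nonneg _ _ _)
  rw [abs_le] at hz
  unfold EI
  split_ifs with h0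
  · have h1 : (z - b) / s ≤ (m - b) / s + 1 := by
      rw [div_add_one h0.ne']
      gcongr; linarith
    have h2 : 0 < (z - b) / s := div_pos h h0
    have h3 := cdf_mul_le_tau ((m - b) / s)
    calc cdf (gaussianReal 0 1) (-1) * (z - b)
        = s * (cdf (gaussianReal 0 1) (-1) * ((z - b) / s)) := by field_simp
      _ ≤ s * (cdf (gaussianReal 0 1) (-1) * ((m - b) / s + 1)) := by gcongr
      _ ≤ _ := by gcongr
  · have : s = 0 := le_antisymm (not_lt.1 h0) hs
    subst this
    refine le_trans ?_ (le_max_left _ _)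
    nlinarith

lemma EI_le {m s b : ℝ} (hs : 0 ≤ s) : EI m s b ≤ max (m - b) 0 + s := by
  unfold EI
  split_ifs with h
  · have := mul_le_mul_of_nonneg_left (tau_le_max_add_one ((m - b) / s)) h.le
    refine this.trans (le_of_eq ?_)
    rw [mul_add, mul_one, mul_max_of_nonneg _ _ h.le, mul_zero, mul_div_cancel₀ _ h.ne']
  · linarith

/-- If the expected improvement at a point with mean `m < b` is at least the expected improvement
at a point whose mean is the reference value `b`, then the deficit `b - m` is at most the width
`s` times the root of twice the logarithm of the ratio of the two widths. -/
lemma sub_le_of_EI_le {m s s' b : ℝ} (hs : 0 ≤ s) (hs' : 0 < s') (hm : m < b)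
    (h : EI b s' b ≤ EI m s b) : b - m ≤ s * √(2 * Real.log (s / s')) := by
  have h1 : EI b s' b = s' * tau 0 := by simp [EI, hs']
  have ht : 0 < tau 0 := by rw [tau_zero]; exact gaussianPDFReal_std_zero_pos
  have hpos : 0 < s' * tau 0 := mul_pos hs' ht
  have hs0 : 0 < s := by
    by_contra hcon
    have : EI m s b = 0 := by
      simp only [EI, hcon, if_false]
      exact max_eq_right (by linarith)
    linarith
  have h2 : EI m s b = s * tau (-((b - m) / s)) := by
    simp only [EI, hs0, if_true]; congr 2; ring
  have hu : 0 ≤ (b - m) / s := div_nonneg (by linarith) hs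
  have h3 := mul_le_mul_of_nonneg_left (tau_neg_le hu) hs
  set u := (b - m) / s with hu_def
  rw [h1, h2] at h
  have h4 : s' ≤ s * Real.exp (-u ^ 2 / 2) := by
    have : s' * tau 0 ≤ s * Real.exp (-u ^ 2 / 2) * tau 0 := by linarith
    exact le_of_mul_le_mul_right this ht
  have h5 : Real.exp (u ^ 2 / 2) ≤ s / s' := by
    rw [le_div_iff₀ hs']
    calc Real.exp (u ^ 2 / 2) * s'
        ≤ Real.exp (u ^ 2 / 2) * (s * Real.exp (-u ^ 2 / 2)) := by gcongr
      _ = s * (Real.exp (u ^ 2 / 2) * Real.exp (-u ^ 2 / 2)) := by ring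
      _ = s := by rw [← Real.exp_add]; ring_nf; simp
  have h6 : u ^ 2 ≤ 2 * Real.log (s / s') := by
    have := (Real.le_log_iff_exp_le (div_pos hs0 hs')).2 h5
    linarith
  have h7 : u ≤ √(2 * Real.log (s / s')) := Real.le_sqrt_of_sq_le h6
  calc b - m = s * u := by rw [hu_def]; field_simp
    _ ≤ _ := by gcongr

lemma gaussianReal_Ioi_le {v : ℝ≥0} (hv : v ≠ 0) {t : ℝ} (ht : 0 ≤ t) :
    gaussianReal 0 v (Set.Ioi t) ≤
      ENNReal.ofReal (Real.exp (-t ^ 2 / (2 * v))) * gaussianReal 0 v (Set.Ioi 0) := by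
  have h1 : gaussianReal 0 v (Set.Ioi t) = gaussianReal (-t) v (Set.Ioi 0) := by
    have h := gaussianReal_map_sub_const (μ := 0) (v := v) t
    rw [zero_sub] at h
    rw [← h, Measure.map_apply (by fun_prop) measurableSet_Ioi]
    congr 1; ext x; simp
  rw [h1, gaussianReal_apply _ hv, gaussianReal_apply _ hv,
    ← lintegral_const_mul _ (measurable_gaussianPDF _ _)]
  refine setLIntegral_mono (by fun_prop) fun x hx => ?_
  rw [gaussianPDF, gaussianPDF, ← ENNReal.ofReal_mul (Real.exp_pos _).le]
  refine ENNReal.ofReal_le_ofReal ?_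
  rw [gaussianPDFReal, gaussianPDFReal, mul_left_comm, ← Real.exp_add]
  gcongr
  rw [← add_div]
  have hx' : 0 < x := hx
  have : 0 ≤ t * x := by positivity
  gcongr
  nlinarith

/-- The two-sided Gaussian tail bound with the exact constant `1` in front of the exponential. -/
lemma gaussianReal_abs_gt_le (v : ℝ≥0) {c : ℝ} (hc : 0 ≤ c) :
    gaussianReal 0 v {x | c * √v < |x|} ≤ ENNReal.ofReal (Real.exp (-c ^ 2 / 2)) := by
  rcases eq_or_ne v 0 with rfl | hv
  · simp [gaussianReal_zero_var, Measure.dirac_apply]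
  set t := c * √v with ht_def
  have ht : 0 ≤ t := by positivity
  have hexp : -t ^ 2 / (2 * v) = -c ^ 2 / 2 := by
    rw [ht_def, mul_pow, Real.sq_sqrt v.coe_nonneg]
    have : (v : ℝ) ≠ 0 := by exact_mod_cast hv
    field_simp
  have hset : {x : ℝ | t < |x|} = Set.Ioi t ∪ (fun x => -x) ⁻¹' Set.Ioi t := by
    ext x; simp [lt_abs, lt_neg]
  have hneg : ∀ s : ℝ, gaussianReal 0 v ((fun x => -x) ⁻¹' Set.Ioi s)
      = gaussianReal 0 v (Set.Ioi s) := by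
    intro s
    rw [← Measure.map_apply measurable_neg measurableSet_Ioi, gaussianReal_map_neg, neg_zero]
  have hsum : gaussianReal 0 v (Set.Ioi 0) + gaussianReal 0 v (Set.Ioi 0) ≤ 1 := by
    nth_rewrite 2 [← hneg 0]
    rw [← measure_union _ (measurable_neg measurableSet_Ioi)]
    · exact prob_le_one
    · rw [Set.disjoint_left]; intro x hx hx'
      simp only [Set.mem_Ioi, Set.mem_preimage] at hx hx'; linarith
  have h := gaussianReal_Ioi_le hv ht
  rw [hexp] at h
  calc gaussianReal 0 v {x | t < |x|}
      ≤ gaussianReal 0 v (Set.Ioi t) + gaussianReal 0 v (Set.Ioi t) := by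
        rw [hset]; exact (measure_union_le _ _).trans (by rw [hneg])
    _ ≤ ENNReal.ofReal (Real.exp (-c ^ 2 / 2)) *
        (gaussianReal 0 v (Set.Ioi 0) + gaussianReal 0 v (Set.Ioi 0)) := by
        rw [mul_add]; gcongr
    _ ≤ _ := mul_le_of_le_one_right zero_le hsum

/-! ### The posterior of a kernel given by a feature map -/

section Posterior

variable {S : Type*} {k : S → S → ℝ} {σ : ℝ≥0}

/-- The coefficients of the posterior mean at `s`, as a linear function of the observations. -/
noncomputable def postWeight (k : S → S → ℝ) (σ : ℝ≥0) {n : ℕ} (a : Fin n → S) (s : S) :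
    Fin n → ℝ :=
  (regGram k σ a)⁻¹ *ᵥ (fun i => k s (a i))

variable {H : Type*} [NormedAddCommGroup H] [InnerProductSpace ℝ H] {Φ : S → H}

lemma regGram_eq_gram_add (hk : ∀ s t, k s t = inner ℝ (Φ s) (Φ t)) {n : ℕ} (a : Fin n → S) :
    regGram k σ a = Matrix.gram ℝ (Φ ∘ a) + ((σ : ℝ) ^ 2) • (1 : Matrix (Fin n) (Fin n) ℝ) := by
  ext i j
  simp [regGram, Matrix.gram_apply, hk]

lemma posDef_regGram (hk : ∀ s t, k s t = inner ℝ (Φ s) (Φ t)) (hσ : 0 < σ) {n : ℕ}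
    (a : Fin n → S) : (regGram k σ a).PosDef := by
  rw [regGram_eq_gram_add hk]
  exact Matrix.PosDef.posSemidef_add (Matrix.posSemidef_gram ℝ (Φ ∘ a))
    (Matrix.PosDef.one.smul (pow_pos (NNReal.coe_pos.2 hσ) 2))

lemma regGram_mulVec_postWeight (hk : ∀ s t, k s t = inner ℝ (Φ s) (Φ t)) (hσ : 0 < σ) {n : ℕ}
    (a : Fin n → S) (s : S) :
    regGram k σ a *ᵥ postWeight k σ a s = fun i => k s (a i) := by
  have h : IsUnit (regGram k σ a).det :=
    (Matrix.isUnit_iff_isUnit_det _).1 (posDef_regGram hk hσ a).isUnit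
  rw [postWeight, Matrix.mulVec_mulVec, Matrix.mul_nonsing_inv _ h, Matrix.one_mulVec]

/-- The normal equations: the posterior residual at `s` has covariance `σ² w i` with the `i`-th
point, where `w` is the vector of posterior weights. -/
lemma inner_sub_sum_postWeight (hk : ∀ s t, k s t = inner ℝ (Φ s) (Φ t)) (hσ : 0 < σ) {n : ℕ}
    (a : Fin n → S) (s : S) (i : Fin n) :
    inner ℝ (Φ s - ∑ j, postWeight k σ a s j • Φ (a j)) (Φ (a i)) =
      (σ : ℝ) ^ 2 * postWeight k σ a s i := by
  have h := congrFun (regGram_mulVec_postWeight hk hσ a s) i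
  rw [regGram, Matrix.add_mulVec, Matrix.smul_mulVec, Matrix.one_mulVec] at h
  simp only [Pi.add_apply, Pi.smul_apply, smul_eq_mul, Matrix.mulVec, dotProduct,
    Matrix.of_apply] at h
  rw [inner_sub_left, sum_inner, ← hk, ← h]
  simp only [real_inner_smul_left, ← hk]
  have : ∀ j, k (a i) (a j) = k (a j) (a i) := fun j => by rw [hk, hk, real_inner_comm]
  simp only [this, mul_comm]
  ring

lemma postMean_eq_sum (hk : ∀ s t, k s t = inner ℝ (Φ s) (Φ t)) {n : ℕ}
    (a : Fin n → S) (y : Fin n → ℝ) (s : S) :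
    postMean k σ a y s = ∑ i, postWeight k σ a s i * y i := by
  have hsymm : (regGram k σ a)ᵀ = regGram k σ a := by
    ext i j
    simp [regGram, hk, real_inner_comm, Matrix.one_apply, eq_comm]
  rw [postMean, Matrix.dotProduct_mulVec, postWeight, ← Matrix.vecMul_transpose,
    Matrix.transpose_nonsing_inv, hsymm]
  rfl

/-- The posterior variance is the mean squared error of the posterior mean. -/
lemma postVar_eq (hk : ∀ s t, k s t = inner ℝ (Φ s) (Φ t)) (hσ : 0 < σ) {n : ℕ}
    (a : Fin n → S) (s : S) :
    postVar k σ a s = ‖Φ s - ∑ i, postWeight k σ a s i • Φ (a i)‖ ^ 2 +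
      (σ : ℝ) ^ 2 * ∑ i, postWeight k σ a s i ^ 2 := by
  set w := postWeight k σ a s with hw
  set R := Φ s - ∑ i, w i • Φ (a i) with hR
  have h1 : inner ℝ R (∑ i, w i • Φ (a i)) = (σ : ℝ) ^ 2 * ∑ i, w i ^ 2 := by
    rw [inner_sum, Finset.mul_sum]
    refine Finset.sum_congr rfl fun i _ => ?_
    rw [real_inner_smul_right, hR, hw, inner_sub_sum_postWeight hk hσ]
    ring
  have h2 : postVar k σ a s = inner ℝ R (Φ s) := by
    rw [postVar, hR, inner_sub_left, sum_inner, hk s s]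
    simp only [real_inner_smul_left, dotProduct]
    congr 1
    refine Finset.sum_congr rfl fun i _ => ?_
    rw [hk s, real_inner_comm, mul_comm]
    rfl
  have h3 : Φ s = R + ∑ i, w i • Φ (a i) := by rw [hR]; abel
  rw [h2, h3, inner_add_right, h1, real_inner_self_eq_norm_sq]

lemma postVar_nonneg (hk : ∀ s t, k s t = inner ℝ (Φ s) (Φ t)) (hσ : 0 < σ) {n : ℕ}
    (a : Fin n → S) (s : S) : 0 ≤ postVar k σ a s := by
  rw [postVar_eq hk hσ]
  positivity

/-- The posterior mean minimizes the mean squared error among linear estimators. -/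
lemma postVar_le (hk : ∀ s t, k s t = inner ℝ (Φ s) (Φ t)) (hσ : 0 < σ) {n : ℕ}
    (a : Fin n → S) (s : S) (w : Fin n → ℝ) :
    postVar k σ a s ≤ ‖Φ s - ∑ i, w i • Φ (a i)‖ ^ 2 + (σ : ℝ) ^ 2 * ∑ i, w i ^ 2 := by
  rw [postVar_eq hk hσ]
  set v := postWeight k σ a s with hv
  set R := Φ s - ∑ i, v i • Φ (a i) with hR
  set D := ∑ i, (w i - v i) • Φ (a i) with hD
  have h1 : Φ s - ∑ i, w i • Φ (a i) = R - D := by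
    rw [hR, hD]
    simp only [sub_smul, Finset.sum_sub_distrib]
    abel
  have h2 : inner ℝ R D = (σ : ℝ) ^ 2 * ∑ i, (w i - v i) * v i := by
    rw [hD, inner_sum, Finset.mul_sum]
    refine Finset.sum_congr rfl fun i _ => ?_
    rw [real_inner_smul_right, hR, hv, inner_sub_sum_postWeight hk hσ]
    ring
  have h3 : ∑ i, w i ^ 2 =
      ∑ i, v i ^ 2 + 2 * ∑ i, (w i - v i) * v i + ∑ i, (w i - v i) ^ 2 := by
    rw [Finset.mul_sum, ← Finset.sum_add_distrib, ← Finset.sum_add_distrib]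
    exact Finset.sum_congr rfl fun i _ => by ring
  have h4 : 0 ≤ ∑ i, (w i - v i) ^ 2 := Finset.sum_nonneg fun i _ => sq_nonneg _
  rw [h1, norm_sub_sq_real R D, h2, h3]
  nlinarith [sq_nonneg ‖D‖, mul_nonneg (sq_nonneg (σ : ℝ)) h4]

lemma postVar_le_self (hk : ∀ s t, k s t = inner ℝ (Φ s) (Φ t)) (hσ : 0 < σ) {n : ℕ}
    (a : Fin n → S) (s : S) : postVar k σ a s ≤ k s s := by
  have h := postVar_le hk hσ a s 0
  simpa [hk] using h

lemma postVar_zero (a : Fin 0 → S) (s : S) : postVar k σ a s = k s s := by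
  simp [postVar]

lemma postMean_zero (a : Fin 0 → S) (y : Fin 0 → ℝ) (s : S) : postMean k σ a y s = 0 := by
  simp [postMean]

lemma antitone_postVar (hk : ∀ s t, k s t = inner ℝ (Φ s) (Φ t)) (hσ : 0 < σ) (a : ℕ → S)
    (s : S) : Antitone fun n : ℕ => postVar k σ (fun i : Fin n => a i) s := by
  refine antitone_nat_of_succ_le fun n => ?_
  have h := postVar_le hk hσ (fun i : Fin (n + 1) => a i) s
    (Fin.snoc (postWeight k σ (fun i : Fin n => a i) s) 0)
  simpa [Fin.sum_univ_castSucc, ← postVar_eq hk hσ] using h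

lemma antitone_postSd (hk : ∀ s t, k s t = inner ℝ (Φ s) (Φ t)) (hσ : 0 < σ) (a : ℕ → S)
    (s : S) : Antitone fun n : ℕ => postSd k σ (fun i : Fin n => a i) s :=
  fun _ _ h => Real.sqrt_le_sqrt (antitone_postVar hk hσ a s h)

/-- After `n` observations the posterior variance is at least of order `1 / n`. -/
lemma le_postVar (hk : ∀ s t, k s t = inner ℝ (Φ s) (Φ t)) (hσ : 0 < σ) {κ : ℝ}
    (hκ : ∀ s, κ ≤ k s s ∧ k s s ≤ 1) {n : ℕ} (hn : 1 ≤ n) (a : Fin n → S) (s : S) :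
    κ * min 1 ((σ : ℝ) ^ 2) / (2 * n) ≤ postVar k σ a s := by
  rw [postVar_eq hk hσ]
  set w := postWeight k σ a s
  set G := ∑ i, w i • Φ (a i)
  set m := min 1 ((σ : ℝ) ^ 2)
  have hn0 : (0 : ℝ) < n := by exact_mod_cast hn
  have hn1 : (1 : ℝ) ≤ n := by exact_mod_cast hn
  have hm0 : 0 < m := lt_min one_pos (pow_pos (NNReal.coe_pos.2 hσ) 2)
  have hnorm : ∀ t, ‖Φ t‖ ≤ 1 := fun t => by
    have := (hκ t).2
    rw [hk, real_inner_self_eq_norm_sq] at this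
    exact (sq_le_one_iff₀ (norm_nonneg _)).1 this
  have hG : ‖G‖ ^ 2 ≤ n * ∑ i, w i ^ 2 := by
    have h1 : ‖G‖ ≤ ∑ i, |w i| := by
      refine (norm_sum_le _ _).trans (Finset.sum_le_sum fun i _ => ?_)
      rw [norm_smul, Real.norm_eq_abs]
      exact mul_le_of_le_one_right (abs_nonneg _) (hnorm _)
    calc ‖G‖ ^ 2 ≤ (∑ i, |w i|) ^ 2 := by gcongr
      _ ≤ (Finset.univ : Finset (Fin n)).card * ∑ i, |w i| ^ 2 := sq_sum_le_card_mul_sum_sq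
      _ = _ := by simp
  -- Either the regularized approximation `G` of `Φ s` is far from it, or the norm of `G`, hence
  -- that of the weights, is bounded below.
  have hX : κ ≤ 2 * ‖Φ s - G‖ ^ 2 + 2 * ‖G‖ ^ 2 := by
    have h1 := (hκ s).1
    rw [hk, real_inner_self_eq_norm_sq] at h1
    have h2 : ‖Φ s‖ ≤ ‖Φ s - G‖ + ‖G‖ := by simpa using norm_add_le (Φ s - G) G
    nlinarith [norm_nonneg (Φ s), sq_nonneg (‖Φ s - G‖ - ‖G‖)]
  have hS : 0 ≤ ∑ i, w i ^ 2 := Finset.sum_nonneg fun i _ => sq_nonneg _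
  rw [div_le_iff₀ (by positivity)]
  have e1 : m * ‖Φ s - G‖ ^ 2 ≤ n * ‖Φ s - G‖ ^ 2 :=
    mul_le_mul_of_nonneg_right ((min_le_left _ _).trans hn1) (sq_nonneg _)
  have e2 : m * ‖G‖ ^ 2 ≤ (σ : ℝ) ^ 2 * (n * ∑ i, w i ^ 2) :=
    mul_le_mul (min_le_right _ _) hG (sq_nonneg _) (sq_nonneg _)
  nlinarith [mul_le_mul_of_nonneg_right hX hm0.le]

end Posterior

/-! ### Regret of expected improvement on the confidence event -/

/-- A path of the sequential optimization with expected improvement on which the confidence bounds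
hold: `φ` is the objective, `x n` the point queried in round `n`, `μ n` and `s n` the posterior mean
and standard deviation before that round, `b n` the reference value and `B n` the scaling. The
bounds are required at the points queried up to round `n`, and at points which nearly maximize
the objective. -/
structure ConfidentRun {S : Type*} (φ : S → ℝ) (x : ℕ → S) (μ s : ℕ → S → ℝ) (b B : ℕ → ℝ)
    (η : ℝ) : Prop where
  η_pos : 0 < η
  η_le : η ≤ 1
  sd_nonneg : ∀ n t, 0 ≤ s n t
  sd_le_one : ∀ n t, s n t ≤ 1
  sd_anti : ∀ t, Antitone fun n => s n t
  le_sd_sq : ∀ n t, 1 ≤ n → η / n ≤ s n t ^ 2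
  mean_zero : ∀ t, μ 0 t = 0
  ref_zero : b 0 = 0
  ref_attained : ∀ n, 1 ≤ n → ∃ i < n, b n = μ n (x i)
  le_ref : ∀ n, ∀ i < n, μ n (x i) ≤ b n
  one_le_scale : ∀ n, 1 ≤ B n
  scale_mono : Monotone B
  optimal : ∀ n t, EI (μ n t) (B n * s n t) (b n) ≤ EI (μ n (x n)) (B n * s n (x n)) (b n)
  conf_query : ∀ n, ∀ i ≤ n, |φ (x i) - μ n (x i)| ≤ B n * s n (x i)
  conf_near : ∀ (n : ℕ) t, ∃ t', φ t ≤ φ t' + 1 / ((n : ℝ) + 1) ^ 2 ∧ |φ t' - μ n t'| ≤ B n * s n t'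

lemma sum_one_div_succ_sq_le (T : ℕ) : ∑ n ∈ Finset.range T, 1 / ((n : ℝ) + 1) ^ 2 ≤ 2 := by
  suffices h : ∑ n ∈ Finset.range T, 1 / ((n : ℝ) + 1) ^ 2 ≤ 2 - 1 / (T : ℝ) by
    have : (0 : ℝ) ≤ 1 / (T : ℝ) := by positivity
    linarith
  induction T with
  | zero => norm_num
  | succ T ih =>
    rw [Finset.sum_range_succ]
    rcases Nat.eq_zero_or_pos T with rfl | hT
    · norm_num
    have hT : (0 : ℝ) < T := by exact_mod_cast hT
    have h1 : 1 / ((T : ℝ) + 1) ^ 2 ≤ 1 / ((T : ℝ) * (T + 1)) := by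
      gcongr
      nlinarith
    have h2 : 1 / ((T : ℝ) * (T + 1)) = 1 / T - 1 / (T + 1) := by field_simp; ring
    push_cast
    linarith

namespace ConfidentRun

variable {S : Type*} {φ : S → ℝ} {x : ℕ → S} {μ s : ℕ → S → ℝ} {b B : ℕ → ℝ} {η : ℝ}

lemma width_le (h : ConfidentRun φ x μ s b B η) {m n : ℕ} (hmn : m ≤ n) (t : S) {M : ℝ}
    (hM : B n ≤ M) : B n * s n t ≤ M * s m t :=
  mul_le_mul hM (h.sd_anti t hmn) (h.sd_nonneg _ _)
    ((zero_le_one.trans (h.one_le_scale n)).trans hM)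

/-- The improvements of the posterior mean over the reference value are summable up to the widths:
at two consecutive rounds `l < n` with such an improvement, the mean at `x n` exceeds the mean at
`x l`, so that the improvements telescope. Here `l` is the last such round before `T`. -/
lemma exists_sum_improvement_le (h : ConfidentRun φ x μ s b B η) (M : ℝ) (T : ℕ)
    (hM : ∀ n ≤ T, B n ≤ M) :
    ∃ l ≤ T, ∑ n ∈ Finset.range (T + 1), max (μ n (x n) - b n) 0 ≤
      φ (x l) - φ (x 0) + 2 * M * ∑ n ∈ Finset.range (T + 1), s n (x n) - M * s l (x l) := by
  induction T with
  | zero =>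
    have h1 := h.sd_nonneg 0 (x 0)
    have h2 := (zero_le_one.trans (h.one_le_scale 0)).trans (hM 0 le_rfl)
    refine ⟨0, le_rfl, ?_⟩
    simp only [zero_add, Finset.range_one, Finset.sum_singleton, h.mean_zero, h.ref_zero, sub_self,
      max_self]
    nlinarith [mul_nonneg h2 h1]
  | succ T ih =>
    obtain ⟨l, hl, hsum⟩ := ih fun n hn => hM n (hn.trans T.le_succ)
    have hM0 : 0 ≤ M := (zero_le_one.trans (h.one_le_scale 0)).trans (hM 0 (Nat.zero_le _))
    have hs := mul_nonneg hM0 (h.sd_nonneg (T + 1) (x (T + 1)))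
    rcases le_or_gt (μ (T + 1) (x (T + 1)) - b (T + 1)) 0 with hD | hD
    · refine ⟨l, hl.trans T.le_succ, ?_⟩
      rw [Finset.sum_range_succ, Finset.sum_range_succ (fun n => s n (x n)), max_eq_right hD]
      linarith
    · refine ⟨T + 1, le_rfl, ?_⟩
      rw [Finset.sum_range_succ, Finset.sum_range_succ (fun n => s n (x n)), max_eq_left hD.le]
      have e1 := h.le_ref (T + 1) l (Nat.lt_succ_of_le hl)
      have e2 := abs_le.1 (h.conf_query (T + 1) l (hl.trans T.le_succ))
      have e3 := abs_le.1 (h.conf_query (T + 1) (T + 1) le_rfl)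
      have e4 := h.width_le (hl.trans T.le_succ) (x l) (hM (T + 1) le_rfl)
      have e5 := h.width_le le_rfl (x (T + 1)) (hM (T + 1) le_rfl)
      linarith

/-- The regret of the first round, from the confidence bounds of the prior, whose mean is zero. -/
lemma sub_first_le (h : ConfidentRun φ x μ s b B η) (t : S) : φ t - φ (x 0) ≤ 3 * B 0 := by
  obtain ⟨t', h1, h2⟩ := h.conf_near 0 t
  have h3 := abs_le.1 h2
  have h4 := abs_le.1 (h.conf_query 0 0 le_rfl)
  rw [h.mean_zero] at h3 h4
  have hB := h.one_le_scale 0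
  have e1 := mul_le_of_le_one_right (zero_le_one.trans hB) (h.sd_le_one 0 t')
  have e2 := mul_le_of_le_one_right (zero_le_one.trans hB) (h.sd_le_one 0 (x 0))
  norm_num at h1
  linarith

/-- Where the mean at the queried point falls short of the reference value, it does so by at most
a multiple `O(√log n)` of the width. -/
lemma ref_sub_mean_le (h : ConfidentRun φ x μ s b B η) {n : ℕ} (hn : 1 ≤ n) :
    b n - μ n (x n) ≤ B n * s n (x n) * √(Real.log (n / η)) := by
  have hB := h.one_le_scale n
  have hB0 : 0 < B n := by linarith
  have hw := mul_nonneg hB0.le (h.sd_nonneg n (x n))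
  rcases le_or_gt (b n) (μ n (x n)) with hle | hlt
  · have := mul_nonneg hw (Real.sqrt_nonneg (Real.log (n / η)))
    linarith
  -- The expected improvement at the query is compared with that at `x i`, whose mean is `b n`.
  obtain ⟨i, -, hbi⟩ := h.ref_attained n hn
  have hn0 : (0 : ℝ) < n := by exact_mod_cast hn
  have hη := h.η_pos
  have hsi : 0 < s n (x i) := by
    refine (h.sd_nonneg n _).lt_of_ne' fun h0 => ?_
    have := h.le_sd_sq n (x i) hn
    rw [h0] at this
    have : 0 < η / n := by positivity
    norm_num at *
    linarith
  have hopt := h.optimal n (x i)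
  rw [← hbi] at hopt
  refine (sub_le_of_EI_le hw (mul_pos hB0 hsi) hlt hopt).trans ?_
  gcongr
  rw [mul_div_mul_left _ _ hB0.ne']
  rcases (h.sd_nonneg n (x n)).eq_or_lt with h0 | hpos
  · -- Here the logarithm on the left has the junk value `log 0 = 0`.
    rw [← h0]
    simp only [zero_div, Real.log_zero, mul_zero]
    refine Real.log_nonneg ?_
    rw [one_le_div hη]
    exact h.η_le.trans (by exact_mod_cast hn)
  rw [← Nat.cast_two, ← Real.log_pow]
  refine Real.log_le_log (by positivity) ?_
  rw [div_pow]
  calc s n (x n) ^ 2 / s n (x i) ^ 2 ≤ 1 / (η / n) := by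
        have h1 := h.le_sd_sq n (x i) hn
        have h2 : s n (x n) ^ 2 ≤ 1 := pow_le_one₀ hpos.le (h.sd_le_one _ _)
        gcongr
    _ = n / η := by rw [one_div_div]

/-- The regret of a later round in terms of the improvement of the mean at the query over the
reference value and of the width at the query: the reference value serves as an intermediate point,
and the expected improvement at the query dominates that at a near-maximizer of the objective. -/
lemma sub_query_le (h : ConfidentRun φ x μ s b B η) {n : ℕ} (hn : 1 ≤ n) (t : S) :
    φ t - φ (x n) ≤ 1 / ((n : ℝ) + 1) ^ 2 +
      (cdf (gaussianReal 0 1) (-1))⁻¹ * (max (μ n (x n) - b n) 0 + B n * s n (x n)) +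
      B n * s n (x n) * (√(Real.log (n / η)) + 1) := by
  obtain ⟨t', h1, h2⟩ := h.conf_near n t
  have hB0 : 0 ≤ B n := zero_le_one.trans (h.one_le_scale n)
  have e1 := cdf_mul_sub_le_EI (b := b n) (mul_nonneg hB0 (h.sd_nonneg n t')) h2
  have e2 := h.optimal n t'
  have e3 := EI_le (m := μ n (x n)) (b := b n) (mul_nonneg hB0 (h.sd_nonneg n (x n)))
  have e4 := h.ref_sub_mean_le hn
  have e5 := abs_le.1 (h.conf_query n n le_rfl)
  have e6 : φ t' - b n ≤ (cdf (gaussianReal 0 1) (-1))⁻¹ *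
      (max (μ n (x n) - b n) 0 + B n * s n (x n)) := by
    rw [← div_eq_inv_mul, le_div_iff₀' cdf_neg_one_pos]
    linarith
  linarith

/-- The regret is at most a constant times the scaling, `√log T`, and the sum of the posterior
standard deviations at the queried points. -/
lemma sum_regret_le (h : ConfidentRun φ x μ s b B η) {T : ℕ} (hT : 2 ≤ T) :
    ∑ n ∈ Finset.range T, ((⨆ t, φ t) - φ (x n)) ≤
      (12 + 12 * (cdf (gaussianReal 0 1) (-1))⁻¹ + √(1 + Real.log (1 / η) / Real.log 2)) *
        B (T - 1) * √(Real.log T) * (1 + ∑ n ∈ Finset.range T, s n (x n)) := by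
  have : Nonempty S := ⟨x 0⟩
  obtain ⟨m, rfl⟩ : ∃ m, T = m + 1 := ⟨T - 1, by omega⟩
  have hm : 1 ≤ m := by omega
  set M := B (m + 1 - 1) with hM
  simp only [Nat.add_sub_cancel] at hM
  set c := (cdf (gaussianReal 0 1) (-1))⁻¹
  set A := √(1 + Real.log (1 / η) / Real.log 2) with hA
  set l := √(Real.log (m + 1 : ℕ)) with hl
  have hc0 : 0 < c := inv_pos.2 cdf_neg_one_pos
  have hM1 : 1 ≤ M := hM ▸ h.one_le_scale m
  have hBM : ∀ n ≤ m, B n ≤ M := fun n hn => hM ▸ h.scale_mono hn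
  have hA0 : 0 ≤ A := Real.sqrt_nonneg _
  have hlog2 : 0 < Real.log 2 := Real.log_pos one_lt_two
  have hlogT : Real.log 2 ≤ Real.log (m + 1 : ℕ) :=
    Real.log_le_log two_pos (by exact_mod_cast hT)
  -- As `√(log T)` is bounded below, terms without this factor can be absorbed.
  have hl2 : 1 ≤ 2 * l := by
    have : (1 / 2 : ℝ) ≤ l := by
      refine Real.le_sqrt_of_sq_le ?_
      have := Real.log_two_gt_d9
      norm_num at *
      linarith
    linarith
  have hlog : ∀ n, 1 ≤ n → n ≤ m → √(Real.log (n / η)) ≤ A * l := by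
    intro n h1 hn
    rw [hA, hl, ← Real.sqrt_mul' _ (hlog2.le.trans hlogT)]
    refine Real.sqrt_le_sqrt ?_
    have hη := h.η_pos
    have hn0 : (0 : ℝ) < n := by exact_mod_cast h1
    have e1 : 0 ≤ Real.log (1 / η) := Real.log_nonneg (by rw [one_le_div hη]; exact h.η_le)
    have e2 : Real.log n ≤ Real.log (m + 1 : ℕ) :=
      Real.log_le_log hn0 (by exact_mod_cast hn.trans m.le_succ)
    have e3 : Real.log (n / η) = Real.log n + Real.log (1 / η) := by
      rw [← Real.log_mul hn0.ne' (by positivity), mul_one_div]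
    have e4 : Real.log (1 / η) ≤ Real.log (1 / η) / Real.log 2 * Real.log (m + 1 : ℕ) := by
      rw [div_mul_eq_mul_div, le_div_iff₀ hlog2]
      exact mul_le_mul_of_nonneg_left hlogT e1
    rw [e3]
    linarith
  have hr0 : (⨆ t, φ t) - φ (x 0) ≤ 3 * M := by
    have : (⨆ t, φ t) ≤ φ (x 0) + 3 * M := ciSup_le fun t => by
      have := h.sub_first_le t
      have := hBM 0 (Nat.zero_le _)
      linarith
    linarith
  have hr : ∀ n, 1 ≤ n → n ≤ m → (⨆ t, φ t) - φ (x n) ≤ 1 / ((n : ℝ) + 1) ^ 2 +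
      c * (max (μ n (x n) - b n) 0 + M * s n (x n)) + M * s n (x n) * (A * l + 1) := by
    intro n h1 hn
    have : (⨆ t, φ t) ≤ φ (x n) + (1 / ((n : ℝ) + 1) ^ 2 +
        c * (max (μ n (x n) - b n) 0 + M * s n (x n)) + M * s n (x n) * (A * l + 1)) := by
      refine ciSup_le fun t => ?_
      have e1 := h.sub_query_le h1 t
      have e2 := h.width_le (le_refl n) (x n) (hBM n hn)
      have e3 : 0 ≤ B n * s n (x n) :=
        mul_nonneg (zero_le_one.trans (h.one_le_scale n)) (h.sd_nonneg _ _)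
      have e4 : B n * s n (x n) * (√(Real.log (n / η)) + 1) ≤ M * s n (x n) * (A * l + 1) :=
        mul_le_mul e2 (by linarith [hlog n h1 hn]) (by positivity) (e3.trans e2)
      have e5 := mul_le_mul_of_nonneg_left e2 hc0.le
      simp only [mul_add] at *
      linarith
    linarith
  obtain ⟨j, hj, hsum⟩ := h.exists_sum_improvement_le M m hBM
  have hj0 := h.sub_first_le (x j)
  have hB0 := hBM 0 (Nat.zero_le _)
  set V := ∑ n ∈ Finset.range (m + 1), s n (x n) with hV
  have hV0 : 0 ≤ V := Finset.sum_nonneg fun n _ => h.sd_nonneg _ _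
  have hsj := mul_nonneg (zero_le_one.trans hM1) (h.sd_nonneg j (x j))
  have hall : ∑ n ∈ Finset.range (m + 1), ((⨆ t, φ t) - φ (x n)) ≤
      3 * M + ∑ n ∈ Finset.range (m + 1), (1 / ((n : ℝ) + 1) ^ 2 +
      c * (max (μ n (x n) - b n) 0 + M * s n (x n)) + M * s n (x n) * (A * l + 1)) := by
    have hl0 : 0 ≤ l := Real.sqrt_nonneg _
    rw [Finset.sum_range_succ', Finset.sum_range_succ' (fun n : ℕ => (1 / ((n : ℝ) + 1) ^ 2 +
      c * (max (μ n (x n) - b n) 0 + M * s n (x n)) + M * s n (x n) * (A * l + 1)))]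
    have e1 : ∀ n ∈ Finset.range m, (⨆ t, φ t) - φ (x (n + 1)) ≤ _ := fun n hn =>
      hr (n + 1) (by omega) (by have := Finset.mem_range.1 hn; omega)
    have e2 := Finset.sum_le_sum e1
    have e3 : 0 ≤ M * s 0 (x 0) := mul_nonneg (zero_le_one.trans hM1) (h.sd_nonneg _ _)
    have e4 : 0 ≤ 1 / (((0 : ℕ) : ℝ) + 1) ^ 2 +
      c * (max (μ 0 (x 0) - b 0) 0 + M * s 0 (x 0)) + M * s 0 (x 0) * (A * l + 1) := by
      have : 0 ≤ max (μ 0 (x 0) - b 0) 0 := le_max_right _ _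
      positivity
    linarith
  have hexp : ∑ n ∈ Finset.range (m + 1), (1 / ((n : ℝ) + 1) ^ 2 +
      c * (max (μ n (x n) - b n) 0 + M * s n (x n)) + M * s n (x n) * (A * l + 1)) =
      ∑ n ∈ Finset.range (m + 1), 1 / ((n : ℝ) + 1) ^ 2 +
      c * (∑ n ∈ Finset.range (m + 1), max (μ n (x n) - b n) 0 + M * V) +
      M * V * (A * l + 1) := by
    rw [Finset.sum_add_distrib, Finset.sum_add_distrib, hV, ← Finset.mul_sum,
      Finset.sum_add_distrib, ← Finset.mul_sum, ← Finset.sum_mul, ← Finset.mul_sum]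
  have hz : ∑ n ∈ Finset.range (m + 1), 1 / ((n : ℝ) + 1) ^ 2 ≤ 2 * M := by
    have := sum_one_div_succ_sq_le (m + 1)
    linarith
  have hD := mul_le_mul_of_nonneg_left (show
    ∑ n ∈ Finset.range (m + 1), max (μ n (x n) - b n) 0 + M * V ≤ 3 * M * (1 + V) by
      nlinarith) hc0.le
  have hMl : M * (1 + V) ≤ 2 * (M * l * (1 + V)) := by
    have := mul_le_mul_of_nonneg_right hl2 (show 0 ≤ M * (1 + V) by positivity)
    linarith
  have hl0 : 0 ≤ l := Real.sqrt_nonneg _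
  have hfin : ∑ n ∈ Finset.range (m + 1), ((⨆ t, φ t) - φ (x n)) ≤
      (5 + 3 * c) * (M * (1 + V)) + A * (M * l * (1 + V)) := by
    have e1 : 0 ≤ A * M * l := by positivity
    have e2 : 0 ≤ M * V := by positivity
    rw [hexp] at hall
    nlinarith
  have e3 := mul_le_mul_of_nonneg_left hMl (show 0 ≤ 5 + 3 * c by positivity)
  have e4 : 0 ≤ M * l * (1 + V) := by positivity
  nlinarith [mul_nonneg hc0.le e4]

end ConfidentRun

/-! ### The likelihood of sequential Gaussian observations -/

lemma measurable_finSnoc (n : ℕ) :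
    Measurable fun p : (Fin n → ℝ) × ℝ => (Fin.snoc p.1 p.2 : Fin (n + 1) → ℝ) := by
  refine measurable_pi_lambda _ fun i => ?_
  induction i using Fin.lastCases with
  | last => simpa using measurable_snd
  | cast i =>
    simp only [Fin.snoc_castSucc]
    exact (measurable_pi_apply i).comp measurable_fst

lemma lintegral_finSnoc {n : ℕ} {F : (Fin (n + 1) → ℝ) → ℝ≥0∞} (hF : Measurable F) :
    ∫⁻ y, F y = ∫⁻ y : Fin n → ℝ, ∫⁻ z : ℝ, F (Fin.snoc y z) := by
  have h := (volume_preserving_piFinSuccAbove (fun _ : Fin (n + 1) => ℝ) (Fin.last n)).symm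
  rw [← h.lintegral_comp hF, Measure.volume_eq_prod, lintegral_prod_symm']
  · simp [MeasurableEquiv.piFinSuccAbove, Fin.insertNthEquiv, Fin.insertNth_last']
  · exact hF.comp h.measurable

section Indep

variable {Ω A B C : Type*} [MeasurableSpace Ω] [MeasurableSpace A] [MeasurableSpace B]
  [MeasurableSpace C] {P : Measure Ω} [IsProbabilityMeasure P]

lemma _root_.ProbabilityTheory.IndepFun.prodMk_left_of_indepFun {X : Ω → A} {Y : Ω → B} {Z : Ω → C}
    (hX : Measurable X) (hY : Measurable Y) (hZ : Measurable Z)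
    (h : IndepFun X (fun ω => (Y ω, Z ω)) P) (h' : IndepFun Y Z P) :
    IndepFun (fun ω => (X ω, Y ω)) Z P := by
  have hXY : IndepFun X Y P := h.comp (ψ := Prod.fst) measurable_id measurable_fst
  have : IsProbabilityMeasure (P.map X) := Measure.isProbabilityMeasure_map hX.aemeasurable
  have : IsProbabilityMeasure (P.map Y) := Measure.isProbabilityMeasure_map hY.aemeasurable
  have : IsProbabilityMeasure (P.map Z) := Measure.isProbabilityMeasure_map hZ.aemeasurable
  rw [indepFun_iff_map_prod_eq_prod_map_map (by fun_prop) (by fun_prop)] at h h' hXY ⊢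
  rw [hXY]
  rw [h'] at h
  have e : (fun ω => ((X ω, Y ω), Z ω)) =
      MeasurableEquiv.prodAssoc.symm ∘ fun ω => (X ω, Y ω, Z ω) := rfl
  rw [e, ← Measure.map_map (by fun_prop) (by fun_prop), h, ← Measure.prodAssoc_prod,
    Measure.map_map (by fun_prop) (by fun_prop)]
  simp

lemma lintegral_prodMk_of_indepFun {X : Ω → A} {Y : Ω → B} (hX : Measurable X) (hY : Measurable Y)
    (h : IndepFun X Y P) {F : A × B → ℝ≥0∞} (hF : Measurable F) :
    ∫⁻ ω, F (X ω, Y ω) ∂P = ∫⁻ ω, ∫⁻ b, F (X ω, b) ∂(P.map Y) ∂P := by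
  have : IsProbabilityMeasure (P.map Y) := Measure.isProbabilityMeasure_map hY.aemeasurable
  rw [← lintegral_map hF (hX.prodMk hY),
    (indepFun_iff_map_prod_eq_prod_map_map hX.aemeasurable hY.aemeasurable).1 h,
    lintegral_prod _ hF.aemeasurable, lintegral_map hF.lintegral_prod_right' hX]

end Indep

section Likelihood

variable {Ω H : Type*} [MeasurableSpace Ω] [MeasurableSpace H] {P : Measure Ω}

/-- The joint density at `y` of `n` successive Gaussian observations with conditional means
`m i (h, y 0, …, y (i - 1))` and variances `v i`, where `h` stands for all that is not observed. -/
noncomputable def likelihood (m : (n : ℕ) → H × (Fin n → ℝ) → ℝ) (v : ℕ → ℝ≥0) (n : ℕ) (h : H)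
    (y : Fin n → ℝ) : ℝ≥0∞ :=
  ∏ i : Fin n, gaussianPDF (m i (h, fun j : Fin i => y (j.castLE i.2.le))) (v i) (y i)

omit [MeasurableSpace H] in
lemma likelihood_snoc (m : (n : ℕ) → H × (Fin n → ℝ) → ℝ) (v : ℕ → ℝ≥0) (n : ℕ) (h : H)
    (y : Fin n → ℝ) (z : ℝ) :
    likelihood m v (n + 1) h (Fin.snoc y z) =
      likelihood m v n h y * gaussianPDF (m n (h, y)) (v n) z := by
  have e : ∀ i : Fin (n + 1), (fun j : Fin i => (Fin.snoc y z : Fin (n + 1) → ℝ)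
      (j.castLE i.2.le)) = fun j : Fin i => y ⟨j, j.2.trans_le (Nat.lt_succ_iff.1 i.2)⟩ := by
    intro i
    funext j
    have : j.castLE i.2.le = Fin.castSucc ⟨j, j.2.trans_le (Nat.lt_succ_iff.1 i.2)⟩ := rfl
    rw [this, Fin.snoc_castSucc]
  simp only [likelihood, e, Fin.prod_univ_castSucc, Fin.snoc_castSucc, Fin.snoc_last]
  rfl

lemma measurable_likelihood {m : (n : ℕ) → H × (Fin n → ℝ) → ℝ} (hm : ∀ n, Measurable (m n))
    (v : ℕ → ℝ≥0) (n : ℕ) : Measurable fun p : H × (Fin n → ℝ) => likelihood m v n p.1 p.2 := by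
  refine Finset.measurable_prod _ fun i _ => ?_
  have h1 : Measurable fun p : H × (Fin n → ℝ) => m i (p.1, fun j : Fin i => p.2 (j.castLE i.2.le)) :=
    (hm i).comp (by fun_prop)
  exact measurable_uncurry_gaussianPDF.comp
    (h1.prodMk (measurable_const.prodMk ((measurable_pi_apply i).comp measurable_snd)))

lemma measurable_likelihood_right {m : (n : ℕ) → H × (Fin n → ℝ) → ℝ} (hm : ∀ n, Measurable (m n))
    (v : ℕ → ℝ≥0) (n : ℕ) (h : H) : Measurable (likelihood m v n h) := by
  have h1 := measurable_likelihood hm v n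
  generalize likelihood m v n = F at h1 ⊢
  exact h1.comp (measurable_prodMk_left (x := h))

omit [MeasurableSpace H] in
lemma likelihood_ne_zero (m : (n : ℕ) → H × (Fin n → ℝ) → ℝ) {v : ℕ → ℝ≥0} (hv : ∀ n, v n ≠ 0)
    (n : ℕ) (h : H) (y : Fin n → ℝ) : likelihood m v n h y ≠ 0 := by
  unfold likelihood
  exact Finset.prod_ne_zero_iff.2 fun i _ => (gaussianPDF_pos _ (hv i) _).ne'

omit [MeasurableSpace H] in
lemma likelihood_ne_top (m : (n : ℕ) → H × (Fin n → ℝ) → ℝ) (v : ℕ → ℝ≥0)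
    (n : ℕ) (h : H) (y : Fin n → ℝ) : likelihood m v n h y ≠ ∞ := by
  unfold likelihood
  exact ENNReal.prod_ne_top fun i _ => gaussianPDF_ne_top

lemma log_gaussianPDFReal (m : ℝ) {v : ℝ≥0} (hv : v ≠ 0) (x : ℝ) :
    Real.log (gaussianPDFReal m v x) =
      -(Real.log (2 * Real.pi) + Real.log v) / 2 - (x - m) ^ 2 / (2 * v) := by
  have hv0 : (0 : ℝ) < v := lt_of_le_of_ne v.coe_nonneg (by exact_mod_cast hv.symm)
  rw [gaussianPDFReal, Real.log_mul (by positivity) (Real.exp_pos _).ne', Real.log_exp,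
    Real.log_inv, Real.log_sqrt (by positivity), Real.log_mul (by positivity) hv0.ne']
  ring

omit [MeasurableSpace H] in
lemma log_likelihood (m : (n : ℕ) → H × (Fin n → ℝ) → ℝ) {v : ℕ → ℝ≥0} (hv : ∀ n, v n ≠ 0)
    (n : ℕ) (h : H) (y : Fin n → ℝ) : Real.log (likelihood m v n h y).toReal =
      ∑ i : Fin n, (-(Real.log (2 * Real.pi) + Real.log (v i)) / 2 -
        (y i - m i (h, fun j : Fin i => y (j.castLE i.2.le))) ^ 2 / (2 * v i)) := by
  simp only [likelihood, ENNReal.toReal_prod, toReal_gaussianPDF]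
  rw [Real.log_prod fun i : Fin n => fun _ => (gaussianPDFReal_pos _ _ _ (hv i)).ne']
  exact Finset.sum_congr rfl fun i _ => log_gaussianPDFReal _ (hv i) _

lemma measurable_prod_gaussianPDF {n : ℕ} (v : ℝ≥0) :
    Measurable fun q : (Fin n → ℝ) × (Fin n → ℝ) => ∏ i, gaussianPDF (q.1 i) v (q.2 i) := by
  refine Finset.measurable_prod _ fun i _ => ?_
  have h1 : Measurable fun q : (Fin n → ℝ) × (Fin n → ℝ) => q.1 i := by fun_prop
  have h2 : Measurable fun q : (Fin n → ℝ) × (Fin n → ℝ) => q.2 i := by fun_prop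
  exact measurable_uncurry_gaussianPDF.comp (h1.prodMk (measurable_const.prodMk h2))

lemma log_prod_gaussianPDF {n : ℕ} {v : ℝ≥0} (hv : v ≠ 0) (z y : Fin n → ℝ) :
    Real.log (∏ i, gaussianPDF (z i) v (y i)).toReal =
      ∑ i : Fin n, (-(Real.log (2 * Real.pi) + Real.log v) / 2 - (y i - z i) ^ 2 / (2 * v)) := by
  simp only [ENNReal.toReal_prod, toReal_gaussianPDF]
  rw [Real.log_prod (fun i _ => (gaussianPDFReal_pos _ _ _ hv).ne')]
  exact Finset.sum_congr rfl fun i _ => log_gaussianPDFReal _ hv _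

lemma lintegral_gaussianReal_eq (μ : ℝ) {v : ℝ≥0} (hv : v ≠ 0) {F : ℝ → ℝ≥0∞} (hF : Measurable F) :
    ∫⁻ e, F (μ + e) ∂(gaussianReal 0 v) = ∫⁻ z, F z * gaussianPDF μ v z := by
  have h := gaussianReal_map_const_add (μ := 0) (v := v) μ
  rw [zero_add] at h
  rw [← lintegral_map hF (by fun_prop), h, gaussianReal_of_var_ne_zero _ hv,
    lintegral_withDensity_eq_lintegral_mul _ (measurable_gaussianPDF _ _) hF]
  simp only [Pi.mul_apply, mul_comm]

/-- If each observation is Gaussian given `V` and the past, with a mean that is a measurable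
function of `V` and the past, then the law of `V` and the first `n` observations has density
`likelihood` with respect to the product of the law of `V` and Lebesgue measure. -/
lemma lintegral_eq_lintegral_likelihood [IsProbabilityMeasure P] {V : Ω → H} (hV : Measurable V)
    {m : (n : ℕ) → H × (Fin n → ℝ) → ℝ} (hm : ∀ n, Measurable (m n)) {v : ℕ → ℝ≥0}
    (hv : ∀ n, v n ≠ 0) {y ε : ℕ → Ω → ℝ} (hy : ∀ n, Measurable (y n))
    (hε : ∀ n, Measurable (ε n)) (hlaw : ∀ n, P.map (ε n) = gaussianReal 0 (v n))
    (hind : ∀ n, IndepFun (fun ω => (V ω, fun i : Fin n => y i ω)) (ε n) P)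
    (hrec : ∀ n ω, y n ω = m n (V ω, fun i : Fin n => y i ω) + ε n ω) (n : ℕ)
    {F : H × (Fin n → ℝ) → ℝ≥0∞} (hF : Measurable F) :
    ∫⁻ ω, F (V ω, fun i : Fin n => y i ω) ∂P =
      ∫⁻ h, (∫⁻ y, F (h, y) * likelihood m v n h y) ∂(P.map V) := by
  induction n with
  | zero =>
    rw [lintegral_map (Measurable.lintegral_prod_right' (f := fun p : H × (Fin 0 → ℝ) =>
      F p * likelihood m v 0 p.1 p.2) (hF.mul (measurable_likelihood hm v 0))) hV]
    refine lintegral_congr fun ω => ?_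
    rw [Measure.volume_pi_eq_dirac 0, lintegral_dirac]
    simp only [likelihood, Finset.univ_eq_empty, Finset.prod_empty, mul_one]
    congr
    funext i
    exact i.elim0
  | succ n ih =>
    have hW : Measurable fun ω => (V ω, fun i : Fin n => y i ω) := by fun_prop
    have hsnoc : ∀ ω, (fun i : Fin (n + 1) => y i ω) =
        Fin.snoc (fun i : Fin n => y i ω) (m n (V ω, fun i : Fin n => y i ω) + ε n ω) := by
      intro ω
      funext i
      induction i using Fin.lastCases with
      | last => simp [← hrec]
      | cast i => simp
    have hG : Measurable fun p : (H × (Fin n → ℝ)) × ℝ => F (p.1.1, Fin.snoc p.1.2 p.2) :=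
      hF.comp (measurable_fst.fst.prodMk
        ((measurable_finSnoc n).comp (measurable_fst.snd.prodMk measurable_snd)))
    have hpdf : Measurable fun p : (H × (Fin n → ℝ)) × ℝ => gaussianPDF (m n p.1) (v n) p.2 :=
      measurable_uncurry_gaussianPDF.comp
        (((hm n).comp measurable_fst).prodMk (measurable_const.prodMk measurable_snd))
    have hK : Measurable fun p : H × (Fin n → ℝ) =>
        ∫⁻ z, F (p.1, Fin.snoc p.2 z) * gaussianPDF (m n p) (v n) z :=
      Measurable.lintegral_prod_right' (hG.mul hpdf)
    calc ∫⁻ ω, F (V ω, fun i : Fin (n + 1) => y i ω) ∂P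
        = ∫⁻ ω, (fun p : (H × (Fin n → ℝ)) × ℝ => F (p.1.1, Fin.snoc p.1.2 (m n p.1 + p.2)))
            ((V ω, fun i : Fin n => y i ω), ε n ω) ∂P := by
          refine lintegral_congr fun ω => ?_
          rw [hsnoc]
      _ = ∫⁻ ω, ∫⁻ e, F (V ω, Fin.snoc (fun i : Fin n => y i ω)
            (m n (V ω, fun i : Fin n => y i ω) + e)) ∂(gaussianReal 0 (v n)) ∂P := by
          rw [lintegral_prodMk_of_indepFun hW (hε n) (hind n)
            (F := fun p => F (p.1.1, Fin.snoc p.1.2 (m n p.1 + p.2))), hlaw]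
          exact hG.comp (measurable_fst.prodMk (((hm n).comp measurable_fst).add measurable_snd))
      _ = ∫⁻ ω, (fun p : H × (Fin n → ℝ) =>
            ∫⁻ z, F (p.1, Fin.snoc p.2 z) * gaussianPDF (m n p) (v n) z)
            (V ω, fun i : Fin n => y i ω) ∂P := by
          refine lintegral_congr fun ω => ?_
          exact lintegral_gaussianReal_eq _ (hv n) (hG.comp (measurable_prodMk_left
            (x := (V ω, fun i : Fin n => y i ω))))
      _ = ∫⁻ h, (∫⁻ y, (∫⁻ z, F (h, Fin.snoc y z) * gaussianPDF (m n (h, y)) (v n) z) *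
            likelihood m v n h y) ∂(P.map V) := ih hK
      _ = ∫⁻ h, (∫⁻ y, F (h, y) * likelihood m v (n + 1) h y) ∂(P.map V) := by
          refine lintegral_congr fun h => ?_
          rw [lintegral_finSnoc (F := fun y => F (h, y) * likelihood m v (n + 1) h y)
            ((hF.mul (measurable_likelihood hm v (n + 1))).comp
              (measurable_const.prodMk measurable_id))]
          refine lintegral_congr fun y => ?_
          have hz : Measurable fun z => F (h, Fin.snoc y z) * gaussianPDF (m n (h, y)) (v n) z :=
            (hG.mul hpdf).comp (measurable_prodMk_left (x := (h, y)))
          rw [← lintegral_mul_const _ hz]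
          refine lintegral_congr fun z => ?_
          rw [likelihood_snoc]
          ring

/-- The noise of round `n` is independent of the past, if the noise is i.i.d. and independent of
`V`, and the observations are generated recursively from `V` and the noise. -/
lemma indepFun_history [IsProbabilityMeasure P] {V : Ω → H} (hV : Measurable V)
    {m : (n : ℕ) → H × (Fin n → ℝ) → ℝ} (hm : ∀ n, Measurable (m n)) {y ε : ℕ → Ω → ℝ}
    (hε : ∀ n, Measurable (ε n)) (hind : IndepFun V (fun ω n => ε n ω) P) (hiid : iIndepFun ε P)
    (hrec : ∀ n ω, y n ω = m n (V ω, fun i : Fin n => y i ω) + ε n ω) (n : ℕ) :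
    IndepFun (fun ω => (V ω, fun i : Fin n => y i ω)) (ε n) P := by
  have h1 : IndepFun (fun ω => fun i : Fin n => ε i ω) (ε n) P := by
    have h := hiid.indepFun_finset (Finset.range n) {n} (by simp) hε
    have hφ : Measurable fun (g : Finset.range n → ℝ) (i : Fin n) =>
        g ⟨i, Finset.mem_range.2 i.2⟩ := by fun_prop
    have hψ : Measurable fun g : ({n} : Finset ℕ) → ℝ => g ⟨n, Finset.mem_singleton_self n⟩ :=
      measurable_pi_apply _
    exact h.comp hφ hψ
  have h2 : IndepFun (fun ω => (V ω, fun i : Fin n => ε i ω)) (ε n) P := by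
    refine IndepFun.prodMk_left_of_indepFun hV (by fun_prop) (hε n) ?_ h1
    exact hind.comp (φ := id) (ψ := fun g => (fun i : Fin n => g i, g n)) measurable_id
      (by fun_prop)
  have h3 : ∀ n : ℕ, ∃ G : H × (Fin n → ℝ) → (Fin n → ℝ), Measurable G ∧
      ∀ ω, (fun i : Fin n => y i ω) = G (V ω, fun i : Fin n => ε i ω) := by
    intro n
    induction n with
    | zero => exact ⟨fun _ => 0, measurable_const, fun ω => funext fun i => i.elim0⟩
    | succ n ih =>
      obtain ⟨G, hG, hGy⟩ := ih
      have hG' : Measurable fun p : H × (Fin (n + 1) → ℝ) =>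
          G (p.1, fun i : Fin n => p.2 i.castSucc) := hG.comp (by fun_prop)
      refine ⟨fun p => Fin.snoc (G (p.1, fun i : Fin n => p.2 i.castSucc))
        (m n (p.1, G (p.1, fun i : Fin n => p.2 i.castSucc)) + p.2 (Fin.last n)), ?_, ?_⟩
      · exact (measurable_finSnoc n).comp (hG'.prodMk
          (((hm n).comp (measurable_fst.prodMk hG')).add
            ((measurable_pi_apply (Fin.last n)).comp measurable_snd)))
      · intro ω
        funext i
        induction i using Fin.lastCases with
        | last => simp [hrec n ω, hGy]
        | cast i => simpa using congrFun (hGy ω) i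
  obtain ⟨G, hG, hGy⟩ := h3 n
  simp only [hGy]
  exact h2.comp (φ := fun p => (p.1, G p)) (measurable_fst.prodMk hG) measurable_id

end Likelihood

/-! ### The Gaussian posterior for fixed query points -/

namespace IsModel

variable {S Ω 𝒰 : Type*} [MeasurableSpace Ω] [MeasurableSpace 𝒰] {P : Measure Ω}
  {k : S → S → ℝ} {σ : ℝ≥0} {f : S → Ω → ℝ} {ε : ℕ → Ω → ℝ} {U : Ω → 𝒰}

lemma memLp_f (hM : IsModel P k σ f ε U) (s : S) : MemLp (f s) 2 P :=
  (hM.gaussian_f.hasGaussianLaw_eval s).memLp_two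

lemma hasGaussianLaw_noise (hM : IsModel P k σ f ε U) (i : ℕ) : HasGaussianLaw (ε i) P :=
  ⟨by rw [hM.law_noise]; infer_instance⟩

lemma memLp_noise (hM : IsModel P k σ f ε U) (i : ℕ) : MemLp (ε i) 2 P :=
  (hM.hasGaussianLaw_noise i).memLp_two

lemma integral_noise (hM : IsModel P k σ f ε U) (i : ℕ) : ∫ ω, ε i ω ∂P = 0 := by
  have h := integral_map (μ := P) (hM.measurable_noise i).aemeasurable
    (f := fun x : ℝ => x) (by fun_prop)
  rw [hM.law_noise, integral_id_gaussianReal] at h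
  exact h.symm

lemma indepFun_f_noise (hM : IsModel P k σ f ε U) (s : S) (i : ℕ) : IndepFun (f s) (ε i) P :=
  hM.indep_f_noise.comp (measurable_pi_apply s) (measurable_pi_apply i)

lemma cov_noise (hM : IsModel P k σ f ε U) (i j : ℕ) :
    cov[ε i, ε j; P] = if i = j then (σ : ℝ) ^ 2 else 0 := by
  split_ifs with h
  · subst h
    rw [covariance_self (hM.measurable_noise i).aemeasurable,
      ← variance_id_map (hM.measurable_noise i).aemeasurable, hM.law_noise, variance_id_gaussianReal]
    simp
  · exact (hM.indep_noise.indepFun h).covariance_eq_zero (hM.memLp_noise i) (hM.memLp_noise j)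

lemma cov_f_noise (hM : IsModel P k σ f ε U) (s : S) (i : ℕ) : cov[f s, ε i; P] = 0 :=
  (hM.indepFun_f_noise s i).covariance_eq_zero (hM.memLp_f s) (hM.memLp_noise i)

/-- The kernel of a centred Gaussian process is given by a feature map into `L²(P)`. -/
lemma kernel_eq_inner [IsProbabilityMeasure P] (hM : IsModel P k σ f ε U) (s t : S) :
    k s t = inner ℝ ((hM.memLp_f s).toLp (f s)) ((hM.memLp_f t).toLp (f t)) := by
  rw [← hM.cov_f, covariance_eq_sub (hM.memLp_f s) (hM.memLp_f t), hM.mean_f, hM.mean_f, L2.inner_def]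
  simp only [mul_zero, sub_zero, Pi.mul_apply]
  refine integral_congr_ae ?_
  filter_upwards [(hM.memLp_f s).coeFn_toLp, (hM.memLp_f t).coeFn_toLp] with ω h1 h2
  rw [h1, h2, real_inner_eq_re_inner]
  simp [mul_comm]

lemma kernel_comm [IsProbabilityMeasure P] (hM : IsModel P k σ f ε U) (s t : S) : k s t = k t s := by
  rw [hM.kernel_eq_inner, hM.kernel_eq_inner, real_inner_comm]

variable {n : ℕ} (a : Fin n → S) (s : S)

lemma memLp_obs (hM : IsModel P k σ f ε U) (i : Fin n) :
    MemLp (fun ω => f (a i) ω + ε i ω) 2 P :=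
  (hM.memLp_f _).add (hM.memLp_noise _)

lemma cov_obs_obs [IsProbabilityMeasure P] (hM : IsModel P k σ f ε U) (i j : Fin n) :
    cov[fun ω => f (a i) ω + ε i ω, fun ω => f (a j) ω + ε j ω; P] = regGram k σ a i j := by
  have h1 := covariance_add_left (μ := P) (hM.memLp_f (a i)) (hM.memLp_noise i) (hM.memLp_obs a j)
  have h2 := covariance_add_right (μ := P) (hM.memLp_f (a i)) (hM.memLp_f (a j)) (hM.memLp_noise j)
  have h3 := covariance_add_right (μ := P) (hM.memLp_noise i) (hM.memLp_f (a j)) (hM.memLp_noise j)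
  change cov[f (a i) + ε i, f (a j) + ε j; P] = _
  change cov[f (a i) + ε i, f (a j) + ε j; P] =
    cov[f (a i), f (a j) + ε j; P] + cov[ε i, f (a j) + ε j; P] at h1
  rw [h1, h2, h3, hM.cov_f, hM.cov_f_noise, covariance_comm, hM.cov_f_noise, hM.cov_noise]
  simp [regGram, Matrix.one_apply, Fin.ext_iff]

lemma cov_f_obs [IsProbabilityMeasure P] (hM : IsModel P k σ f ε U) (j : Fin n) :
    cov[f s, fun ω => f (a j) ω + ε j ω; P] = k s (a j) := by
  have h2 := covariance_add_right (μ := P) (hM.memLp_f s) (hM.memLp_f (a j)) (hM.memLp_noise j)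
  change cov[f s, f (a j) + ε j; P] = _
  rw [h2, hM.cov_f, hM.cov_f_noise, add_zero]

lemma memLp_mean (hM : IsModel P k σ f ε U) :
    MemLp (fun ω => ∑ i, postWeight k σ a s i * (f (a i) ω + ε i ω)) 2 P :=
  memLp_finsetSum _ fun i _ => (hM.memLp_obs a i).const_mul _

/-- The residual `f s - ∑ w i * Y i` of the posterior mean is uncorrelated with the observations. -/
lemma cov_residual_obs [IsProbabilityMeasure P] (hM : IsModel P k σ f ε U) (hσ : 0 < σ) (j : Fin n) :
    cov[fun ω => f s ω - ∑ i, postWeight k σ a s i * (f (a i) ω + ε i ω),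
      fun ω => f (a j) ω + ε j ω; P] = 0 := by
  rw [covariance_fun_sub_left (hM.memLp_f s) (hM.memLp_mean a s) (hM.memLp_obs a j),
    covariance_fun_sum_left (fun i => (hM.memLp_obs a i).const_mul _) (hM.memLp_obs a j),
    hM.cov_f_obs, ← congrFun (regGram_mulVec_postWeight hM.kernel_eq_inner hσ a s) j]
  simp only [covariance_const_mul_left, hM.cov_obs_obs, Matrix.mulVec, dotProduct]
  rw [← Finset.sum_sub_distrib]
  refine Finset.sum_eq_zero fun i _ => ?_
  have : regGram k σ a i j = regGram k σ a j i := by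
    simp [regGram, hM.kernel_comm (a i), Matrix.one_apply, eq_comm]
  rw [this]
  ring

lemma variance_residual [IsProbabilityMeasure P] (hM : IsModel P k σ f ε U) (hσ : 0 < σ) :
    Var[fun ω => f s ω - ∑ i, postWeight k σ a s i * (f (a i) ω + ε i ω); P] =
      postVar k σ a s := by
  have hW : MemLp (fun ω => f s ω - ∑ i, postWeight k σ a s i * (f (a i) ω + ε i ω)) 2 P :=
    (hM.memLp_f s).sub (hM.memLp_mean a s)
  rw [← covariance_self hW.aemeasurable,
    covariance_fun_sub_right hW (hM.memLp_f s) (hM.memLp_mean a s),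
    covariance_fun_sum_right (fun i => (hM.memLp_obs a i).const_mul _) hW]
  simp only [covariance_const_mul_right, hM.cov_residual_obs a s hσ, mul_zero,
    Finset.sum_const_zero, sub_zero]
  rw [covariance_comm, covariance_fun_sub_right (hM.memLp_f s) (hM.memLp_f s) (hM.memLp_mean a s),
    covariance_fun_sum_right (fun i => (hM.memLp_obs a i).const_mul _) (hM.memLp_f s), hM.cov_f]
  simp only [covariance_const_mul_right, hM.cov_f_obs]
  rw [postVar, dotProduct]
  congr 1
  exact Finset.sum_congr rfl fun i _ => mul_comm _ _

/-- The residual and the observations are jointly Gaussian, as a linear image of finitely many values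
of the process and of the noise. -/
lemma hasGaussianLaw_residual_obs (hM : IsModel P k σ f ε U) :
    HasGaussianLaw (fun ω => ((fun _ : Unit =>
      f s ω - ∑ i, postWeight k σ a s i * (f (a i) ω + ε i ω)),
      fun i : Fin n => f (a i) ω + ε i ω)) P := by
  classical
  have hX : HasGaussianLaw (fun ω (o : Option (Fin n)) => f (o.elim s a) ω) P := by
    let I : Finset S := Finset.univ.image fun o : Option (Fin n) => o.elim s a
    let L : (I → ℝ) →L[ℝ] (Option (Fin n) → ℝ) :=
      { toFun := fun x o => x ⟨o.elim s a, Finset.mem_image_of_mem _ (Finset.mem_univ o)⟩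
        map_add' := fun _ _ => rfl
        map_smul' := fun _ _ => rfl
        cont := by fun_prop }
    exact (hM.gaussian_f.hasGaussianLaw I).map L
  have hE : HasGaussianLaw (fun ω (i : Fin n) => ε i ω) P :=
    (hM.indep_noise.precomp Fin.val_injective).hasGaussianLaw
      (X := fun i : Fin n => ε i) (fun i => hM.hasGaussianLaw_noise i)
  have hXE : IndepFun (fun ω (o : Option (Fin n)) => f (o.elim s a) ω)
      (fun ω (i : Fin n) => ε i ω) P :=
    hM.indep_f_noise.comp (φ := fun (x : S → ℝ) (o : Option (Fin n)) => x (o.elim s a))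
      (ψ := fun (e : ℕ → ℝ) (i : Fin n) => e i) (by fun_prop) (by fun_prop)
  let L : ((Option (Fin n) → ℝ) × (Fin n → ℝ)) →L[ℝ] ((Unit → ℝ) × (Fin n → ℝ)) :=
    { toFun := fun p => ((fun _ => p.1 none - ∑ i, postWeight k σ a s i * (p.1 (some i) + p.2 i)),
        fun i => p.1 (some i) + p.2 i)
      map_add' := fun p q => by
        ext
        · simp only [Prod.fst_add, Prod.snd_add, Pi.add_apply, mul_add, Finset.sum_add_distrib]
          ring
        · simp only [Prod.fst_add, Prod.snd_add, Pi.add_apply]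
          ring
      map_smul' := fun c p => by
        ext
        · simp only [Prod.smul_fst, Prod.smul_snd, Pi.smul_apply, smul_eq_mul, mul_sub,
            Finset.mul_sum, RingHom.id_apply]
          congr 1
          exact Finset.sum_congr rfl fun i _ => by ring
        · simp only [Prod.smul_fst, Prod.smul_snd, Pi.smul_apply, smul_eq_mul, RingHom.id_apply]
          ring
      cont := by fun_prop }
  exact (hXE.hasGaussianLaw hX hE).map L

lemma indepFun_residual_obs [IsProbabilityMeasure P] (hM : IsModel P k σ f ε U) (hσ : 0 < σ) :
    IndepFun (fun ω => f s ω - ∑ i, postWeight k σ a s i * (f (a i) ω + ε i ω))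
      (fun ω (i : Fin n) => f (a i) ω + ε i ω) P :=
  ((hM.hasGaussianLaw_residual_obs a s).indepFun_of_covariance_eval
    (X := fun _ : Unit => fun ω => f s ω - ∑ i, postWeight k σ a s i * (f (a i) ω + ε i ω))
    (Y := fun i : Fin n => fun ω => f (a i) ω + ε i ω)
    fun _ j => hM.cov_residual_obs a s hσ j).comp (φ := fun x : Unit → ℝ => x ()) (ψ := id)
      (by fun_prop) measurable_id

lemma map_residual [IsProbabilityMeasure P] (hM : IsModel P k σ f ε U) (hσ : 0 < σ) :
    P.map (fun ω => f s ω - ∑ i, postWeight k σ a s i * (f (a i) ω + ε i ω)) =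
      gaussianReal 0 (postVar k σ a s).toNNReal := by
  have h := ((hM.hasGaussianLaw_residual_obs a s).fst.eval ()).map_eq_gaussianReal
  rw [hM.variance_residual a s hσ] at h
  rw [h]
  congr 1
  have hi : ∀ i : Fin n, Integrable (fun ω => postWeight k σ a s i * (f (a i) ω + ε i ω)) P :=
    fun i => ((hM.memLp_obs a i).integrable one_le_two).const_mul _
  rw [integral_sub ((hM.memLp_f s).integrable one_le_two) (integrable_finsetSum _ fun i _ => hi i),
    integral_finsetSum _ fun i _ => hi i, hM.mean_f]
  simp only [integral_const_mul]
  have : ∀ i : Fin n, ∫ ω, f (a i) ω + ε i ω ∂P = 0 := fun i => by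
    rw [integral_add ((hM.memLp_f _).integrable one_le_two)
      ((hM.memLp_noise _).integrable one_le_two), hM.mean_f, hM.integral_noise, add_zero]
  simp [this]

end IsModel

/-! ### Mutual information of noisy Gaussian observations -/

namespace IsModel

variable {S Ω 𝒰 : Type*} [MeasurableSpace Ω] [MeasurableSpace 𝒰] {P : Measure Ω}
  {k : S → S → ℝ} {σ : ℝ≥0} {f : S → Ω → ℝ} {ε : ℕ → Ω → ℝ} {U : Ω → 𝒰}

lemma measurable_path (hM : IsModel P k σ f ε U) : Measurable fun ω s => f s ω :=
  measurable_pi_lambda _ hM.measurable_f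

lemma measurable_obs (hM : IsModel P k σ f ε U) (a : ℕ → S) (n : ℕ) :
    Measurable fun ω => f (a n) ω + ε n ω :=
  (hM.measurable_f _).add (hM.measurable_noise _)

variable [IsProbabilityMeasure P]

/-- The noise at time `n` is independent of the process and of the observations made before. -/
lemma indepFun_path_obs_noise (hM : IsModel P k σ f ε U) (a : ℕ → S) (n : ℕ) :
    IndepFun (fun ω => ((fun s => f s ω), fun i : Fin n => f (a i) ω + ε i ω)) (ε n) P :=
  indepFun_history (m := fun n (p : (S → ℝ) × (Fin n → ℝ)) => p.1 (a n))
    (y := fun n ω => f (a n) ω + ε n ω) hM.measurable_path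
    (fun n => (measurable_pi_apply (a n)).comp measurable_fst) hM.measurable_noise
    hM.indep_f_noise hM.indep_noise (fun _ _ => rfl) n

/-- The joint law of the process and of the observations at fixed points. -/
lemma lintegral_fixed_design (hM : IsModel P k σ f ε U) (hσ : 0 < σ) (a : ℕ → S) (n : ℕ)
    {G : (S → ℝ) × (Fin n → ℝ) → ℝ≥0∞} (hG : Measurable G) :
    ∫⁻ ω, G (fun s => f s ω, fun i : Fin n => f (a i) ω + ε i ω) ∂P =
      ∫⁻ ω, (∫⁻ y, G (fun s => f s ω, y) *
        ∏ i : Fin n, gaussianPDF (f (a i) ω) (σ ^ 2) (y i)) ∂P := by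
  have hm : ∀ n, Measurable fun p : (S → ℝ) × (Fin n → ℝ) => p.1 (a n) :=
    fun n => (measurable_pi_apply (a n)).comp measurable_fst
  rw [lintegral_eq_lintegral_likelihood (m := fun n (p : (S → ℝ) × (Fin n → ℝ)) => p.1 (a n))
    (v := fun _ => σ ^ 2) (y := fun n ω => f (a n) ω + ε n ω) hM.measurable_path hm
    (fun _ => (pow_pos hσ 2).ne') (hM.measurable_obs a) hM.measurable_noise hM.law_noise
    (hM.indepFun_path_obs_noise a) (fun _ _ => rfl) n hG, lintegral_map _ hM.measurable_path]
  · rfl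
  · exact Measurable.lintegral_prod_right' (f := fun p : (S → ℝ) × (Fin n → ℝ) =>
      G p * likelihood _ _ n p.1 p.2) (hG.mul (measurable_likelihood hm _ n))

/-- The innovation at time `n`: the observation minus its posterior mean given the past. -/
lemma indepFun_obs_innovation (hM : IsModel P k σ f ε U) (hσ : 0 < σ) (a : ℕ → S) (n : ℕ) :
    IndepFun (fun ω (i : Fin n) => f (a i) ω + ε i ω) (fun ω => f (a n) ω + ε n ω -
      postMean k σ (fun i : Fin n => a i) (fun i => f (a i) ω + ε i ω) (a n)) P ∧
    P.map (fun ω => f (a n) ω + ε n ω -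
      postMean k σ (fun i : Fin n => a i) (fun i => f (a i) ω + ε i ω) (a n)) =
      gaussianReal 0 ((postVar k σ (fun i : Fin n => a i) (a n)).toNNReal + σ ^ 2) := by
  set W : Ω → ℝ := fun ω => f (a n) ω -
    ∑ i : Fin n, postWeight k σ (fun i : Fin n => a i) (a n) i * (f (a i) ω + ε i ω) with hW
  have hWm : Measurable W := (hM.measurable_f _).sub
    (Finset.measurable_sum _ fun i _ => (hM.measurable_obs a i).const_mul _)
  have hYm : Measurable fun ω (i : Fin n) => f (a i) ω + ε i ω :=
    measurable_pi_lambda _ fun i => hM.measurable_obs a i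
  have hWY : IndepFun W (fun ω (i : Fin n) => f (a i) ω + ε i ω) P :=
    hM.indepFun_residual_obs (fun i : Fin n => a i) (a n) hσ
  have hε : IndepFun (ε n) (fun ω => (W ω, fun i : Fin n => f (a i) ω + ε i ω)) P := by
    refine (hM.indepFun_path_obs_noise a n).symm.comp (φ := id)
      (ψ := fun p : (S → ℝ) × (Fin n → ℝ) => (p.1 (a n) -
        ∑ i : Fin n, postWeight k σ (fun i : Fin n => a i) (a n) i * p.2 i, p.2))
      measurable_id ?_
    refine Measurable.prodMk (Measurable.sub ((measurable_pi_apply (a n)).comp measurable_fst) ?_)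
      measurable_snd
    exact Finset.measurable_sum _ fun i _ =>
      ((measurable_pi_apply i).comp measurable_snd).const_mul _
  have hinn : (fun ω => f (a n) ω + ε n ω -
      postMean k σ (fun i : Fin n => a i) (fun i => f (a i) ω + ε i ω) (a n)) = W + ε n := by
    funext ω
    rw [postMean_eq_sum hM.kernel_eq_inner]
    simp only [hW, Pi.add_apply]
    ring
  rw [hinn]
  constructor
  · have h := IndepFun.prodMk_left_of_indepFun (hM.measurable_noise n) hWm hYm hε hWY
    have h' := h.comp (φ := fun p : ℝ × ℝ => p.2 + p.1) (ψ := id) (by fun_prop) measurable_id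
    exact h'.symm
  · have hWε : IndepFun W (ε n) P := (hε.comp (φ := id) measurable_id measurable_fst).symm
    have h := gaussianReal_add_gaussianReal_of_indepFun hWε
      (hM.map_residual (fun i : Fin n => a i) (a n) hσ) (hM.law_noise n)
    rwa [add_zero] at h

/-- The predictive mean of the `n`-th observation at fixed points, given the earlier ones. -/
noncomputable def _root_.GPEI.predMean (k : S → S → ℝ) (σ : ℝ≥0) (a : ℕ → S) (n : ℕ)
    (p : Unit × (Fin n → ℝ)) : ℝ :=
  postMean k σ (fun i : Fin n => a i) p.2 (a n)

/-- The predictive variance of the `n`-th observation at fixed points, given the earlier ones. -/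
noncomputable def _root_.GPEI.predVar (k : S → S → ℝ) (σ : ℝ≥0) (a : ℕ → S) (n : ℕ) : ℝ≥0 :=
  (postVar k σ (fun i : Fin n => a i) (a n)).toNNReal + σ ^ 2

omit [MeasurableSpace Ω] [MeasurableSpace 𝒰] [IsProbabilityMeasure P] in
lemma _root_.GPEI.predVar_ne_zero (hσ : 0 < σ) (a : ℕ → S) (n : ℕ) : predVar k σ a n ≠ 0 :=
  (add_pos_of_nonneg_of_pos zero_le (pow_pos hσ 2)).ne'

lemma measurable_predMean (hM : IsModel P k σ f ε U) (a : ℕ → S) (n : ℕ) :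
    Measurable (predMean k σ a n) := by
  unfold predMean
  simp only [postMean_eq_sum hM.kernel_eq_inner]
  exact Finset.measurable_sum _ fun i _ =>
    ((measurable_pi_apply i).comp measurable_snd).const_mul _

/-- The density of the observations at fixed points, as a product over successive innovations. -/
lemma lintegral_obs (hM : IsModel P k σ f ε U) (hσ : 0 < σ) (a : ℕ → S) (n : ℕ)
    {G : (Fin n → ℝ) → ℝ≥0∞} (hG : Measurable G) :
    ∫⁻ ω, G (fun i : Fin n => f (a i) ω + ε i ω) ∂P =
      ∫⁻ y, G y * likelihood (predMean k σ a) (predVar k σ a) n () y := by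
  have hY : ∀ n, Measurable fun ω => fun i : Fin n => f (a i) ω + ε i ω := fun n =>
    measurable_pi_lambda _ fun i => hM.measurable_obs a i
  have hind : ∀ n, IndepFun (fun ω => ((), fun i : Fin n => f (a i) ω + ε i ω))
      (fun ω => f (a n) ω + ε n ω -
        predMean k σ a n ((), fun i : Fin n => f (a i) ω + ε i ω)) P := fun n =>
    (hM.indepFun_obs_innovation hσ a n).1.comp
      (φ := fun y : Fin n → ℝ => ((), y)) (ψ := id) (by fun_prop) measurable_id
  have h := lintegral_eq_lintegral_likelihood (P := P) (V := fun _ => ())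
    (m := predMean k σ a) (v := predVar k σ a) (y := fun n ω => f (a n) ω + ε n ω)
    (ε := fun n ω => f (a n) ω + ε n ω -
      predMean k σ a n ((), fun i : Fin n => f (a i) ω + ε i ω))
    measurable_const (hM.measurable_predMean a) (predVar_ne_zero hσ a) (hM.measurable_obs a)
    (fun n => (hM.measurable_obs a n).sub
      ((hM.measurable_predMean a n).comp (measurable_const.prodMk (hY n))))
    (fun n => (hM.indepFun_obs_innovation hσ a n).2) hind
    (fun n ω => (add_sub_cancel _ _).symm) n (F := fun p => G p.2) (hG.comp measurable_snd)
  rw [h, lintegral_map Measurable.of_discrete measurable_const]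
  simp

omit [IsProbabilityMeasure P] in
lemma _root_.GPEI.integral_sq_of_map_eq_gaussianReal {X : Ω → ℝ} (hX : Measurable X) {v : ℝ≥0}
    (h : P.map X = gaussianReal 0 v) :
    Integrable (fun ω => X ω ^ 2) P ∧ ∫ ω, X ω ^ 2 ∂P = v := by
  have hL : HasGaussianLaw X P := ⟨by rw [h]; infer_instance⟩
  refine ⟨hL.memLp_two.integrable_sq, ?_⟩
  have h0 : ∫ ω, X ω ∂P = 0 := by
    have := integral_map (μ := P) hX.aemeasurable (f := fun x : ℝ => x) (by fun_prop)
    rw [h, integral_id_gaussianReal] at this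
    exact this.symm
  rw [← variance_of_integral_eq_zero hX.aemeasurable h0, ← variance_id_map hX.aemeasurable, h,
    variance_id_gaussianReal]

end IsModel

namespace IsModel

variable {S Ω 𝒰 : Type*} [MeasurableSpace Ω] [MeasurableSpace 𝒰] {P : Measure Ω}
  {k : S → S → ℝ} {σ : ℝ≥0} {f : S → Ω → ℝ} {ε : ℕ → Ω → ℝ} {U : Ω → 𝒰}
  [IsProbabilityMeasure P]

/-- The density of the first `n` observations at the fixed points `a 0, a 1, …`. -/
noncomputable def _root_.GPEI.obsDensity (k : S → S → ℝ) (σ : ℝ≥0) (a : ℕ → S) (n : ℕ)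
    (y : Fin n → ℝ) : ℝ≥0∞ :=
  likelihood (predMean k σ a) (predVar k σ a) n () y

lemma measurable_obsDensity (hM : IsModel P k σ f ε U) (a : ℕ → S) (n : ℕ) :
    Measurable (obsDensity k σ a n) := 
  measurable_likelihood_right (hM.measurable_predMean a) (predVar k σ a) n ()

/-- The information gain of fixed points is the sum of the capacities of the Gaussian channels
formed by the successive innovations. -/
theorem mutualInfo_eq (hM : IsModel P k σ f ε U) (hσ : 0 < σ) (a : ℕ → S) (T : ℕ) :
    mutualInfo P (fun ω (i : Fin T) => f (a i) ω + ε i ω) (fun ω (i : Fin T) => f (a i) ω) =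
      ENNReal.ofReal (∑ n ∈ Finset.range T,
        Real.log (1 + postVar k σ (fun i : Fin n => a i) (a n) / (σ : ℝ) ^ 2) / 2) := by
  set Y : Ω → Fin T → ℝ := fun ω i => f (a i) ω + ε i ω with hYdef
  set Z : Ω → Fin T → ℝ := fun ω i => f (a i) ω with hZdef
  have hY : Measurable Y := measurable_pi_lambda _ fun i => hM.measurable_obs a i
  have hZ : Measurable Z := measurable_pi_lambda _ fun i => hM.measurable_f _
  have hv : σ ^ 2 ≠ 0 := (pow_pos hσ 2).ne'
  set p : (Fin T → ℝ) → ℝ≥0∞ := obsDensity k σ a T with hp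
  set L : (Fin T → ℝ) → (Fin T → ℝ) → ℝ≥0∞ := fun z y =>
    ∏ i : Fin T, gaussianPDF (z i) (σ ^ 2) (y i) with hL
  have hpm : Measurable p := hM.measurable_obsDensity a T
  have hLm : Measurable fun q : (Fin T → ℝ) × (Fin T → ℝ) => L q.2 q.1 := by
    have h1 := measurable_prod_gaussianPDF (n := T) (σ ^ 2)
    have h2 : Measurable fun q : (Fin T → ℝ) × (Fin T → ℝ) => (q.2, q.1) := measurable_swap
    have h3 := h1.comp h2
    exact h3
  have hL0 : ∀ z y, L z y ≠ 0 := fun z y => Finset.prod_ne_zero_iff.2 fun i _ =>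
    (gaussianPDF_pos _ hv _).ne'
  have hLt : ∀ z y, L z y ≠ ∞ := fun z y => ENNReal.prod_ne_top fun i _ => gaussianPDF_ne_top
  have hp0 : ∀ y, p y ≠ 0 := likelihood_ne_zero _ (predVar_ne_zero hσ a) T ()
  have hpt : ∀ y, p y ≠ ∞ := likelihood_ne_top _ _ T ()
  set g : (Fin T → ℝ) × (Fin T → ℝ) → ℝ≥0∞ := fun q => L q.2 q.1 / p q.1 with hg
  have hgm : Measurable g := hLm.div (hpm.comp measurable_fst)
  set μ := P.map fun ω => (Y ω, Z ω) with hμ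
  set ν := (P.map Y).prod (P.map Z) with hν
  have : IsProbabilityMeasure (P.map Y) := Measure.isProbabilityMeasure_map hY.aemeasurable
  have : IsProbabilityMeasure (P.map Z) := Measure.isProbabilityMeasure_map hZ.aemeasurable
  have : IsProbabilityMeasure μ := Measure.isProbabilityMeasure_map (hY.prodMk hZ).aemeasurable
  -- The joint law has the density `L / p` with respect to the product of the marginals, where `L` is
  -- the conditional density of the observations given the path and `p` their density.
  have hdens : μ = ν.withDensity g := by
    ext A hA
    have hA1 : Measurable (A.indicator (1 : (Fin T → ℝ) × (Fin T → ℝ) → ℝ≥0∞)) :=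
      measurable_one.indicator hA
    rw [withDensity_apply _ hA, ← lintegral_indicator_one hA, hμ,
      lintegral_map hA1 (hY.prodMk hZ), ← lintegral_indicator hA]
    have h1 := hM.lintegral_fixed_design hσ a T
      (G := fun q => A.indicator 1 (q.2, fun i : Fin T => q.1 (a i)))
      (hA1.comp (by fun_prop))
    rw [h1, hν, lintegral_prod_symm' _ (hgm.indicator hA),
      lintegral_map (hgm.indicator hA).lintegral_prod_left' hZ]
    refine lintegral_congr fun ω => ?_
    have hF : Measurable fun y => A.indicator g (y, Z ω) :=
      (hgm.indicator hA).comp measurable_prodMk_right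
    rw [lintegral_map hF hY, hM.lintegral_obs hσ a T hF]
    refine lintegral_congr fun y => ?_
    by_cases hy : (y, Z ω) ∈ A
    · have hy' : (y, fun i : Fin T => f (a i) ω) ∈ A := hy
      rw [Set.indicator_of_mem hy, Set.indicator_of_mem hy', Pi.one_apply, one_mul]
      exact (ENNReal.div_mul_cancel (hp0 y) (hpt y)).symm
    · have hy' : (y, fun i : Fin T => f (a i) ω) ∉ A := hy
      rw [Set.indicator_of_notMem hy, Set.indicator_of_notMem hy', zero_mul, zero_mul]
  have hac : μ ≪ ν := hdens ▸ withDensity_absolutelyContinuous ν g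
  have hllr : llr μ ν =ᵐ[μ] fun q => Real.log (g q).toReal := by
    have h1 : μ.rnDeriv ν =ᵐ[ν] g := by rw [hdens]; exact Measure.rnDeriv_withDensity ν hgm
    filter_upwards [hac.ae_le h1] with q hq
    rw [llr, hq]
  set I : ℕ → Ω → ℝ := fun n ω => f (a n) ω + ε n ω -
      postMean k σ (fun i : Fin n => a i) (fun i => f (a i) ω + ε i ω) (a n) with hI
  have hIm : ∀ n, Measurable (I n) := fun n => (hM.measurable_obs a n).sub
    ((hM.measurable_predMean a n).comp ((measurable_const (a := ())).prodMk
      (measurable_pi_lambda _ fun i : Fin n => hM.measurable_obs a i)))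
  have hIsq := fun n => integral_sq_of_map_eq_gaussianReal (hIm n)
    (hM.indepFun_obs_innovation hσ a n).2
  have hεsq := fun n => integral_sq_of_map_eq_gaussianReal (hM.measurable_noise n)
    (hM.law_noise n)
  -- The log-likelihood ratio is a sum of squares of the Gaussian innovations `I n` and noises `ε n`.
  have hlog : ∀ ω, Real.log (g (Y ω, Z ω)).toReal = ∑ n ∈ Finset.range T,
      ((Real.log (predVar k σ a n) - Real.log ((σ ^ 2 : ℝ≥0) : ℝ)) / 2 +
        I n ω ^ 2 / (2 * predVar k σ a n) - ε n ω ^ 2 / (2 * (σ ^ 2 : ℝ≥0))) := by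
    intro ω
    have h1 : Real.log (p (Y ω)).toReal = _ :=
      log_likelihood (predMean k σ a) (predVar_ne_zero hσ a) T () (Y ω)
    have h2 : Real.log (L (Z ω) (Y ω)).toReal = _ := log_prod_gaussianPDF hv (Z ω) (Y ω)
    rw [← Fin.sum_univ_eq_sum_range]
    simp only [hg, ENNReal.toReal_div]
    rw [Real.log_div (ENNReal.toReal_ne_zero.2 ⟨hL0 _ _, hLt _ _⟩)
      (ENNReal.toReal_ne_zero.2 ⟨hp0 _, hpt _⟩), h1, h2, ← Finset.sum_sub_distrib]
    refine Finset.sum_congr rfl fun i _ => ?_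
    have e1 : Y ω i - Z ω i = ε i ω := by simp [hYdef, hZdef]
    have e2 : Y ω i - predMean k σ a i ((), fun j : Fin i => Y ω (j.castLE i.2.le)) = I i ω := rfl
    rw [e1, e2]
    ring
  have hterm : ∀ n, Integrable (fun ω =>
      ((Real.log (predVar k σ a n) - Real.log ((σ ^ 2 : ℝ≥0) : ℝ)) / 2 +
        I n ω ^ 2 / (2 * predVar k σ a n) - ε n ω ^ 2 / (2 * (σ ^ 2 : ℝ≥0)))) P := fun n =>
    ((integrable_const _).add ((hIsq n).1.div_const _)).sub ((hεsq n).1.div_const _)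
  have hint : Integrable (fun ω => Real.log (g (Y ω, Z ω)).toReal) P := by
    simp only [hlog]
    exact integrable_finsetSum _ fun n _ => hterm n
  have hgl : Measurable fun q => Real.log (g q).toReal := hgm.ennreal_toReal.log
  have hintμ : Integrable (llr μ ν) μ := by
    refine Integrable.congr ?_ hllr.symm
    rw [hμ, integrable_map_measure hgl.aestronglyMeasurable (hY.prodMk hZ).aemeasurable]
    exact hint
  rw [mutualInfo, InformationTheory.klDiv_of_ac_of_integrable hac hintμ]
  congr 1
  rw [integral_congr_ae hllr, hμ, integral_map (hY.prodMk hZ).aemeasurable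
    hgl.aestronglyMeasurable]
  simp only [hlog]
  rw [integral_finsetSum _ fun n _ => hterm n]
  have h1 : ν.real Set.univ = 1 := by simp [hν]
  have h2 : (P.map fun ω => (Y ω, Z ω)).real Set.univ = 1 := by
    rw [← hμ]; simp
  rw [h1, h2, add_sub_cancel_right]
  refine Finset.sum_congr rfl fun n _ => ?_
  have hsum : Integrable (fun ω =>
      (Real.log (predVar k σ a n) - Real.log ((σ ^ 2 : ℝ≥0) : ℝ)) / 2 +
        I n ω ^ 2 / (2 * predVar k σ a n)) P :=
    (integrable_const _).add ((hIsq n).1.div_const _)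
  rw [integral_sub hsum ((hεsq n).1.div_const _),
    integral_add (integrable_const _) ((hIsq n).1.div_const _), integral_div, integral_div, integral_div,
    (hIsq n).2, (hεsq n).2]
  have hpv : (0 : ℝ) < predVar k σ a n :=
    lt_of_le_of_ne NNReal.zero_le_coe (by exact_mod_cast (predVar_ne_zero hσ a n).symm)
  have hs : (0 : ℝ) < (σ ^ 2 : ℝ≥0) := by exact_mod_cast pow_pos hσ 2
  have e1 : (((postVar k σ (fun i : Fin n => a i) (a n)).toNNReal + σ ^ 2 : ℝ≥0) : ℝ) /
      (2 * predVar k σ a n) = 1 / 2 := by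
    change (predVar k σ a n : ℝ) / (2 * predVar k σ a n) = 1 / 2
    field_simp
  have e2 : ((σ ^ 2 : ℝ≥0) : ℝ) / (2 * (σ ^ 2 : ℝ≥0)) = 1 / 2 := by field_simp
  have e3 : (predVar k σ a n : ℝ) =
      (1 + postVar k σ (fun i : Fin n => a i) (a n) / (σ : ℝ) ^ 2) * (σ ^ 2 : ℝ≥0) := by
    have hσ' : (σ : ℝ) ≠ 0 := by exact_mod_cast hσ.ne'
    rw [predVar, NNReal.coe_add, Real.coe_toNNReal _ (postVar_nonneg hM.kernel_eq_inner hσ _ _)]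
    push_cast
    field_simp
    ring
  have e4 : 0 < 1 + postVar k σ (fun i : Fin n => a i) (a n) / (σ : ℝ) ^ 2 := by
    have := postVar_nonneg hM.kernel_eq_inner hσ (fun i : Fin n => a i) (a n)
    positivity
  rw [e1, e2, e3, Real.log_mul e4.ne' hs.ne']
  simp

lemma maxInfoGain_ne_top (hM : IsModel P k σ f ε U) (hσ : 0 < σ) [Nonempty S]
    (hk : ∀ s, k s s ≤ 1) (T : ℕ) : maxInfoGain P f ε T ≠ ∞ := by
  refine ne_top_of_le_ne_top (b := ENNReal.ofReal
    (∑ n ∈ Finset.range T, Real.log (1 + 1 / (σ : ℝ) ^ 2) / 2)) ENNReal.ofReal_ne_top ?_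
  refine iSup_le fun a => ?_
  obtain ⟨a', ha'⟩ : ∃ a' : ℕ → S, ∀ i : Fin T, a i = a' i :=
    ⟨fun n => if h : n < T then a ⟨n, h⟩ else Classical.arbitrary S, fun i => by simp⟩
  simp only [ha']
  rw [hM.mutualInfo_eq hσ a' T]
  refine ENNReal.ofReal_le_ofReal (Finset.sum_le_sum fun n _ => ?_)
  have h0 := postVar_nonneg hM.kernel_eq_inner hσ (fun i : Fin n => a' i) (a' n)
  have h1 := (postVar_le_self hM.kernel_eq_inner hσ (fun i : Fin n => a' i) (a' n)).trans (hk _)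
  gcongr

/-- The posterior variances along any sequence of queries are controlled by the maximum
information gain. -/
lemma sum_postVar_le_maxInfoGain (hM : IsModel P k σ f ε U) (hσ : 0 < σ)
    (hk : ∀ s, k s s ≤ 1) (x : ℕ → S) (T : ℕ) :
    ∑ n ∈ Finset.range T, postVar k σ (fun i : Fin n => x i) (x n) ≤
      2 * ((σ : ℝ) ^ 2 + 1) * (maxInfoGain P f ε T).toReal := by
  have : Nonempty S := ⟨x 0⟩
  have hσ' : (0 : ℝ) < (σ : ℝ) ^ 2 := pow_pos (by exact_mod_cast hσ) 2
  have h1 : ∑ n ∈ Finset.range T,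
      Real.log (1 + postVar k σ (fun i : Fin n => x i) (x n) / (σ : ℝ) ^ 2) / 2 ≤
      (maxInfoGain P f ε T).toReal := by
    refine (ENNReal.ofReal_le_iff_le_toReal (hM.maxInfoGain_ne_top hσ hk T)).1 ?_
    rw [← hM.mutualInfo_eq hσ x T]
    exact le_iSup (fun a : Fin T → S => mutualInfo P (fun ω (i : Fin T) => f (a i) ω + ε i ω)
      (fun ω (i : Fin T) => f (a i) ω)) fun i => x i
  refine le_trans ?_ (mul_le_mul_of_nonneg_left h1 (by positivity))
  rw [Finset.mul_sum]
  refine Finset.sum_le_sum fun n _ => ?_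
  have h0 := postVar_nonneg hM.kernel_eq_inner hσ (fun i : Fin n => x i) (x n)
  have h1 := (postVar_le_self hM.kernel_eq_inner hσ (fun i : Fin n => x i) (x n)).trans (hk _)
  generalize postVar k σ (fun i : Fin n => x i) (x n) = v at h0 h1 ⊢
  generalize (σ : ℝ) ^ 2 = s at hσ' ⊢
  have h2 := Real.one_sub_inv_le_log_of_pos (x := 1 + v / s) (by positivity)
  have h3 : 1 - (1 + v / s)⁻¹ = v / (s + v) := by field_simp; ring
  have h4 : v / (s + 1) ≤ v / (s + v) := by gcongr
  have h5 : v = (s + 1) * (v / (s + 1)) := by field_simp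
  nlinarith

end IsModel

/-! ### Tails of the posterior for every value of the observations -/

lemma gaussianPDF_le (μ : ℝ) (v : ℝ≥0) (x : ℝ) :
    gaussianPDF μ v x ≤ ENNReal.ofReal (√(2 * Real.pi * v))⁻¹ := by
  unfold gaussianPDF gaussianPDFReal
  refine ENNReal.ofReal_le_ofReal (mul_le_of_le_one_right (by positivity) ?_)
  refine Real.exp_le_one_iff.2 ?_
  exact div_nonpos_of_nonpos_of_nonneg (neg_nonpos.2 (sq_nonneg _)) (by positivity)

/-- The density at `y` of independent Gaussian observations with means `z i` and variance `v`. -/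
noncomputable def noiseDensity (v : ℝ≥0) {n : ℕ} (z y : Fin n → ℝ) : ℝ≥0∞ :=
  ∏ i, gaussianPDF (z i) v (y i)

lemma measurable_noiseDensity (v : ℝ≥0) (n : ℕ) :
    Measurable fun q : (Fin n → ℝ) × (Fin n → ℝ) => noiseDensity v q.1 q.2 :=
  measurable_prod_gaussianPDF v

lemma continuous_noiseDensity (v : ℝ≥0) {n : ℕ} (z : Fin n → ℝ) :
    Continuous (noiseDensity v z) := by
  unfold noiseDensity
  have h : ∀ y : Fin n → ℝ, (∏ i, gaussianPDF (z i) v (y i)) =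
      ENNReal.ofReal (∏ i, gaussianPDFReal (z i) v (y i)) := fun y => by
    rw [ENNReal.ofReal_prod_of_nonneg fun i _ => gaussianPDFReal_nonneg _ _ _]
    rfl
  simp only [h, gaussianPDFReal]
  exact ENNReal.continuous_ofReal.comp (by fun_prop)

lemma noiseDensity_le (v : ℝ≥0) {n : ℕ} (z y : Fin n → ℝ) :
    noiseDensity v z y ≤ ENNReal.ofReal (√(2 * Real.pi * v))⁻¹ ^ n := by
  refine (Finset.prod_le_prod' fun i _ => gaussianPDF_le (z i) v (y i)).trans ?_
  simp

namespace IsModel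

variable {S Ω 𝒰 : Type*} [MeasurableSpace Ω] [MeasurableSpace 𝒰] {P : Measure Ω}
  {k : S → S → ℝ} {σ : ℝ≥0} {f : S → Ω → ℝ} {ε : ℕ → Ω → ℝ} {U : Ω → 𝒰}
  [IsProbabilityMeasure P]

/-- A variant of `lintegral_fixed_design` for a finite family of points. -/
lemma lintegral_fixed_design' (hM : IsModel P k σ f ε U) (hσ : 0 < σ) {n : ℕ} (a : Fin n → S)
    (s : S) {G : (S → ℝ) × (Fin n → ℝ) → ℝ≥0∞} (hG : Measurable G) :
    ∫⁻ ω, G (fun s => f s ω, fun i : Fin n => f (a i) ω + ε i ω) ∂P =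
      ∫⁻ ω, (∫⁻ y, G (fun s => f s ω, y) * noiseDensity (σ ^ 2) (fun i => f (a i) ω) y) ∂P := by
  obtain ⟨a', ha'⟩ : ∃ a' : ℕ → S, ∀ i : Fin n, a i = a' i :=
    ⟨fun m => if h : m < n then a ⟨m, h⟩ else s, fun i => by simp⟩
  simp only [ha']
  exact hM.lintegral_fixed_design hσ a' n hG

lemma continuous_postMean (hM : IsModel P k σ f ε U) {n : ℕ} (a : Fin n → S) (s : S) :
    Continuous fun y => postMean k σ a y s := by
  simp only [postMean_eq_sum hM.kernel_eq_inner]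
  fun_prop

/-- The set of pairs of a path and of observations at `a` for which the path deviates at `s` from
its posterior mean by more than `c` posterior standard deviations. -/
def _root_.GPEI.tailSet (k : S → S → ℝ) (σ : ℝ≥0) {n : ℕ} (a : Fin n → S) (s : S) (c : ℝ) :
    Set ((S → ℝ) × (Fin n → ℝ)) :=
  {p | c * postSd k σ a s < |p.1 s - postMean k σ a p.2 s|}

lemma measurableSet_tailSet (hM : IsModel P k σ f ε U) {n : ℕ} (a : Fin n → S) (s : S) (c : ℝ) :
    MeasurableSet (tailSet k σ a s c) := by
  have h1 : Measurable fun p : (S → ℝ) × (Fin n → ℝ) => p.1 s :=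
    (measurable_pi_apply s).comp measurable_fst
  have h2 : Measurable fun p : (S → ℝ) × (Fin n → ℝ) => postMean k σ a p.2 s :=
    (hM.continuous_postMean a s).measurable.comp measurable_snd
  exact measurableSet_lt measurable_const (h1.sub h2).abs

/-- The deviation of `f s` from its posterior mean is Gaussian and independent of the
observations. -/
lemma measure_tailSet_inter_le (hM : IsModel P k σ f ε U) (hσ : 0 < σ) {n : ℕ} (a : Fin n → S)
    (s : S) {c : ℝ} (hc : 0 ≤ c) {B : Set (Fin n → ℝ)} (hB : MeasurableSet B) :
    ∫⁻ ω, (Prod.snd ⁻¹' B ∩ tailSet k σ a s c).indicator 1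
        ((fun s => f s ω), fun i : Fin n => f (a i) ω + ε i ω) ∂P ≤
      ENNReal.ofReal (Real.exp (-c ^ 2 / 2)) *
        ∫⁻ ω, B.indicator 1 (fun i : Fin n => f (a i) ω + ε i ω) ∂P := by
  set Y : Ω → Fin n → ℝ := fun ω i => f (a i) ω + ε i ω with hYdef
  set W : Ω → ℝ := fun ω => f s ω - ∑ i, postWeight k σ a s i * (f (a i) ω + ε i ω) with hW
  have hY : Measurable Y :=
    measurable_pi_lambda _ fun i => (hM.measurable_f _).add (hM.measurable_noise _)
  have hWm : Measurable W := (hM.measurable_f _).sub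
    (Finset.measurable_sum _ fun i _ =>
      ((hM.measurable_f _).add (hM.measurable_noise _)).const_mul _)
  set D : Set ℝ := {w | c * postSd k σ a s < |w|} with hD
  have hDm : MeasurableSet D := measurableSet_lt measurable_const measurable_id.abs
  have hind : IndepFun W Y P := hM.indepFun_residual_obs a s hσ
  have h1 : ∀ ω, (Prod.snd ⁻¹' B ∩ tailSet k σ a s c).indicator (1 : (S → ℝ) × (Fin n → ℝ) → ℝ≥0∞)
      ((fun s => f s ω), Y ω) = (W ⁻¹' D ∩ Y ⁻¹' B).indicator 1 ω := by
    intro ω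
    have hiff : ((fun s => f s ω), Y ω) ∈ Prod.snd ⁻¹' B ∩ tailSet k σ a s c ↔
        ω ∈ W ⁻¹' D ∩ Y ⁻¹' B := by
      simp only [Set.mem_inter_iff, Set.mem_preimage, tailSet, Set.mem_ofPred_eq, hD, hW,
        postMean_eq_sum hM.kernel_eq_inner, hYdef]
      exact and_comm
    by_cases h : ω ∈ W ⁻¹' D ∩ Y ⁻¹' B
    · rw [Set.indicator_of_mem h, Set.indicator_of_mem (hiff.2 h)]
      rfl
    · rw [Set.indicator_of_notMem h, Set.indicator_of_notMem (mt hiff.1 h)]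
  have h2 : ∀ ω, B.indicator (1 : (Fin n → ℝ) → ℝ≥0∞) (Y ω) = (Y ⁻¹' B).indicator 1 ω := fun ω => rfl
  rw [lintegral_congr h1, lintegral_congr h2, lintegral_indicator_one ((hWm hDm).inter (hY hB)), lintegral_indicator_one (hY hB),
    hind.measure_inter_preimage_eq_mul _ _ hDm hB]
  refine mul_le_mul_left ?_ _
  rw [← Measure.map_apply hWm hDm, hM.map_residual a s hσ]
  refine le_trans (le_of_eq ?_) (gaussianReal_abs_gt_le (postVar k σ a s).toNNReal hc)
  rw [hD, postSd, Real.coe_toNNReal _ (postVar_nonneg hM.kernel_eq_inner hσ a s)]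

/-- Conditionally on the observations at fixed points taking the value `y`, the deviation of `f s`
from its posterior mean has Gaussian tails. The inequality holds for almost every `y` by
independence, and extends to every `y` since its left side is lower semicontinuous and its right
side continuous in `y`. -/
theorem lintegral_tail_le (hM : IsModel P k σ f ε U) (hσ : 0 < σ) {n : ℕ} (a : Fin n → S)
    (s : S) {c : ℝ} (hc : 0 ≤ c) (y : Fin n → ℝ) :
    ∫⁻ ω, (tailSet k σ a s c).indicator 1 ((fun s => f s ω), y) *
        noiseDensity (σ ^ 2) (fun i => f (a i) ω) y ∂P ≤
      ENNReal.ofReal (Real.exp (-c ^ 2 / 2)) *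
        ∫⁻ ω, noiseDensity (σ ^ 2) (fun i => f (a i) ω) y ∂P := by
  have hDm := hM.measurableSet_tailSet a s c
  have hfa : Measurable fun ω (i : Fin n) => f (a i) ω :=
    measurable_pi_lambda _ fun i => hM.measurable_f _
  have hL : Measurable fun q : Ω × (Fin n → ℝ) =>
      noiseDensity (σ ^ 2) (fun i => f (a i) q.1) q.2 := by
    have h := (measurable_noiseDensity (σ ^ 2) n).comp
      ((hfa.comp measurable_fst).prodMk (measurable_snd (α := Ω) (β := Fin n → ℝ)))
    exact h
  have h1D : Measurable ((tailSet k σ a s c).indicator (1 : (S → ℝ) × (Fin n → ℝ) → ℝ≥0∞)) :=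
    measurable_one.indicator hDm
  have hI : Measurable fun q : Ω × (Fin n → ℝ) =>
      (tailSet k σ a s c).indicator (1 : (S → ℝ) × (Fin n → ℝ) → ℝ≥0∞) ((fun s => f s q.1), q.2) := by
    have h := h1D.comp ((hM.measurable_path.comp measurable_fst).prodMk
      (measurable_snd (α := Ω) (β := Fin n → ℝ)))
    exact h
  set A : (Fin n → ℝ) → ℝ≥0∞ := fun y =>
    ∫⁻ ω, (tailSet k σ a s c).indicator 1 ((fun s => f s ω), y) *
        noiseDensity (σ ^ 2) (fun i => f (a i) ω) y ∂P with hA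
  set B : (Fin n → ℝ) → ℝ≥0∞ := fun y =>
    ∫⁻ ω, noiseDensity (σ ^ 2) (fun i => f (a i) ω) y ∂P with hB
  have hAm : Measurable A := (hI.mul hL).lintegral_prod_left'
  have hBm : Measurable B := hL.lintegral_prod_left'
  -- For almost every `y`, by integration over `y` in an arbitrary measurable set.
  have hae : ∀ᵐ y, A y ≤ ENNReal.ofReal (Real.exp (-c ^ 2 / 2)) * B y := by
    refine ae_le_of_forall_setLIntegral_le_of_sigmaFinite hAm fun E hE _ => ?_
    rw [← lintegral_indicator hE, ← lintegral_indicator hE]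
    have h1E : Measurable (E.indicator (1 : (Fin n → ℝ) → ℝ≥0∞)) := measurable_one.indicator hE
    have e1 : ∫⁻ y, E.indicator A y = ∫⁻ ω, (Prod.snd ⁻¹' E ∩ tailSet k σ a s c).indicator 1
        ((fun s => f s ω), fun i : Fin n => f (a i) ω + ε i ω) ∂P := by
      rw [hM.lintegral_fixed_design' hσ a s
        (measurable_one.indicator ((measurable_snd hE).inter hDm)), lintegral_lintegral_swap]
      · refine lintegral_congr fun y => ?_
        by_cases hy : y ∈ E
        · rw [Set.indicator_of_mem hy]
          refine lintegral_congr fun ω => ?_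
          by_cases h : ((fun s => f s ω), y) ∈ tailSet k σ a s c
          · have h' : ((fun s => f s ω), y) ∈ Prod.snd ⁻¹' E ∩ tailSet k σ a s c := ⟨hy, h⟩
            rw [Set.indicator_of_mem h, Set.indicator_of_mem h']
          · have h' : ((fun s => f s ω), y) ∉ Prod.snd ⁻¹' E ∩ tailSet k σ a s c := fun h' => h h'.2
            rw [Set.indicator_of_notMem h, Set.indicator_of_notMem h']
        · simp [hy, Set.indicator]
      · have h := (measurable_one (α := ℝ≥0∞)).indicator ((measurable_snd hE).inter hDm)
        have h' := h.comp ((hM.measurable_path.comp measurable_fst).prodMk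
          (measurable_snd (α := Ω) (β := Fin n → ℝ)))
        exact (h'.mul hL).aemeasurable
    have e2 : ∫⁻ y, E.indicator B y =
        ∫⁻ ω, E.indicator 1 (fun i : Fin n => f (a i) ω + ε i ω) ∂P := by
      rw [hM.lintegral_fixed_design' hσ a s (G := fun p => E.indicator 1 p.2)
        (h1E.comp measurable_snd), lintegral_lintegral_swap]
      · refine lintegral_congr fun y => ?_
        by_cases hy : y ∈ E
        · simp [hy, hB]
        · simp [hy]
      · exact ((h1E.comp measurable_snd).mul hL).aemeasurable
    have e3 : ∀ y, E.indicator (fun y => ENNReal.ofReal (Real.exp (-c ^ 2 / 2)) * B y) y =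
        ENNReal.ofReal (Real.exp (-c ^ 2 / 2)) * E.indicator B y := by
      intro y
      by_cases hy : y ∈ E <;> simp [hy]
    simp only [e3]
    rw [lintegral_const_mul _ (hBm.indicator hE), e1, e2]
    exact hM.measure_tailSet_inter_le hσ a s hc hE
  -- For every `y`, by approximation: Fatou's lemma on the left, dominated convergence on the right.
  obtain ⟨u, hu, hlim⟩ := mem_closure_iff_seq_limit.1 (Measure.dense_of_ae hae y)
  have hLu : ∀ j, Measurable fun ω => noiseDensity (σ ^ 2) (fun i => f (a i) ω) (u j) := fun j => by
    have h := hL.comp (measurable_prodMk_right (y := u j))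
    exact h
  have hIu : ∀ j, Measurable fun ω =>
      (tailSet k σ a s c).indicator (1 : (S → ℝ) × (Fin n → ℝ) → ℝ≥0∞) ((fun s => f s ω), u j) :=
    fun j => by
      have h := hI.comp (measurable_prodMk_right (y := u j))
      exact h
  have hBlim : Filter.Tendsto (fun j => B (u j)) Filter.atTop (nhds (B y)) := by
    refine tendsto_lintegral_of_dominated_convergence
      (fun _ => ENNReal.ofReal (√(2 * Real.pi * ((σ ^ 2 : ℝ≥0) : ℝ)))⁻¹ ^ n)
      hLu
      (fun j => Filter.Eventually.of_forall fun ω => noiseDensity_le _ _ _)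
      (by rw [lintegral_const, measure_univ, mul_one]; exact ENNReal.pow_ne_top ENNReal.ofReal_ne_top)
      (Filter.Eventually.of_forall fun ω => ?_)
    exact ((continuous_noiseDensity (σ ^ 2) fun i => f (a i) ω).tendsto y).comp hlim
  have hAlim : A y ≤ Filter.liminf (fun j => A (u j)) Filter.atTop := by
    refine le_trans (lintegral_mono fun ω => ?_)
      (lintegral_liminf_le fun j => (hIu j).mul (hLu j))
    by_cases hy : ((fun s => f s ω), y) ∈ tailSet k σ a s c
    · have hopen : ∀ᶠ j in Filter.atTop, ((fun s => f s ω), u j) ∈ tailSet k σ a s c := by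
        refine hlim.eventually (IsOpen.mem_nhds (s := {y | ((fun s => f s ω), y) ∈
          tailSet k σ a s c}) ?_ hy)
        exact isOpen_lt continuous_const
          (continuous_const.sub (hM.continuous_postMean a s)).abs
      have ht := ((continuous_noiseDensity (σ ^ 2) fun i => f (a i) ω).tendsto y).comp hlim
      refine le_of_eq ?_
      rw [Set.indicator_of_mem hy, Pi.one_apply, one_mul, ← ht.liminf_eq]
      refine Filter.liminf_congr ?_
      filter_upwards [hopen] with j hj
      simp [Set.indicator_of_mem hj]
    · rw [Set.indicator_of_notMem hy, zero_mul]
      exact zero_le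
  calc A y ≤ Filter.liminf (fun j => A (u j)) Filter.atTop := hAlim
    _ ≤ Filter.liminf (fun j => ENNReal.ofReal (Real.exp (-c ^ 2 / 2)) * B (u j)) Filter.atTop :=
        Filter.liminf_le_liminf (Filter.Eventually.of_forall hu)
    _ = _ := (ENNReal.Tendsto.const_mul hBlim (Or.inr ENNReal.ofReal_ne_top)).liminf_eq

end IsModel

/-! ### Joint measurability of the posterior -/

section Measurability

variable {α S : Type*} [MeasurableSpace α] [MeasurableSpace S]

lemma measurable_det {n : ℕ} {M : α → Matrix (Fin n) (Fin n) ℝ}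
    (hM : ∀ i j, Measurable fun x => M x i j) : Measurable fun x => (M x).det := by
  simp only [Matrix.det_apply]
  exact Finset.measurable_sum _ fun τ _ =>
    (Finset.measurable_prod _ fun i _ => hM _ _).const_smul _

lemma measurable_matrix_inv_apply {n : ℕ} {M : α → Matrix (Fin n) (Fin n) ℝ}
    (hM : ∀ i j, Measurable fun x => M x i j) (i j : Fin n) :
    Measurable fun x => (M x)⁻¹ i j := by
  simp only [Matrix.inv_def, Ring.inverse_eq_inv', Matrix.smul_apply, Matrix.adjugate_apply,
    smul_eq_mul]
  refine (measurable_det hM).inv.mul (measurable_det fun i' j' => ?_)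
  simp only [Matrix.updateRow_apply]
  split_ifs
  · exact measurable_const
  · exact hM _ _

variable {k : S → S → ℝ} {σ : ℝ≥0} {n : ℕ} {a : α → Fin n → S} {y : α → Fin n → ℝ} {s : α → S}

lemma measurable_regGram_inv_apply (hk : Measurable fun p : S × S => k p.1 p.2) (ha : Measurable a)
    (i j : Fin n) : Measurable fun x => (regGram k σ (a x))⁻¹ i j := by
  refine measurable_matrix_inv_apply (fun i j => ?_) i j
  simp only [regGram, Matrix.add_apply, Matrix.of_apply]
  exact (hk.comp ((measurable_pi_iff.1 ha i).prodMk (measurable_pi_iff.1 ha j))).add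
    measurable_const

lemma measurable_postMean (hk : Measurable fun p : S × S => k p.1 p.2) (ha : Measurable a)
    (hy : Measurable y) (hs : Measurable s) :
    Measurable fun x => postMean k σ (a x) (y x) (s x) := by
  simp only [postMean, dotProduct, Matrix.mulVec]
  refine Finset.measurable_sum _ fun i _ =>
    (hk.comp (hs.prodMk (measurable_pi_iff.1 ha i))).mul (Finset.measurable_sum _ fun j _ =>
      (measurable_regGram_inv_apply hk ha i j).mul (measurable_pi_iff.1 hy j))

lemma measurable_postSd (hk : Measurable fun p : S × S => k p.1 p.2) (ha : Measurable a)
    (hs : Measurable s) : Measurable fun x => postSd k σ (a x) (s x) := by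
  have h : ∀ i, Measurable fun x => k (s x) (a x i) := fun i =>
    hk.comp (hs.prodMk (measurable_pi_iff.1 ha i))
  simp only [postSd, postVar, dotProduct, Matrix.mulVec]
  refine (Measurable.sub (hk.comp (hs.prodMk hs)) (Finset.measurable_sum _ fun i _ =>
    (h i).mul (Finset.measurable_sum _ fun j _ =>
      (measurable_regGram_inv_apply hk ha i j).mul (h j)))).sqrt

end Measurability

/-! ### The posterior at adaptively chosen points -/

/-- The first `n` queries of a strategy `π`, as a function of the extra randomness and of the
observations. -/
def design {S 𝒰 : Type*} (π : (n : ℕ) → 𝒰 × (Fin n → ℝ) → S) (n : ℕ) (p : 𝒰 × (Fin n → ℝ)) :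
    Fin n → S :=
  fun i => π i (p.1, fun j : Fin i => p.2 (j.castLE i.2.le))

lemma measurable_design {S 𝒰 : Type*} [MeasurableSpace S] [MeasurableSpace 𝒰]
    {π : (n : ℕ) → 𝒰 × (Fin n → ℝ) → S} (hπ : ∀ n, Measurable (π n)) (n : ℕ) :
    Measurable (design π n) := by
  refine measurable_pi_lambda _ fun i => (hπ i).comp ?_
  exact measurable_fst.prodMk (measurable_pi_lambda _ fun j =>
    (measurable_pi_apply (j.castLE i.2.le)).comp measurable_snd)

lemma measurable_eval_continuous {S : Type*} [TopologicalSpace S]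
    [TopologicalSpace.MetrizableSpace S] [SecondCountableTopology S] [MeasurableSpace S]
    [BorelSpace S] : Measurable fun p : S × {φ : S → ℝ // Continuous φ} => p.2.1 p.1 :=
  measurable_uncurry_of_continuous_of_measurable
    (u := fun (s : S) (φ : {φ : S → ℝ // Continuous φ}) => φ.1 s) (fun φ => φ.2)
    fun s => (measurable_pi_apply s).comp measurable_subtype_coe

namespace IsModel

variable {S Ω 𝒰 : Type*} [MeasurableSpace Ω] [MeasurableSpace 𝒰] {P : Measure Ω}
  {k : S → S → ℝ} {σ : ℝ≥0} {f : S → Ω → ℝ} {ε : ℕ → Ω → ℝ} {U : Ω → 𝒰}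
  [IsProbabilityMeasure P]

lemma kernel_eq_integral (hM : IsModel P k σ f ε U) (s t : S) : k s t = ∫ ω, f s ω * f t ω ∂P := by
  rw [← hM.cov_f, covariance_eq_sub (hM.memLp_f s) (hM.memLp_f t), hM.mean_f, hM.mean_f]
  simp

variable [TopologicalSpace S] [TopologicalSpace.MetrizableSpace S] [SecondCountableTopology S]
  [MeasurableSpace S] [BorelSpace S]

/-- The covariance is measurable since it is an integral of a jointly measurable function. -/
lemma measurable_kernel (hM : IsModel P k σ f ε U) (hc : ∀ ω, Continuous fun s => f s ω) :
    Measurable fun p : S × S => k p.1 p.2 := by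
  simp only [hM.kernel_eq_integral]
  have hf : Measurable (Function.uncurry f) :=
    measurable_uncurry_of_continuous_of_measurable hc hM.measurable_f
  have h1 : Measurable fun p : (S × S) × Ω => f p.1.1 p.2 :=
    hf.comp (measurable_fst.fst.prodMk measurable_snd)
  have h2 : Measurable fun p : (S × S) × Ω => f p.1.2 p.2 :=
    hf.comp (measurable_fst.snd.prodMk measurable_snd)
  exact (h1.mul h2).stronglyMeasurable.integral_prod_right.measurable

omit [IsProbabilityMeasure P] in
lemma measurable_adaptive_obs (hM : IsModel P k σ f ε U) (hc : ∀ ω, Continuous fun s => f s ω)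
    {π : (n : ℕ) → 𝒰 × (Fin n → ℝ) → S} (hπ : ∀ n, Measurable (π n)) {y : ℕ → Ω → ℝ}
    (hy : ∀ n ω, y n ω = f (π n (U ω, fun i : Fin n => y i ω)) ω + ε n ω) (n : ℕ) :
    Measurable (y n) := by
  have hf : Measurable (Function.uncurry f) :=
    measurable_uncurry_of_continuous_of_measurable hc hM.measurable_f
  induction n using Nat.strong_induction_on with
  | _ n ih =>
    have : y n = fun ω => f (π n (U ω, fun i : Fin n => y i ω)) ω + ε n ω := funext (hy n)
    rw [this]
    have hq : Measurable fun ω => π n (U ω, fun i : Fin n => y i ω) :=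
      (hπ n).comp (hM.measurable_U.prodMk (measurable_pi_lambda _ fun i : Fin n => ih i i.2))
    exact (hf.comp (hq.prodMk measurable_id)).add (hM.measurable_noise n)

/-- The law of the path, the extra randomness and the observations of an adaptive strategy:
conditionally on the former two, the observations have the same density as at the fixed points
that the strategy would query. -/
lemma lintegral_adaptive (hM : IsModel P k σ f ε U) (hσ : 0 < σ)
    (hc : ∀ ω, Continuous fun s => f s ω) {π : (n : ℕ) → 𝒰 × (Fin n → ℝ) → S}
    (hπ : ∀ n, Measurable (π n)) {y : ℕ → Ω → ℝ}
    (hy : ∀ n ω, y n ω = f (π n (U ω, fun i : Fin n => y i ω)) ω + ε n ω) (n : ℕ)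
    {F : (𝒰 × {φ : S → ℝ // Continuous φ}) × (Fin n → ℝ) → ℝ≥0∞} (hF : Measurable F) :
    ∫⁻ ω, F ((U ω, ⟨fun s => f s ω, hc ω⟩), fun i : Fin n => y i ω) ∂P =
      ∫⁻ u, (∫⁻ z, (∫⁻ ω, F ((u, ⟨fun s => f s ω, hc ω⟩), z) *
        noiseDensity (σ ^ 2) (fun i => f (design π n (u, z) i) ω) z ∂P)) ∂(P.map U) := by
  -- Only on the space of continuous paths is the evaluation jointly measurable in the path and in
  -- the point; its measurable sets pull back to the same events as those of the product space.
  set e : Ω → {φ : S → ℝ // Continuous φ} := fun ω => ⟨fun s => f s ω, hc ω⟩ with he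
  have hem : Measurable e := hM.measurable_path.subtype_mk
  have hεm : Measurable fun ω n => ε n ω := measurable_pi_lambda _ hM.measurable_noise
  have hcomap : MeasurableSpace.comap e inferInstance =
      MeasurableSpace.comap (fun ω s => f s ω) MeasurableSpace.pi := by
    rw [show (inferInstance : MeasurableSpace {φ : S → ℝ // Continuous φ}) =
      MeasurableSpace.comap Subtype.val MeasurableSpace.pi from rfl, MeasurableSpace.comap_comp]
    rfl
  have h1 : IndepFun e (fun ω n => ε n ω) P := by
    have h := hM.indep_f_noise
    rw [IndepFun_iff_Indep] at h ⊢
    rwa [hcomap]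
  have h2 : IndepFun U (fun ω => (e ω, fun n => ε n ω)) P := by
    have h := hM.indep_U
    rw [IndepFun_iff_Indep] at h ⊢
    have e1 : MeasurableSpace.comap (fun ω => (e ω, fun n => ε n ω)) inferInstance = _ :=
      MeasurableSpace.comap_prodMk e fun ω n => ε n ω
    have e2 : MeasurableSpace.comap (fun ω => (fun s => f s ω, fun n => ε n ω)) inferInstance = _ :=
      MeasurableSpace.comap_prodMk (fun ω s => f s ω) fun ω n => ε n ω
    rw [e2, ← hcomap, ← e1] at h
    exact h
  have hV : Measurable fun ω => (U ω, e ω) := hM.measurable_U.prodMk hem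
  have h3 : IndepFun (fun ω => (U ω, e ω)) (fun ω n => ε n ω) P :=
    IndepFun.prodMk_left_of_indepFun hM.measurable_U hem hεm h2 h1
  have hUe : IndepFun U e P := h2.comp (ψ := Prod.fst) measurable_id measurable_fst
  have heval := measurable_eval_continuous (S := S)
  set m : (n : ℕ) → (𝒰 × {φ : S → ℝ // Continuous φ}) × (Fin n → ℝ) → ℝ :=
    fun n p => p.1.2.1 (π n (p.1.1, p.2)) with hm
  have hmm : ∀ n, Measurable (m n) := fun n =>
    heval.comp (((hπ n).comp (measurable_fst.fst.prodMk measurable_snd)).prodMk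
      measurable_fst.snd)
  have hrec : ∀ n ω, y n ω = m n ((U ω, e ω), fun i : Fin n => y i ω) + ε n ω := hy
  have hym := hM.measurable_adaptive_obs hc hπ hy
  have hlik : ∀ u φ z, likelihood m (fun _ => σ ^ 2) n (u, φ) z =
      noiseDensity (σ ^ 2) (fun i => φ.1 (design π n (u, z) i)) z := fun _ _ _ => rfl
  have hFL : Measurable fun p : (𝒰 × {φ : S → ℝ // Continuous φ}) × (Fin n → ℝ) =>
      F p * likelihood m (fun _ => σ ^ 2) n p.1 p.2 :=
    hF.mul (measurable_likelihood hmm _ n)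
  have : IsProbabilityMeasure (P.map U) :=
    Measure.isProbabilityMeasure_map hM.measurable_U.aemeasurable
  have : IsProbabilityMeasure (P.map e) := Measure.isProbabilityMeasure_map hem.aemeasurable
  rw [lintegral_eq_lintegral_likelihood hV hmm (fun _ => (pow_pos hσ 2).ne') hym
    hM.measurable_noise hM.law_noise
    (indepFun_history hV hmm hM.measurable_noise h3 hM.indep_noise hrec) hrec n hF,
    (indepFun_iff_map_prod_eq_prod_map_map hM.measurable_U.aemeasurable hem.aemeasurable).1 hUe,
    lintegral_prod _ hFL.lintegral_prod_right'.aemeasurable]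
  refine lintegral_congr fun u => ?_
  have hFu : Measurable fun p : {φ : S → ℝ // Continuous φ} × (Fin n → ℝ) =>
      F ((u, p.1), p.2) * likelihood m (fun _ => σ ^ 2) n (u, p.1) p.2 := by
    have hmk : Measurable fun p : {φ : S → ℝ // Continuous φ} × (Fin n → ℝ) =>
        ((u, p.1), p.2) := (measurable_const.prodMk measurable_fst).prodMk measurable_snd
    have h := hFL.comp hmk
    exact h
  rw [lintegral_lintegral_swap hFu.aemeasurable]
  refine lintegral_congr fun z => ?_
  have hFz : Measurable fun φ : {φ : S → ℝ // Continuous φ} =>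
      F ((u, φ), z) * likelihood m (fun _ => σ ^ 2) n (u, φ) z := by
    have h := hFu.comp (measurable_prodMk_right (y := z))
    exact h
  rw [lintegral_map hFz hem]
  rfl

/-- For an adaptive strategy the deviation of the process from its posterior mean, at a point
chosen from the extra randomness and the observations, has Gaussian tails. -/
lemma measure_tail_le_of_continuous (hM : IsModel P k σ f ε U) (hσ : 0 < σ)
    (hc : ∀ ω, Continuous fun s => f s ω) {π : (n : ℕ) → 𝒰 × (Fin n → ℝ) → S}
    (hπ : ∀ n, Measurable (π n)) {y : ℕ → Ω → ℝ}
    (hy : ∀ n ω, y n ω = f (π n (U ω, fun i : Fin n => y i ω)) ω + ε n ω) (n : ℕ)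
    {q : 𝒰 × (Fin n → ℝ) → S} (hq : Measurable q) {c : ℝ} (hc0 : 0 ≤ c) :
    P {ω | c * postSd k σ (design π n (U ω, fun i : Fin n => y i ω))
        (q (U ω, fun i : Fin n => y i ω)) <
      |f (q (U ω, fun i : Fin n => y i ω)) ω -
        postMean k σ (design π n (U ω, fun i : Fin n => y i ω)) (fun i : Fin n => y i ω)
          (q (U ω, fun i : Fin n => y i ω))|} ≤ ENNReal.ofReal (Real.exp (-c ^ 2 / 2)) := by
  have hk := hM.measurable_kernel hc
  set D : Set ((𝒰 × {φ : S → ℝ // Continuous φ}) × (Fin n → ℝ)) :=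
    {p | c * postSd k σ (design π n (p.1.1, p.2)) (q (p.1.1, p.2)) <
      |p.1.2.1 (q (p.1.1, p.2)) - postMean k σ (design π n (p.1.1, p.2)) p.2 (q (p.1.1, p.2))|}
    with hD
  have heval := measurable_eval_continuous (S := S)
  have hp : Measurable fun p : (𝒰 × {φ : S → ℝ // Continuous φ}) × (Fin n → ℝ) => (p.1.1, p.2) :=
    measurable_fst.fst.prodMk measurable_snd
  have hqp : Measurable fun p : (𝒰 × {φ : S → ℝ // Continuous φ}) × (Fin n → ℝ) =>
      q (p.1.1, p.2) := hq.comp hp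
  have hdp : Measurable fun p : (𝒰 × {φ : S → ℝ // Continuous φ}) × (Fin n → ℝ) =>
      design π n (p.1.1, p.2) := (measurable_design hπ n).comp hp
  have hDm : MeasurableSet D := by
    refine measurableSet_lt ((measurable_postSd hk hdp hqp).const_mul c)
      (Measurable.abs (Measurable.sub ?_ (measurable_postMean hk hdp measurable_snd hqp)))
    have h := heval.comp (hqp.prodMk measurable_fst.snd)
    exact h
  have h1 := hM.lintegral_adaptive hσ hc hπ hy n
    ((measurable_one (α := ℝ≥0∞)).indicator hDm)
  have h2 := hM.lintegral_adaptive hσ hc hπ hy n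
    (F := fun _ => 1) measurable_const
  simp only [lintegral_const, measure_univ, mul_one, one_mul] at h2
  have h3 : P {ω | c * postSd k σ (design π n (U ω, fun i : Fin n => y i ω))
        (q (U ω, fun i : Fin n => y i ω)) <
      |f (q (U ω, fun i : Fin n => y i ω)) ω -
        postMean k σ (design π n (U ω, fun i : Fin n => y i ω)) (fun i : Fin n => y i ω)
          (q (U ω, fun i : Fin n => y i ω))|} ≤
      ∫⁻ ω, D.indicator 1 ((U ω, ⟨fun s => f s ω, hc ω⟩), fun i : Fin n => y i ω) ∂P := by
    have hem : Measurable fun ω => (⟨fun s => f s ω, hc ω⟩ : {φ : S → ℝ // Continuous φ}) :=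
      hM.measurable_path.subtype_mk
    have hg : Measurable fun ω => ((U ω, (⟨fun s => f s ω, hc ω⟩ : {φ : S → ℝ // Continuous φ})),
        fun i : Fin n => y i ω) := (hM.measurable_U.prodMk hem).prodMk
      (measurable_pi_lambda _ fun i : Fin n => hM.measurable_adaptive_obs hc hπ hy i)
    exact (lintegral_indicator_one (hg hDm)).ge
  rw [h1] at h3
  refine h3.trans ?_
  calc _ ≤ ∫⁻ u, (∫⁻ z, ENNReal.ofReal (Real.exp (-c ^ 2 / 2)) * (∫⁻ ω,
        noiseDensity (σ ^ 2) (fun i => f (design π n (u, z) i) ω) z ∂P)) ∂(P.map U) := by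
        refine lintegral_mono fun u => lintegral_mono fun z => ?_
        exact hM.lintegral_tail_le hσ (design π n (u, z)) (q (u, z)) hc0 z
    _ = ENNReal.ofReal (Real.exp (-c ^ 2 / 2)) := by
        simp only [lintegral_const_mul' _ _ ENNReal.ofReal_ne_top]
        rw [← h2, mul_one]

end IsModel

/-- The sequence determined by the recursion `y n = m n (y 0, …, y (n - 1))`. -/
noncomputable def recSeq (m : (n : ℕ) → (Fin n → ℝ) → ℝ) (n : ℕ) : ℝ :=
  m n fun i : Fin n => recSeq m i
  termination_by n
  decreasing_by exact i.2

lemma recSeq_eq (m : (n : ℕ) → (Fin n → ℝ) → ℝ) (n : ℕ) :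
    recSeq m n = m n fun i : Fin n => recSeq m i := by
  rw [recSeq]

lemma eq_recSeq {m : (n : ℕ) → (Fin n → ℝ) → ℝ} {y : ℕ → ℝ}
    (hy : ∀ n, y n = m n fun i : Fin n => y i) (n : ℕ) : y n = recSeq m n := by
  induction n using Nat.strong_induction_on with
  | _ n ih =>
    rw [hy, recSeq_eq]
    congr 1
    funext i
    exact ih i i.2

namespace IsModel

variable {S Ω 𝒰 : Type*} [MeasurableSpace Ω] [MeasurableSpace 𝒰] {P : Measure Ω}
  {k : S → S → ℝ} {σ : ℝ≥0} {f : S → Ω → ℝ} {ε : ℕ → Ω → ℝ} {U : Ω → 𝒰}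

/-- A process all of whose paths are modified on a common null set satisfies the same model. -/
lemma congr (hM : IsModel P k σ f ε U) {g : S → Ω → ℝ} (hg : ∀ s, Measurable (g s))
    (hfg : ∀ᵐ ω ∂P, ∀ s, f s ω = g s ω) : IsModel P k σ g ε U where
  measurable_f := hg
  gaussian_f := hM.gaussian_f.congr fun s => hfg.mono fun ω h => h s
  mean_f s := by
    rw [← hM.mean_f s]
    exact integral_congr_ae (hfg.mono fun ω h => (h s).symm)
  cov_f s s' := by
    have h1 : ∀ s, f s =ᵐ[P] g s := fun s => hfg.mono fun ω h => h s
    rw [← hM.cov_f s s', covariance, covariance, integral_congr_ae (h1 s),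
      integral_congr_ae (h1 s')]
    refine integral_congr_ae ?_
    filter_upwards [hfg] with ω h
    rw [h, h]
  measurable_noise := hM.measurable_noise
  law_noise := hM.law_noise
  indep_noise := hM.indep_noise
  indep_f_noise := hM.indep_f_noise.congr (hfg.mono fun ω h => funext h) (ae_eq_refl _)
  measurable_U := hM.measurable_U
  indep_U := hM.indep_U.congr (ae_eq_refl _) (hfg.mono fun ω h => by
    simp only [Prod.mk.injEq, and_true]
    exact funext h)

variable [IsProbabilityMeasure P] [TopologicalSpace S] [TopologicalSpace.MetrizableSpace S]
  [SecondCountableTopology S] [MeasurableSpace S] [BorelSpace S]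

/-- For an adaptive strategy the deviation of the process from its posterior mean, at a point
chosen from the extra randomness and the observations, has Gaussian tails. -/
theorem measure_tail_le (hM : IsModel P k σ f ε U) (hσ : 0 < σ)
    (hc : ∀ᵐ ω ∂P, Continuous fun s => f s ω) {x : ℕ → Ω → S}
    {π : (n : ℕ) → 𝒰 × (Fin n → ℝ) → S} (hπ : ∀ n, Measurable (π n))
    (hx : ∀ n ω, x n ω = π n (U ω, fun i : Fin n => obs f ε x i ω)) (n : ℕ)
    {q : 𝒰 × (Fin n → ℝ) → S} (hq : Measurable q) {c : ℝ} (hc0 : 0 ≤ c) :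
    P {ω | c * postSd k σ (fun i : Fin n => x i ω) (q (U ω, fun i : Fin n => obs f ε x i ω)) <
      |f (q (U ω, fun i : Fin n => obs f ε x i ω)) ω -
        postMean k σ (fun i : Fin n => x i ω) (fun i : Fin n => obs f ε x i ω)
          (q (U ω, fun i : Fin n => obs f ε x i ω))|} ≤ ENNReal.ofReal (Real.exp (-c ^ 2 / 2)) := by
  -- The process is set to zero on a null set off which its paths are continuous, and the
  -- observations that the strategy would make of the modified process are constructed recursively.
  obtain ⟨N, hN, hNm, hN0⟩ := exists_measurable_superset_of_null (ae_iff.1 hc)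
  set g : S → Ω → ℝ := fun s => Nᶜ.indicator (f s) with hg
  have hfg : ∀ ω ∈ Nᶜ, ∀ s, f s ω = g s ω := fun ω hω s => (Set.indicator_of_mem hω _).symm
  have hNae : ∀ᵐ ω ∂P, ω ∈ Nᶜ := compl_mem_ae_iff.2 hN0
  have hMg : IsModel P k σ g ε U :=
    hM.congr (fun s => (hM.measurable_f s).indicator hNm.compl)
      (hNae.mono fun ω hω s => hfg ω hω s)
  have hgc : ∀ ω, Continuous fun s => g s ω := by
    intro ω
    by_cases hω : ω ∈ N
    · have : (fun s => g s ω) = fun _ => 0 := by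
        funext s
        exact Set.indicator_of_notMem (fun h : ω ∈ Nᶜ => h hω) _
      rw [this]
      exact continuous_const
    · have h1 : Continuous fun s => f s ω := by
        by_contra h
        exact hω (hN h)
      rwa [show (fun s => g s ω) = fun s => f s ω from funext fun s => (hfg ω hω s).symm]
  set y : ℕ → Ω → ℝ := fun n ω => recSeq (fun n z => g (π n (U ω, z)) ω + ε n ω) n with hydef
  have hy : ∀ n ω, y n ω = g (π n (U ω, fun i : Fin n => y i ω)) ω + ε n ω :=
    fun n ω => recSeq_eq _ n
  have hobs : ∀ ω ∈ Nᶜ, ∀ n, obs f ε x n ω = y n ω := by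
    intro ω hω n
    refine eq_recSeq (y := fun n => obs f ε x n ω)
      (m := fun n z => g (π n (U ω, z)) ω + ε n ω) (fun n => ?_) n
    rw [← hfg ω hω, ← hx n ω]
    rfl
  refine le_trans (measure_mono_ae ?_)
    (hMg.measure_tail_le_of_continuous hσ hgc hπ hy n hq hc0)
  filter_upwards [hNae] with ω hω h
  have e1 : ∀ n : ℕ, (fun i : Fin n => obs f ε x i ω) = fun i : Fin n => y i ω :=
    fun n => funext fun i => hobs ω hω i
  have e2 : (fun i : Fin n => x i ω) = design π n (U ω, fun i : Fin n => y i ω) := by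
    funext i
    rw [hx i ω, e1]
    rfl
  have h' : c * postSd k σ (fun i : Fin n => x i ω) (q (U ω, fun i : Fin n => obs f ε x i ω)) <
      |f (q (U ω, fun i : Fin n => obs f ε x i ω)) ω -
        postMean k σ (fun i : Fin n => x i ω) (fun i : Fin n => obs f ε x i ω)
          (q (U ω, fun i : Fin n => obs f ε x i ω))| := h
  rw [e1, e2, hfg ω hω] at h'
  exact h'

end IsModel

/-! ### The regret bound in terms of the information gain -/

/-- The posterior at `s` before round `n` fails to confine the objective to `c` posterior standard
deviations around its mean. -/
def Deviates {S Ω : Type*} (k : S → S → ℝ) (σ : ℝ≥0) (f : S → Ω → ℝ) (ε : ℕ → Ω → ℝ)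
    (x : ℕ → Ω → S) (n : ℕ) (c : ℝ) (s : S) (ω : Ω) : Prop :=
  c * postSd k σ (fun i : Fin n => x i ω) s <
    |f s ω - postMean k σ (fun i : Fin n => x i ω) (fun i : Fin n => obs f ε x i ω) s|

/-- The constant of the regret bound: the constant of `ConfidentRun.sum_regret_le`, for
`η = κ min(1, σ²) / 2`, times the one of the bound on the sum of the posterior standard deviations. -/
noncomputable def regretConst (σ : ℝ≥0) (κ : ℝ) : ℝ :=
  (12 + 12 * (cdf (gaussianReal 0 1) (-1))⁻¹ +
      √(1 + Real.log (1 / (κ * min 1 ((σ : ℝ) ^ 2) / 2)) / Real.log 2)) *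
    ((1 + 1 / √κ) * √(2 * ((σ : ℝ) ^ 2 + 1)))

lemma regretConst_pos (σ : ℝ≥0) {κ : ℝ} (hκ : 0 < κ) : 0 < regretConst σ κ := by
  have := cdf_neg_one_pos
  have := Real.sqrt_pos.2 hκ
  have : 0 < √(2 * ((σ : ℝ) ^ 2 + 1)) := Real.sqrt_pos.2 (by positivity)
  unfold regretConst
  positivity

namespace IsModel

variable {S Ω 𝒰 : Type*} [MeasurableSpace Ω] [MeasurableSpace 𝒰] {P : Measure Ω}
  {k : S → S → ℝ} {σ : ℝ≥0} {f : S → Ω → ℝ} {ε : ℕ → Ω → ℝ} {U : Ω → 𝒰}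
  [IsProbabilityMeasure P]

/-- The sum of the posterior standard deviations at the queries, by Cauchy-Schwarz and the
information gain. -/
lemma one_add_sum_postSd_le (hM : IsModel P k σ f ε U) (hσ : 0 < σ) {κ : ℝ} (hκ : 0 < κ)
    (hk : ∀ s, κ ≤ k s s ∧ k s s ≤ 1) (x : ℕ → S) {T : ℕ} (hT : 1 ≤ T) :
    1 + ∑ n ∈ Finset.range T, postSd k σ (fun i : Fin n => x i) (x n) ≤
      (1 + 1 / √κ) * √(2 * ((σ : ℝ) ^ 2 + 1)) * √((maxInfoGain P f ε T).toReal * T) := by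
  set γ := (maxInfoGain P f ε T).toReal
  set V := ∑ n ∈ Finset.range T, postVar k σ (fun i : Fin n => x i) (x n) with hV
  have hVγ : V ≤ 2 * ((σ : ℝ) ^ 2 + 1) * γ :=
    hM.sum_postVar_le_maxInfoGain hσ (fun s => (hk s).2) x T
  have h0 : ∀ n : ℕ, 0 ≤ postVar k σ (fun i : Fin n => x i) (x n) := fun n =>
    postVar_nonneg hM.kernel_eq_inner hσ _ _
  have hκV : κ ≤ V := by
    refine le_trans ?_ (Finset.single_le_sum (fun n _ => h0 n) (Finset.mem_range.2 hT))
    rw [postVar_zero]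
    exact (hk _).1
  have hT' : (1 : ℝ) ≤ T := by exact_mod_cast hT
  have hsum : ∑ n ∈ Finset.range T, postSd k σ (fun i : Fin n => x i) (x n) ≤ √(T * V) := by
    refine Real.le_sqrt_of_sq_le (sq_sum_le_card_mul_sum_sq.trans (le_of_eq ?_))
    rw [Finset.card_range, hV]
    congr 1
    exact Finset.sum_congr rfl fun n _ => Real.sq_sqrt (h0 n)
  have hone : 1 ≤ 1 / √κ * √(T * V) := by
    rw [one_div, ← div_eq_inv_mul, one_le_div (Real.sqrt_pos.2 hκ)]
    exact Real.sqrt_le_sqrt (by nlinarith)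
  have hTV : √(T * V) ≤ √(2 * ((σ : ℝ) ^ 2 + 1)) * √(γ * T) := by
    rw [← Real.sqrt_mul (by positivity)]
    exact Real.sqrt_le_sqrt (by nlinarith)
  calc 1 + ∑ n ∈ Finset.range T, postSd k σ (fun i : Fin n => x i) (x n)
      ≤ (1 + 1 / √κ) * √(T * V) := by linarith
    _ ≤ (1 + 1 / √κ) * (√(2 * ((σ : ℝ) ^ 2 + 1)) * √(γ * T)) := by gcongr
    _ = _ := by ring

/-- The regret bound holds along every path on which the queries maximize the expected improvement
and the confidence bounds are valid at the queries and near the maximum of the objective. -/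
theorem regret_le (hM : IsModel P k σ f ε U) (hσ : 0 < σ) {κ : ℝ} (hκ : 0 < κ)
    (hk : ∀ s, κ ≤ k s s ∧ k s s ≤ 1) {β : ℕ → ℝ} (hβ1 : ∀ n, 1 ≤ β (n + 1))
    (hβm : ∀ n, β (n + 1) ≤ β (n + 2)) {x : ℕ → Ω → S} {ω : Ω}
    (hopt : ∀ n : ℕ, ∀ s,
      EI (postMean k σ (fun i : Fin n => x i ω) (fun i : Fin n => obs f ε x i ω) s)
        (√(β (n + 1)) * postSd k σ (fun i : Fin n => x i ω) s)
        (refValue k σ (fun i : Fin n => x i ω) (fun i : Fin n => obs f ε x i ω)) ≤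
      EI (postMean k σ (fun i : Fin n => x i ω) (fun i : Fin n => obs f ε x i ω) (x n ω))
        (√(β (n + 1)) * postSd k σ (fun i : Fin n => x i ω) (x n ω))
        (refValue k σ (fun i : Fin n => x i ω) (fun i : Fin n => obs f ε x i ω)))
    (hquery : ∀ n, ∀ i ≤ n, ¬ Deviates k σ f ε x n (√(β (n + 1))) (x i ω) ω)
    (hnear : ∀ (n : ℕ) t, ∃ t', f t ω ≤ f t' ω + 1 / ((n : ℝ) + 1) ^ 2 ∧
      ¬ Deviates k σ f ε x n (√(β (n + 1))) t' ω) {T : ℕ} (hT : 2 ≤ T) :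
    regret f x T ω ≤ regretConst σ κ *
      √(β T * (maxInfoGain P f ε T).toReal * T * Real.log T) := by
  have hK := hM.kernel_eq_inner
  have hm0 : 0 < min 1 ((σ : ℝ) ^ 2) := lt_min one_pos (pow_pos (NNReal.coe_pos.2 hσ) 2)
  have hrun : ConfidentRun (fun s => f s ω) (fun n => x n ω)
      (fun n s => postMean k σ (fun i : Fin n => x i ω) (fun i : Fin n => obs f ε x i ω) s)
      (fun n s => postSd k σ (fun i : Fin n => x i ω) s)
      (fun n => refValue k σ (fun i : Fin n => x i ω) (fun i : Fin n => obs f ε x i ω))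
      (fun n => √(β (n + 1))) (κ * min 1 ((σ : ℝ) ^ 2) / 2) :=
    { η_pos := by positivity
      η_le := by
        have h1 : κ ≤ 1 := (hk (x 0 ω)).1.trans (hk (x 0 ω)).2
        have h2 : min 1 ((σ : ℝ) ^ 2) ≤ 1 := min_le_left _ _
        nlinarith
      sd_nonneg := fun n t => Real.sqrt_nonneg _
      sd_le_one := fun n t => Real.sqrt_le_one.2
        ((postVar_le_self hK hσ _ t).trans (hk t).2)
      sd_anti := fun t => antitone_postSd hK hσ (fun i => x i ω) t
      le_sd_sq := fun n t hn => by
        have h := le_postVar hK hσ hk hn (fun i : Fin n => x i ω) t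
        rw [postSd, Real.sq_sqrt (postVar_nonneg hK hσ _ _), div_div]
        exact h
      mean_zero := fun t => postMean_zero _ _ _
      ref_zero := by simp [refValue]
      ref_attained := fun n hn => by
        have : Nonempty (Fin n) := ⟨⟨0, hn⟩⟩
        obtain ⟨i, hi⟩ := exists_eq_ciSup_of_finite (f := fun i : Fin n =>
          postMean k σ (fun i : Fin n => x i ω) (fun i : Fin n => obs f ε x i ω) (x i ω))
        exact ⟨i, i.2, by rw [refValue, if_neg (by omega), ← hi]⟩
      le_ref := fun n i hi => by
        rw [refValue, if_neg (by omega)]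
        exact le_ciSup (f := fun i : Fin n =>
          postMean k σ (fun i : Fin n => x i ω) (fun i : Fin n => obs f ε x i ω) (x i ω))
          (Set.finite_range _).bddAbove ⟨i, hi⟩
      one_le_scale := fun n => Real.one_le_sqrt.2 (hβ1 n)
      scale_mono := monotone_nat_of_le_succ fun n => Real.sqrt_le_sqrt (hβm n)
      optimal := hopt
      conf_query := fun n i hi => not_lt.1 (hquery n i hi)
      conf_near := fun n t => (hnear n t).imp fun t' h => ⟨h.1, not_lt.1 h.2⟩ }
  have hT1 : T - 1 + 1 = T := by omega
  have hβ0 : 0 ≤ β T := by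
    have := hβ1 (T - 1)
    rw [hT1] at this
    linarith
  have hlog : 0 ≤ Real.log T := Real.log_nonneg (by exact_mod_cast by omega)
  set γ := (maxInfoGain P f ε T).toReal with hγ
  have hγ0 : 0 ≤ γ := ENNReal.toReal_nonneg
  have h1 := hrun.sum_regret_le hT
  have h2 := hM.one_add_sum_postSd_le hσ hκ hk (fun n => x n ω) (show 1 ≤ T by omega)
  rw [hT1] at h1
  have e : √(β T * γ * T * Real.log T) = √(β T) * √(Real.log T) * √(γ * T) := by
    rw [← Real.sqrt_mul hβ0, ← Real.sqrt_mul (by positivity)]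
    congr 1
    ring
  have hc : 0 ≤ 12 + 12 * (cdf (gaussianReal 0 1) (-1))⁻¹ +
      √(1 + Real.log (1 / (κ * min 1 ((σ : ℝ) ^ 2) / 2)) / Real.log 2) := by
    have := cdf_neg_one_pos
    positivity
  rw [regret, e]
  refine h1.trans ((mul_le_mul_of_nonneg_left h2 (by positivity)).trans (le_of_eq ?_))
  rw [regretConst]
  ring

end IsModel

/-! ### The confidence parameters -/

lemma tsum_ofReal_inv_sq {p : ℝ} (hp : 0 ≤ p) :
    ∑' n : ℕ, ENNReal.ofReal (6 * p / (Real.pi ^ 2 * ((n : ℝ) + 1) ^ 2)) = ENNReal.ofReal p := by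
  have h1 : HasSum (fun n : ℕ => 1 / ((n : ℝ) + 1) ^ 2) (Real.pi ^ 2 / 6) := by
    have h := (hasSum_nat_add_iff' 1).2 hasSum_zeta_two
    simpa using h
  have hπ := Real.pi_pos
  have h2 : HasSum (fun n : ℕ => 6 * p / (Real.pi ^ 2 * ((n : ℝ) + 1) ^ 2)) p := by
    have h := h1.mul_left (6 * p / Real.pi ^ 2)
    have e : 6 * p / Real.pi ^ 2 * (Real.pi ^ 2 / 6) = p := by field_simp
    rw [e] at h
    refine h.congr_fun ?_
    intro n
    field_simp
  rw [← ENNReal.ofReal_tsum_of_nonneg (fun n => by positivity) h2.summable, h2.tsum_eq]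

lemma one_le_log_of_three_le {z : ℝ} (hz : 3 ≤ z) : 1 ≤ Real.log z := by
  rw [Real.le_log_iff_exp_le (by linarith)]
  linarith [Real.exp_one_lt_d9]

lemma nine_le_pi_sq : 9 ≤ Real.pi ^ 2 := by nlinarith [Real.pi_gt_three]

section Finite

variable {N : ℕ} {δ : ℝ}

/-- With a single point `β` can be slightly smaller than `1`, whence the assumption on `N`. -/
lemma one_le_betaFinite (hN : 2 ≤ N) (hδ : 0 < δ) (hδ1 : δ < 1) (n : ℕ) :
    1 ≤ betaFinite N δ (n + 1) := by
  have hN' : (2 : ℝ) ≤ N := by exact_mod_cast hN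
  have ht : (1 : ℝ) ≤ ((n + 1 : ℕ) : ℝ) ^ 2 :=
    one_le_pow₀ (by push_cast; linarith [n.cast_nonneg (α := ℝ)])
  have h := one_le_log_of_three_le (z := N * ((n + 1 : ℕ) : ℝ) ^ 2 * Real.pi ^ 2 / (6 * δ)) (by
    rw [le_div_iff₀ (by positivity)]
    have h1 : 2 * 1 ≤ (N : ℝ) * ((n + 1 : ℕ) : ℝ) ^ 2 := by gcongr
    have h2 : 2 * 1 * 9 ≤ (N : ℝ) * ((n + 1 : ℕ) : ℝ) ^ 2 * Real.pi ^ 2 :=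
      mul_le_mul h1 nine_le_pi_sq (by norm_num) (by positivity)
    linarith)
  unfold betaFinite
  linarith

lemma betaFinite_mono (hN : 2 ≤ N) (hδ : 0 < δ) (n : ℕ) :
    betaFinite N δ (n + 1) ≤ betaFinite N δ (n + 2) := by
  have hN' : (0 : ℝ) < N := by exact_mod_cast (by omega)
  have hπ := Real.pi_pos
  unfold betaFinite
  gcongr
  omega

lemma exp_neg_betaFinite (hN : 2 ≤ N) (hδ : 0 < δ) (n : ℕ) :
    N * Real.exp (-betaFinite N δ (n + 1) / 2) = 6 * δ / (Real.pi ^ 2 * ((n : ℝ) + 1) ^ 2) := by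
  have hN' : (0 : ℝ) < N := by exact_mod_cast (by omega)
  have hπ := Real.pi_pos
  have e : -betaFinite N δ (n + 1) / 2 =
      -Real.log (N * ((n + 1 : ℕ) : ℝ) ^ 2 * Real.pi ^ 2 / (6 * δ)) := by
    unfold betaFinite
    ring
  rw [e, Real.exp_neg, Real.exp_log (by positivity)]
  push_cast
  field_simp

end Finite

section Continuous

variable {d : ℕ} {r a b δ : ℝ}

/-- The number of cells per coordinate of the grid used in round `t`. -/
noncomputable def meshCount (d : ℕ) (r a b δ : ℝ) (t : ℕ) : ℕ :=
  ⌈b * d * r * t ^ 2 * √(Real.log (4 * a * d / δ))⌉₊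

lemma meshCount_mono (hb : 0 ≤ b) (hr : 0 ≤ r) (n : ℕ) :
    meshCount d r a b δ (n + 1) ≤ meshCount d r a b δ (n + 2) := by
  unfold meshCount
  gcongr
  omega

lemma betaCont_eq (d : ℕ) (r a b δ : ℝ) (t : ℕ) : betaCont d r a b δ t =
    2 * Real.log (Real.pi ^ 2 * t ^ 2 / (3 * δ)) +
      2 * d * Real.log (meshCount d r a b δ t + t) := rfl

lemma one_le_betaCont (hδ : 0 < δ) (hδ1 : δ < 1) (n : ℕ) : 1 ≤ betaCont d r a b δ (n + 1) := by
  have ht : (1 : ℝ) ≤ ((n + 1 : ℕ) : ℝ) := by push_cast; linarith [n.cast_nonneg (α := ℝ)]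
  have h := one_le_log_of_three_le (z := Real.pi ^ 2 * ((n + 1 : ℕ) : ℝ) ^ 2 / (3 * δ)) (by
    rw [le_div_iff₀ (by positivity)]
    have h2 : 9 * 1 ≤ Real.pi ^ 2 * ((n + 1 : ℕ) : ℝ) ^ 2 :=
      mul_le_mul nine_le_pi_sq (one_le_pow₀ ht) (by norm_num) (by positivity)
    linarith)
  have h2 : 0 ≤ Real.log (meshCount d r a b δ (n + 1) + ((n + 1 : ℕ) : ℝ)) :=
    Real.log_nonneg (by linarith [(meshCount d r a b δ (n + 1)).cast_nonneg (α := ℝ)])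
  have h3 : 0 ≤ 2 * (d : ℝ) * Real.log (meshCount d r a b δ (n + 1) + ((n + 1 : ℕ) : ℝ)) := by
    positivity
  rw [betaCont_eq]
  linarith

lemma betaCont_mono (hb : 0 ≤ b) (hr : 0 ≤ r) (hδ : 0 < δ) (n : ℕ) :
    betaCont d r a b δ (n + 1) ≤ betaCont d r a b δ (n + 2) := by
  have hπ := Real.pi_pos
  have hm := meshCount_mono (d := d) (a := a) (δ := δ) hb hr n
  rw [betaCont_eq, betaCont_eq]
  gcongr <;> omega

/-- The failure probability of one confidence bound in round `n`, times the number of bounds: one for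
each of `m ^ d` grid points and one for each of the `n + 1` queries up to that round. -/
lemma exp_neg_betaCont_le (hd : 1 ≤ d) (hδ : 0 < δ) (n : ℕ) :
    ((meshCount d r a b δ (n + 1) : ℝ) ^ d + ((n : ℝ) + 1)) *
      Real.exp (-betaCont d r a b δ (n + 1) / 2) ≤
      6 * (δ / 2) / (Real.pi ^ 2 * ((n : ℝ) + 1) ^ 2) := by
  have hπ := Real.pi_pos
  set m : ℝ := (meshCount d r a b δ (n + 1) : ℝ) with hm
  have hm0 : 0 ≤ m := Nat.cast_nonneg _
  have ht : (1 : ℝ) ≤ (n : ℝ) + 1 := by linarith [n.cast_nonneg (α := ℝ)]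
  have e : -betaCont d r a b δ (n + 1) / 2 =
      -(Real.log (Real.pi ^ 2 * ((n : ℝ) + 1) ^ 2 / (3 * δ)) + d * Real.log (m + (n + 1))) := by
    rw [betaCont_eq]
    push_cast
    ring
  have h1 : m ^ d + ((n : ℝ) + 1) ≤ (m + (n + 1)) ^ d := by
    refine le_trans ?_ (pow_add_pow_le hm0 (by linarith) (by omega))
    gcongr
    exact le_self_pow₀ ht (by omega)
  rw [e, Real.exp_neg, Real.exp_add, Real.exp_nat_mul, Real.exp_log (by positivity),
    Real.exp_log (by linarith), mul_inv, inv_div]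
  have h2 : 0 < (m + ((n : ℝ) + 1)) ^ d := by positivity
  calc (m ^ d + ((n : ℝ) + 1)) *
        (3 * δ / (Real.pi ^ 2 * ((n : ℝ) + 1) ^ 2) * ((m + ((n : ℝ) + 1)) ^ d)⁻¹)
      ≤ (m + ((n : ℝ) + 1)) ^ d *
        (3 * δ / (Real.pi ^ 2 * ((n : ℝ) + 1) ^ 2) * ((m + ((n : ℝ) + 1)) ^ d)⁻¹) := by
        gcongr
    _ = 6 * (δ / 2) / (Real.pi ^ 2 * ((n : ℝ) + 1) ^ 2) := by
        field_simp
        ring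

end Continuous

/-! ### Union bounds -/

section Union

variable {S Ω 𝒰 : Type*} [MeasurableSpace Ω] [MeasurableSpace 𝒰] {P : Measure Ω}
  {k : S → S → ℝ} {σ : ℝ≥0} {f : S → Ω → ℝ} {ε : ℕ → Ω → ℝ} {U : Ω → 𝒰}
  [IsProbabilityMeasure P]

lemma ofReal_one_sub_le_measure {A B : Set Ω} {δ : ℝ} (hδ : 0 ≤ δ) (hB : P B ≤ ENNReal.ofReal δ)
    (hAB : ∀ᵐ ω ∂P, ω ∉ B → ω ∈ A) : ENNReal.ofReal (1 - δ) ≤ P A := by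
  rw [ENNReal.ofReal_sub _ hδ, ENNReal.ofReal_one, tsub_le_iff_right]
  calc 1 = P Set.univ := measure_univ.symm
    _ ≤ P (A ∪ B) := measure_mono_ae (hAB.mono fun ω h _ => by
        by_cases hω : ω ∈ B
        · exact Or.inr hω
        · exact Or.inl (h hω))
    _ ≤ P A + P B := measure_union_le _ _
    _ ≤ P A + ENNReal.ofReal δ := by gcongr

namespace IsModel

/-- The high-probability regret bound, given an exceptional event outside of which the confidence
bounds hold. -/
theorem ofReal_one_sub_le_measure_regret_le (hM : IsModel P k σ f ε U) (hσ : 0 < σ) {κ : ℝ}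
    (hκ : 0 < κ) (hk : ∀ s, κ ≤ k s s ∧ k s s ≤ 1) {β : ℕ → ℝ} (hβ1 : ∀ n, 1 ≤ β (n + 1))
    (hβm : ∀ n, β (n + 1) ≤ β (n + 2)) {x : ℕ → Ω → S} (hEI : IsScaledEI P k σ β f ε x)
    {δ : ℝ} (hδ : 0 ≤ δ) {B : Set Ω} (hB : P B ≤ ENNReal.ofReal δ)
    (hgood : ∀ᵐ ω ∂P, ω ∉ B →
      (∀ n, ∀ i ≤ n, ¬ Deviates k σ f ε x n (√(β (n + 1))) (x i ω) ω) ∧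
      ∀ (n : ℕ) t, ∃ t', f t ω ≤ f t' ω + 1 / ((n : ℝ) + 1) ^ 2 ∧
        ¬ Deviates k σ f ε x n (√(β (n + 1))) t' ω) :
    ENNReal.ofReal (1 - δ) ≤ P {ω | ∀ T : ℕ, 2 ≤ T → regret f x T ω ≤ regretConst σ κ *
      √(β T * (maxInfoGain P f ε T).toReal * T * Real.log T)} := by
  refine ofReal_one_sub_le_measure hδ hB ?_
  filter_upwards [hEI, hgood] with ω hopt h hω T hT
  exact hM.regret_le hσ hκ hk hβ1 hβm hopt (h hω).1 (h hω).2 hT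

variable [TopologicalSpace S] [TopologicalSpace.MetrizableSpace S]
  [SecondCountableTopology S] [MeasurableSpace S] [BorelSpace S]

lemma measure_deviates_le (hM : IsModel P k σ f ε U) (hσ : 0 < σ)
    (hc : ∀ᵐ ω ∂P, Continuous fun s => f s ω) {x : ℕ → Ω → S} (hx : IsAdaptive f ε U x) (n : ℕ)
    {β : ℝ} (hβ : 0 ≤ β) (s : S) :
    P {ω | Deviates k σ f ε x n (√β) s ω} ≤ ENNReal.ofReal (Real.exp (-β / 2)) := by
  obtain ⟨π, hπ, hx⟩ := hx
  have h := hM.measure_tail_le hσ hc hπ hx n (q := fun _ => s) measurable_const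
    (Real.sqrt_nonneg β)
  rwa [Real.sq_sqrt hβ] at h

/-- The point is a query made up to round `n`; for `i = n` it is determined, like the earlier ones,
by the observations before round `n`. -/
lemma measure_deviates_query_le (hM : IsModel P k σ f ε U) (hσ : 0 < σ)
    (hc : ∀ᵐ ω ∂P, Continuous fun s => f s ω) {x : ℕ → Ω → S} (hx : IsAdaptive f ε U x) {n i : ℕ}
    (hi : i ≤ n) {β : ℝ} (hβ : 0 ≤ β) :
    P {ω | Deviates k σ f ε x n (√β) (x i ω) ω} ≤ ENNReal.ofReal (Real.exp (-β / 2)) := by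
  obtain ⟨π, hπ, hx⟩ := hx
  have hq : Measurable fun p : 𝒰 × (Fin n → ℝ) =>
      π i (p.1, fun j : Fin i => p.2 (j.castLE hi)) :=
    (hπ i).comp (measurable_fst.prodMk (measurable_pi_lambda _ fun j =>
      (measurable_pi_apply (j.castLE hi)).comp measurable_snd))
  have h := hM.measure_tail_le hσ hc hπ hx n hq (Real.sqrt_nonneg β)
  rw [Real.sq_sqrt hβ] at h
  refine le_trans (measure_mono fun ω hω => ?_) h
  have e : π i (U ω, fun j : Fin i => obs f ε x (j.castLE hi) ω) = x i ω := (hx i ω).symm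
  simp only [Set.mem_ofPred_eq, e]
  exact hω

end IsModel

end Union

/-! ### Finite domains -/

section Finite

variable {S Ω 𝒰 : Type*} [MeasurableSpace Ω] [MeasurableSpace 𝒰] {P : Measure Ω}
  {k : S → S → ℝ} {σ : ℝ≥0} {f : S → Ω → ℝ} {ε : ℕ → Ω → ℝ} {U : Ω → 𝒰}
  [IsProbabilityMeasure P]
  [TopologicalSpace S] [TopologicalSpace.MetrizableSpace S]
  [SecondCountableTopology S] [MeasurableSpace S] [BorelSpace S]

/-- The regret bound on a finite domain: the union bound runs over all points of the domain. -/
theorem IsModel.ofReal_one_sub_le_measure_regret_le_of_finite [Finite S]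
    (hM : IsModel P k σ f ε U) (hσ : 0 < σ) {κ : ℝ}
    (hκ : 0 < κ) (hk : ∀ s, κ ≤ k s s ∧ k s s ≤ 1) {δ : ℝ} (hδ : 0 < δ) (hδ1 : δ < 1)
    {x : ℕ → Ω → S} (hx : IsAdaptive f ε U x) (hS : 2 ≤ Nat.card S)
    (hEI : IsScaledEI P k σ (betaFinite (Nat.card S) δ) f ε x) :
    ENNReal.ofReal (1 - δ) ≤ P {ω | ∀ T : ℕ, 2 ≤ T → regret f x T ω ≤ regretConst σ κ *
      √(betaFinite (Nat.card S) δ T * (maxInfoGain P f ε T).toReal * T * Real.log T)} := by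
  have := Fintype.ofFinite S
  have hβ1 := one_le_betaFinite hS hδ hδ1
  have hc : ∀ᵐ ω ∂P, Continuous fun s => f s ω :=
    Filter.Eventually.of_forall fun ω => continuous_of_discreteTopology
  refine hM.ofReal_one_sub_le_measure_regret_le hσ hκ hk hβ1 (betaFinite_mono hS hδ) hEI hδ.le
    (B := ⋃ n : ℕ, ⋃ s ∈ (Finset.univ : Finset S),
      {ω | Deviates k σ f ε x n (√(betaFinite (Nat.card S) δ (n + 1))) s ω}) ?_
    (Filter.Eventually.of_forall fun ω hω => ?_)
  · rw [← tsum_ofReal_inv_sq hδ.le]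
    refine (measure_iUnion_le _).trans (ENNReal.tsum_le_tsum fun n => ?_)
    refine (measure_biUnion_finset_le _ _).trans ((Finset.sum_le_sum fun s _ =>
      hM.measure_deviates_le hσ hc hx n (zero_le_one.trans (hβ1 n)) s).trans (le_of_eq ?_))
    rw [Finset.sum_const, Finset.card_univ, nsmul_eq_mul, ← ENNReal.ofReal_natCast,
      ← ENNReal.ofReal_mul (Nat.cast_nonneg _), ← Nat.card_eq_fintype_card,
      exp_neg_betaFinite hS hδ]
  · have h : ∀ n s, ¬ Deviates k σ f ε x n (√(betaFinite (Nat.card S) δ (n + 1))) s ω := by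
      intro n s hns
      exact hω (Set.mem_iUnion.2 ⟨n, Set.mem_biUnion (Finset.mem_univ s) hns⟩)
    exact ⟨fun n i _ => h n _, fun n t => ⟨t, by simp; positivity, h n t⟩⟩

end Finite

/-! ### Continuous domains -/

lemma exists_finset_of_finite_range {α ι : Type*} [Fintype ι] (c : α → ι) :
    ∃ A : Finset α, A.card ≤ Fintype.card ι ∧ ∀ t, ∃ t' ∈ A, c t' = c t := by
  classical
  refine ⟨Finset.univ.image fun i : Set.range c => i.2.choose, ?_, fun t => ?_⟩
  · exact Finset.card_image_le.trans (Fintype.card_subtype_le _)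
  · exact ⟨_, Finset.mem_image_of_mem _ (Finset.mem_univ ⟨c t, t, rfl⟩),
      (⟨c t, t, rfl⟩ : Set.range c).2.choose_spec⟩

/-- A subset of `[0, r]^d` contains a net of at most `m ^ d` points of mesh `r / m`: one point in
each cell of a grid that it meets. -/
lemma exists_net {d : ℕ} {X : Set (Fin d → ℝ)} {r : ℝ} (hr : 0 < r)
    (hX : X ⊆ Set.Icc 0 fun _ => r) {m : ℕ} (hm : 1 ≤ m) :
    ∃ A : Finset X, A.card ≤ m ^ d ∧ ∀ t : X, ∃ t' ∈ A, ‖(t : Fin d → ℝ) - t'‖ ≤ r / m := by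
  have hm0 : (0 : ℝ) < m := by exact_mod_cast hm
  obtain ⟨A, hA, hnet⟩ := exists_finset_of_finite_range
    (fun (t : X) (j : Fin d) => (⟨min ⌊(t : Fin d → ℝ) j * m / r⌋₊ (m - 1), by omega⟩ : Fin m))
  refine ⟨A, by simpa using hA, fun t => ?_⟩
  obtain ⟨t', ht', h⟩ := hnet t
  refine ⟨t', ht', (pi_norm_le_iff_of_nonneg (by positivity)).2 fun j => ?_⟩
  have key : ∀ t : X, ((min ⌊(t : Fin d → ℝ) j * m / r⌋₊ (m - 1) : ℕ) : ℝ) ≤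
        (t : Fin d → ℝ) j * m / r ∧
      (t : Fin d → ℝ) j * m / r ≤ ((min ⌊(t : Fin d → ℝ) j * m / r⌋₊ (m - 1) : ℕ) : ℝ) + 1 := by
    intro t
    have h0 : 0 ≤ (t : Fin d → ℝ) j := (hX t.2).1 j
    have h1 : (t : Fin d → ℝ) j ≤ r := (hX t.2).2 j
    have hu0 : 0 ≤ (t : Fin d → ℝ) j * m / r := by positivity
    have hu1 : (t : Fin d → ℝ) j * m / r ≤ m := by
      rw [div_le_iff₀ hr]
      nlinarith
    refine ⟨le_trans (by exact_mod_cast min_le_left _ _) (Nat.floor_le hu0), ?_⟩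
    rcases min_choice ⌊(t : Fin d → ℝ) j * m / r⌋₊ (m - 1) with h | h <;> rw [h]
    · exact (Nat.lt_floor_add_one _).le
    · rw [Nat.cast_sub hm]
      simpa using hu1
  have hj : min ⌊(t' : Fin d → ℝ) j * m / r⌋₊ (m - 1) = min ⌊(t : Fin d → ℝ) j * m / r⌋₊ (m - 1) :=
    congrArg Fin.val (congrFun h j)
  have k1 := key t
  have k2 := key t'
  rw [hj] at k2
  have h3 : |(t : Fin d → ℝ) j * m / r - (t' : Fin d → ℝ) j * m / r| ≤ 1 :=
    abs_sub_le_iff.2 ⟨by linarith, by linarith⟩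
  have h4 : (t : Fin d → ℝ) j * m / r - (t' : Fin d → ℝ) j * m / r =
      ((t : Fin d → ℝ) j - (t' : Fin d → ℝ) j) * (m / r) := by ring
  rw [h4, abs_mul, abs_of_pos (div_pos hm0 hr)] at h3
  rw [Pi.sub_apply, Real.norm_eq_abs, le_div_iff₀ hm0]
  have h5 : |(t : Fin d → ℝ) j - (t' : Fin d → ℝ) j| * (m / r) * r =
      |(t : Fin d → ℝ) j - (t' : Fin d → ℝ) j| * m := by field_simp
  nlinarith

lemma opNorm_le_of_apply_single_le {d : ℕ} (L : (Fin d → ℝ) →L[ℝ] ℝ) {c : ℝ} (hc : 0 ≤ c)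
    (h : ∀ j, ‖L (Pi.single j 1)‖ ≤ c) : ‖L‖ ≤ d * c := by
  refine L.opNorm_le_bound (by positivity) fun v => ?_
  have e : L v = ∑ j, v j * L (Pi.single j 1) := by
    conv_lhs => rw [pi_eq_sum_univ' v]
    rw [map_sum]
    refine Finset.sum_congr rfl fun j _ => ?_
    rw [map_smul, smul_eq_mul]
  rw [e]
  calc ‖∑ j, v j * L (Pi.single j 1)‖ ≤ ∑ j : Fin d, ‖v‖ * c :=
        norm_sum_le_of_le _ fun j _ => by
          rw [norm_mul]
          exact mul_le_mul (norm_le_pi_norm v j) (h j) (norm_nonneg _) (norm_nonneg _)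
    _ = d * c * ‖v‖ := by
        rw [Finset.sum_const, Finset.card_univ, Fintype.card_fin, nsmul_eq_mul]
        ring

section Smooth

variable {d : ℕ} {X : Set (Fin d → ℝ)} {Ω 𝒰 : Type*} [MeasurableSpace Ω] [MeasurableSpace 𝒰]
  {P : Measure Ω} {k : X → X → ℝ} {σ : ℝ≥0} {f : X → Ω → ℝ} {ε : ℕ → Ω → ℝ} {U : Ω → 𝒰}
  {r a b : ℝ}

lemma SmoothPaths.ae_continuous (h : SmoothPaths P f r a b) :
    ∀ᵐ ω ∂P, Continuous fun s => f s ω := by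
  obtain ⟨-, -, -, -, -, -, D, hD, -⟩ := h
  filter_upwards [hD] with ω hω
  have h1 : ContinuousOn (Function.extend Subtype.val (fun s' : X => f s' ω) 0) X :=
    fun s hs => (hω ⟨s, hs⟩).continuousWithinAt
  have h2 := continuousOn_iff_continuous_domRestrict.1 h1
  have h3 : X.domRestrict (Function.extend Subtype.val (fun s' : X => f s' ω) 0) =
      fun s => f s ω := by
    funext s
    rw [Set.domRestrict_apply, Subtype.val_injective.extend_apply]
  rwa [h3] at h2

/-- With high probability the paths are Lipschitz, with a constant that the grids of the confidence
parameter take into account. -/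
lemma SmoothPaths.exists_lipschitz (h : SmoothPaths P f r a b) (hd : 1 ≤ d) {δ : ℝ} (hδ : 0 < δ)
    (hδ1 : δ < 1) : ∃ B : Set Ω, P B ≤ ENNReal.ofReal (δ / 2) ∧ ∀ᵐ ω ∂P, ω ∉ B → ∀ s t : X,
      |f s ω - f t ω| ≤ d * (b * √(Real.log (4 * a * d / δ))) * ‖(s : Fin d → ℝ) - t‖ := by
  obtain ⟨hr, ha, hb, -, hconv, -, D, hD, htail⟩ := h
  have hd1 : (1 : ℝ) ≤ d := by exact_mod_cast hd
  have hquot : 1 < 4 * a * d / δ := by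
    rw [one_lt_div hδ]
    nlinarith
  have hlog : 0 < Real.log (4 * a * d / δ) := Real.log_pos hquot
  set c := b * √(Real.log (4 * a * d / δ)) with hc
  have hc0 : 0 < c := mul_pos hb (Real.sqrt_pos.2 hlog)
  have hexp : a * Real.exp (-(c / b) ^ 2) = δ / (4 * d) := by
    rw [hc, mul_div_cancel_left₀ _ hb.ne', Real.sq_sqrt hlog.le, Real.exp_neg,
      Real.exp_log (by linarith)]
    field_simp
  refine ⟨⋃ j : Fin d, {ω | ENNReal.ofReal c < ⨆ s : X, ‖D s ω (Pi.single j 1)‖ₑ}, ?_, ?_⟩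
  · refine (measure_iUnion_le _).trans ?_
    rw [tsum_fintype]
    refine (Finset.sum_le_sum fun j _ => htail j c hc0).trans ?_
    rw [hexp, Finset.sum_const, Finset.card_univ, Fintype.card_fin, nsmul_eq_mul,
      ← ENNReal.ofReal_natCast, ← ENNReal.ofReal_mul (Nat.cast_nonneg _)]
    refine ENNReal.ofReal_le_ofReal ?_
    have : (d : ℝ) * (δ / (4 * d)) = δ / 4 := by field_simp
    linarith
  · filter_upwards [hD] with ω hω hB s t
    classical
    have hj : ∀ (s : X) j, ‖D s ω (Pi.single j 1)‖ ≤ c := by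
      intro s j
      have h1 : ¬ ENNReal.ofReal c < ⨆ s : X, ‖D s ω (Pi.single j 1)‖ₑ := fun h =>
        hB (Set.mem_iUnion.2 ⟨j, h⟩)
      have h2 : ‖D s ω (Pi.single j 1)‖ₑ ≤ ENNReal.ofReal c :=
        (le_iSup (fun s : X => ‖D s ω (Pi.single j 1)‖ₑ) s).trans (not_lt.1 h1)
      rwa [← ofReal_norm, ENNReal.ofReal_le_ofReal_iff hc0.le] at h2
    have h := hconv.norm_image_sub_le_of_norm_hasFDerivWithin_le
      (f := Function.extend Subtype.val (fun s' : X => f s' ω) 0)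
      (f' := fun z => if hz : z ∈ X then D ⟨z, hz⟩ ω else 0) (C := d * c)
      (fun z hz => by rw [dif_pos hz]; exact hω ⟨z, hz⟩)
      (fun z hz => by rw [dif_pos hz]; exact opNorm_le_of_apply_single_le _ hc0.le (hj _))
      t.2 s.2
    rwa [Subtype.val_injective.extend_apply, Subtype.val_injective.extend_apply] at h

/-- The regret bound on a continuous domain: half of `δ` pays for the Lipschitz bound on the paths,
the other half for the union bound over grid points and queries. -/
theorem IsModel.ofReal_one_sub_le_measure_regret_le_of_smoothPaths [IsProbabilityMeasure P]
    (hM : IsModel P k σ f ε U) (hσ : 0 < σ) {κ : ℝ}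
    (hκ : 0 < κ) (hk : ∀ s, κ ≤ k s s ∧ k s s ≤ 1) {δ : ℝ} (hδ : 0 < δ) (hδ1 : δ < 1)
    {x : ℕ → Ω → X} (hx : IsAdaptive f ε U x) (hd : 1 ≤ d) (hf : SmoothPaths P f r a b)
    (hEI : IsScaledEI P k σ (betaCont d r a b δ) f ε x) :
    ENNReal.ofReal (1 - δ) ≤ P {ω | ∀ T : ℕ, 2 ≤ T → regret f x T ω ≤ regretConst σ κ *
      √(betaCont d r a b δ T * (maxInfoGain P f ε T).toReal * T * Real.log T)} := by
  have hc := hf.ae_continuous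
  obtain ⟨BL, hBL, hlip⟩ := hf.exists_lipschitz hd hδ hδ1
  obtain ⟨hr, ha, hb, -, -, hX, -⟩ := hf
  have hβ1 := one_le_betaCont (d := d) (r := r) (a := a) (b := b) hδ hδ1
  have hd1 : (1 : ℝ) ≤ d := by exact_mod_cast hd
  have hlog : 0 < Real.log (4 * a * d / δ) := by
    refine Real.log_pos ?_
    rw [one_lt_div hδ]
    nlinarith
  have hsq := Real.sqrt_pos.2 hlog
  have hmesh : ∀ n : ℕ, 1 ≤ meshCount d r a b δ (n + 1) := fun n => by
    refine Nat.one_le_ceil_iff.2 ?_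
    push_cast
    positivity
  choose A hAcard hA using fun n => exists_net hr hX (hmesh n)
  refine hM.ofReal_one_sub_le_measure_regret_le hσ hκ hk hβ1
    (betaCont_mono hb.le hr.le hδ) hEI hδ.le
    (B := BL ∪ ⋃ n : ℕ,
      ((⋃ s ∈ A n, {ω | Deviates k σ f ε x n (√(betaCont d r a b δ (n + 1))) s ω}) ∪
      ⋃ i ∈ Finset.range (n + 1),
        {ω | Deviates k σ f ε x n (√(betaCont d r a b δ (n + 1))) (x i ω) ω})) ?_ ?_
  · rw [← add_halves δ, ENNReal.ofReal_add (by linarith) (by linarith), add_halves]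
    refine (measure_union_le _ _).trans (add_le_add hBL ?_)
    rw [← tsum_ofReal_inv_sq (p := δ / 2) (by linarith)]
    refine (measure_iUnion_le _).trans (ENNReal.tsum_le_tsum fun n => ?_)
    have hβ0 := zero_le_one.trans (hβ1 n)
    refine le_trans ?_ (ENNReal.ofReal_le_ofReal (exp_neg_betaCont_le (r := r) (a := a) (b := b) hd hδ n))
    set p := Real.exp (-betaCont d r a b δ (n + 1) / 2) with hp
    have hp0 : 0 < p := Real.exp_pos _
    have h1 : P (⋃ s ∈ A n, {ω | Deviates k σ f ε x n (√(betaCont d r a b δ (n + 1))) s ω}) ≤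
        ENNReal.ofReal ((meshCount d r a b δ (n + 1) : ℝ) ^ d * p) := by
      refine (measure_biUnion_finset_le _ _).trans ((Finset.sum_le_sum fun s _ =>
        hM.measure_deviates_le hσ hc hx n hβ0 s).trans ?_)
      rw [Finset.sum_const, nsmul_eq_mul, ← ENNReal.ofReal_natCast,
        ← ENNReal.ofReal_mul (Nat.cast_nonneg _)]
      refine ENNReal.ofReal_le_ofReal (mul_le_mul_of_nonneg_right ?_ hp0.le)
      exact_mod_cast hAcard n
    have h2 : P (⋃ i ∈ Finset.range (n + 1),
        {ω | Deviates k σ f ε x n (√(betaCont d r a b δ (n + 1))) (x i ω) ω}) ≤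
        ENNReal.ofReal (((n : ℝ) + 1) * p) := by
      refine (measure_biUnion_finset_le _ _).trans ((Finset.sum_le_sum fun i hi =>
        hM.measure_deviates_query_le hσ hc hx (Nat.lt_succ_iff.1 (Finset.mem_range.1 hi))
          hβ0).trans (le_of_eq ?_))
      rw [Finset.sum_const, Finset.card_range, nsmul_eq_mul, ← ENNReal.ofReal_natCast,
        ← ENNReal.ofReal_mul (Nat.cast_nonneg _)]
      push_cast
      rfl
    rw [add_mul, ENNReal.ofReal_add (by positivity) (by positivity)]
    exact (measure_union_le _ _).trans (add_le_add h1 h2)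
  · filter_upwards [hlip] with ω hω hB
    rw [Set.mem_union, not_or] at hB
    have hB2 : ∀ n, ω ∉ ((⋃ s ∈ A n,
          {ω | Deviates k σ f ε x n (√(betaCont d r a b δ (n + 1))) s ω}) ∪
        ⋃ i ∈ Finset.range (n + 1),
          {ω | Deviates k σ f ε x n (√(betaCont d r a b δ (n + 1))) (x i ω) ω}) :=
      fun n hn => hB.2 (Set.mem_iUnion.2 ⟨n, hn⟩)
    refine ⟨fun n i hi hdev => hB2 n (Or.inr (Set.mem_biUnion
      (Finset.mem_range.2 (Nat.lt_succ_of_le hi)) hdev)), fun n t => ?_⟩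
    obtain ⟨t', ht', hdist⟩ := hA n t
    refine ⟨t', ?_, fun hdev => hB2 n (Or.inl (Set.mem_biUnion ht' hdev))⟩
    have h1 := (abs_le.1 (hω hB.1 t t')).2
    set c := b * √(Real.log (4 * a * d / δ)) with hcdef
    have hm0 : (0 : ℝ) < meshCount d r a b δ (n + 1) := by exact_mod_cast hmesh n
    have hm : b * d * r * ((n + 1 : ℕ) : ℝ) ^ 2 * √(Real.log (4 * a * d / δ)) ≤
        meshCount d r a b δ (n + 1) := Nat.le_ceil _
    have h2 : d * c * ‖(t : Fin d → ℝ) - t'‖ ≤ d * c * (r / meshCount d r a b δ (n + 1)) := by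
      gcongr
    have h3 : d * c * (r / meshCount d r a b δ (n + 1)) ≤ 1 / ((n : ℝ) + 1) ^ 2 := by
      rw [← mul_div_assoc, div_le_div_iff₀ hm0 (by positivity)]
      push_cast at hm
      calc d * c * r * ((n : ℝ) + 1) ^ 2
          = b * d * r * ((n : ℝ) + 1) ^ 2 * √(Real.log (4 * a * d / δ)) := by rw [hcdef]; ring
        _ ≤ _ := by linarith
    linarith

end Smooth

lemma regret_of_subsingleton {S Ω : Type*} [Subsingleton S] (f : S → Ω → ℝ) (x : ℕ → Ω → S)
    (T : ℕ) (ω : Ω) : regret f x T ω = 0 := by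
  refine Finset.sum_eq_zero fun n _ => ?_
  have : Nonempty S := ⟨x n ω⟩
  rw [ciSup_subsingleton (x n ω) fun s => f s ω, sub_self]

end GPEI

theorem mainTheorem9 (σ : ℝ≥0) (hσ : 0 < σ) (κ : ℝ) (hκ : 0 < κ) :
    ∃ C : ℝ, 0 < C ∧
      ∀ (d : ℕ) (X : Set (Fin d → ℝ)) (k : X → X → ℝ)
        (_ : ∀ s, κ ≤ k s s ∧ k s s ≤ 1)
        (Ω : Type*) [MeasurableSpace Ω] (P : Measure Ω) [IsProbabilityMeasure P]
        (𝒰 : Type*) [MeasurableSpace 𝒰]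
        (f : X → Ω → ℝ) (ε : ℕ → Ω → ℝ) (U : Ω → 𝒰) (_ : GPEI.IsModel P k σ f ε U)
        (δ : ℝ) (_ : 0 < δ) (_ : δ < 1)
        (β : ℕ → ℝ)
        (_ : (X.Finite ∧ β = GPEI.betaFinite X.ncard δ) ∨
          (∃ r a b : ℝ, GPEI.SmoothPaths P f r a b ∧ β = GPEI.betaCont d r a b δ))
        (x : ℕ → Ω → X) (_ : GPEI.IsAdaptive f ε U x) (_ : GPEI.IsScaledEI P k σ β f ε x),
        ENNReal.ofReal (1 - δ) ≤
          P {ω | ∀ T : ℕ, 2 ≤ T →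
            GPEI.regret f x T ω ≤
              C * Real.sqrt (β T * (GPEI.maxInfoGain P f ε T).toReal * T * Real.log T)} := by
  refine ⟨GPEI.regretConst σ κ, GPEI.regretConst_pos σ hκ, ?_⟩
  intro d X k hk Ω _ P _ 𝒰 _ f ε U hM δ hδ hδ1 β hβ x hx hEI
  rcases subsingleton_or_nontrivial X with hX | hX
  · -- On a domain with one point the regret vanishes, and `β` may be smaller than `1`.
    have hall : {ω | ∀ T : ℕ, 2 ≤ T → GPEI.regret f x T ω ≤ GPEI.regretConst σ κ *
        Real.sqrt (β T * (GPEI.maxInfoGain P f ε T).toReal * T * Real.log T)} = Set.univ := by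
      refine Set.eq_univ_of_forall fun ω T _ => ?_
      rw [GPEI.regret_of_subsingleton]
      have := GPEI.regretConst_pos σ hκ
      positivity
    rw [hall, measure_univ]
    exact ENNReal.ofReal_le_one.2 (by linarith)
  · rcases hβ with ⟨hfin, rfl⟩ | ⟨r, a, b, hf, rfl⟩
    · have : Finite X := hfin
      have hcard : X.ncard = Nat.card X := (Nat.card_coe_set_eq X).symm
      rw [hcard] at hEI ⊢
      exact hM.ofReal_one_sub_le_measure_regret_le_of_finite hσ hκ hk hδ hδ1 hx
        Finite.one_lt_card hEI
    · have hd : 1 ≤ d := by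
        rcases Nat.eq_zero_or_pos d with rfl | hd
        · exact absurd hX (not_nontrivial _)
        · exact hd
      exact hM.ofReal_one_sub_le_measure_regret_le_of_smoothPaths hσ hκ hk hδ hδ1 hx hd hf hEI
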